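/- **Setting.** Let $d\ge 1$, $T>0$, and let $(\Omega,\mathcal A,\mathbb P)$ be a complete probability space. Let $\mathcal D$ be the space of smooth compactly supported real functions on $[0,\infty)\times\mathbb R^d$, and write $\mathcal F f(\xi)=\int_{\mathbb R^d}e^{-i\langle \xi,x\rangle}f(x)\,dx$. Let $\mu$ be a non-negative tempered measure on $\mathbb R^d$ and let $W=\{W(\varphi),\ \varphi\in\mathcal D\}$ be a centered Gaussian process with $$\mathbb E[W(\varphi)W(\psi)]=\int_0^\infty\int_{\mathbb R^d}\mathcal F\varphi(t,\cdot)(\xi)\,\overline{\mathcal F\psi(t,\cdot)(\xi)}\,\mu(d\xi)\,dt,\qquad \varphi,\psi\in\mathcal D.$$ For $g$ in the completion of $\mathcal D$ for this inner product, $W(g)=\int_0^\infty\int_{\mathbb R^d} g(t,x)\,W(dt,dx)$ denotes the $L^2(\mathbb P)$-isometric extension of $W$ (Wiener integral). Let $\mathcal F_t$ be the $\sigma$-algebra generated by the variables $W(\mathbf 1_{[0,s]}\varphi)$, $s\in[0,t]$, $\varphi\in\mathcal D$, and the $\mathbb P$-null sets. Let $G_t(x)=(2\pi t)^{-d/2}e^{-|x|^2/(2t)}$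 for $t>0$, let $b:\mathbb R\to\mathbb R$ be globally Lipschitz and let $u_0:\mathbb R^d\to\mathbb R$. A *mild solution* on $[0,T]\times\mathbb R^d$ of the stochastic heat equation $$\partial_t u-\tfrac12\Delta u=b(u)+\dot W,\qquad u(0,\cdot)=u_0,$$ is a jointly measurable, $(\mathcal F_t)$-adapted process $u=\{u(t,x),\ (t,x)\in[0,T]\times\mathbb R^d\}$ such that for every $(t,x)\in[0,T]\times\mathbb R^d$, almost surely, $$u(t,x)=I_0(t,x)+\int_0^t\int_{\mathbb R^d}G_{t-s}(x-y)\,W(ds,dy)+\int_0^t\int_{\mathbb R^d} b(u(s,y))\,G_{t-s}(x-y)\,dy\,ds,$$ the last integral being absolutely convergent, where $I_0(t,\cdot)=u_0*G_t$ for $t>0$ and $I_0(0,\cdot)=u_0$. **Proposition.** Assume that $u_0$ is bounded and $\alpha$-Hölder continuous on $\mathbb R^d$ for some $\alpha\in(0,1)$, and that for some $q\in(0,2)$ $$\int_{\mathbb R^d}\frac{\mu(d\xi)}{1+|\xi|^q}<\infty .$$ Let $u$ be the mild solution with $\sup_{(t,x)\in[0,T]\times\mathbb R^d}\mathbb E|u(t,x)|^2<\infty$,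 and put $\beta=\min(\alpha,1-\tfrac q2)$. Then for every real $p\ge1$ there is a constant $C>0$ such that $$\sup_{t\in[0,T]}\mathbb E|u(t,x)-u(t,z)|^p\le C\,|x-z|^{p\beta}\qquad\text{for all }x,z\in\mathbb R^d,$$ $$\sup_{x\in\mathbb R^d}\mathbb E|u(t,x)-u(s,x)|^p\le C\,|t-s|^{p\beta/2}\qquad\text{for all }s,t\in[0,T].$$ Consequently $u$ has a version with jointly Hölder continuous paths: there is a process $w$ with $w(t,x)=u(t,x)$ almost surely for each $(t,x)\in[0,T]\times\mathbb R^d$ such that, for every $\omega\in\Omega$, every $\theta\in(0,\beta)$ and every $R>0$, there is $C=C(\omega,\theta,R)$ with $$|w(t,x)(\omega)-w(s,z)(\omega)|\le C\big(|t-s|^{\theta/2}+|x-z|^{\theta}\big)\qquad\text{for all }s,t\in[0,T],\ |x|,|z|\le R.$$ -/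

import Mathlib

open MeasureTheory ProbabilityTheory Filter Topology
open scoped NNReal ENNReal ComplexConjugate Distributions

noncomputable section

/-- Euclidean space `ℝ^d`. -/
abbrev SpaceE (d : ℕ) : Type := EuclideanSpace ℝ (Fin d)

/-- Test functions: real-valued smooth compactly supported functions of `(t, x) ∈ ℝ × ℝ^d`.
Only their restrictions to `[0, ∞) × ℝ^d` enter below, and these restrictions are exactly the
smooth compactly supported functions on `[0, ∞) × ℝ^d`. -/
abbrev TestFn (d : ℕ) : Type := 𝓓((⊤ : TopologicalSpace.Opens (ℝ × SpaceE d)), ℝ)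

/-- Fourier transform in the space variable of `g(t, ·)`, with the normalisation
`ℱ f (ξ) = ∫ exp(-i ⟨ξ, x⟩) f(x) dx`. -/
def spaceFourier {d : ℕ} (g : ℝ → SpaceE d → ℝ) (t : ℝ) (ξ : SpaceE d) : ℂ :=
  ∫ x : SpaceE d, Complex.exp (-(Complex.I * ((inner ℝ ξ x : ℝ) : ℂ))) * (g t x : ℂ)

/-- `W` is a spatially homogeneous centered Gaussian noise, white in time, with spectral measure
`μ`: a Gaussian process indexed by the test functions, with mean zero and covariance
`E[W(φ) W(ψ)] = ∫_0^∞ ∫ ℱφ(t,·)(ξ) conj(ℱψ(t,·)(ξ)) μ(dξ) dt`, where `μ` is tempered. -/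
structure IsHomogeneousNoise {d : ℕ} {Ω : Type*} [MeasurableSpace Ω] (P : Measure Ω)
    (μ : Measure (SpaceE d)) (W : TestFn d → Ω → ℝ) : Prop where
  tempered : μ.HasTemperateGrowth
  gaussian : IsGaussianProcess W P
  mean_zero : ∀ φ, ∫ ω, W φ ω ∂P = 0
  covariance : ∀ φ ψ : TestFn d,
    ((∫ ω, W φ ω * W ψ ω ∂P : ℝ) : ℂ) =
      ∫ t in Set.Ioi (0 : ℝ), ∫ ξ,
        spaceFourier (fun s x => φ (s, x)) t ξ *
          conj (spaceFourier (fun s x => ψ (s, x)) t ξ) ∂μ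

/-- `X` is (a version of) the Wiener integral `W(g) = ∫_0^∞ ∫ g(t,x) W(dt,dx)` of a deterministic
function `g` on `[0, ∞) × ℝ^d`: there are test functions `φ_k` converging to `g` for the norm of
the Hilbert space of the noise, that is,
`∫_0^∞ ∫ |ℱφ_k(t,·)(ξ) - ℱg(t,·)(ξ)|² μ(dξ) dt → 0`, such that `W(φ_k) → X` in `L²(P)`.
By the isometry property of `W`, the random variable `X` is determined almost surely. -/
def IsWienerIntegral {d : ℕ} {Ω : Type*} [MeasurableSpace Ω] (P : Measure Ω)
    (μ : Measure (SpaceE d)) (W : TestFn d → Ω → ℝ) (g : ℝ → SpaceE d → ℝ) (X : Ω → ℝ) : Prop :=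
  MemLp X 2 P ∧ ∃ φ : ℕ → TestFn d,
    Tendsto (fun k => ∫⁻ t in Set.Ioi (0 : ℝ), ∫⁻ ξ,
      ‖spaceFourier (fun s x => φ k (s, x)) t ξ - spaceFourier g t ξ‖ₑ ^ 2 ∂μ) atTop (𝓝 0) ∧
    Tendsto (fun k => eLpNorm (W (φ k) - X) 2 P) atTop (𝓝 0)

/-- The σ-algebra `ℱ_t` generated by the variables `W(1_{[0,s]} φ)`, `0 ≤ s ≤ t`, `φ` a test
function, and by the `P`-null sets. Since the null sets are included it does not matter which
versions of the Wiener integrals are used; all of them are taken. -/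
abbrev noiseSigma {d : ℕ} {Ω : Type*} [MeasurableSpace Ω] (P : Measure Ω)
    (μ : Measure (SpaceE d)) (W : TestFn d → Ω → ℝ) (t : ℝ) : MeasurableSpace Ω :=
  MeasurableSpace.generateFrom
    ({A | MeasurableSet A ∧ P A = 0} ∪
      {A | ∃ s ∈ Set.Icc (0 : ℝ) t, ∃ (φ : TestFn d) (X : Ω → ℝ) (B : Set ℝ),
        Measurable X ∧
        IsWienerIntegral P μ W (fun r y => (Set.Icc 0 s).indicator (fun r' => φ (r', y)) r) X ∧
        MeasurableSet B ∧ A = X ⁻¹' B})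

/-- The heat kernel `G_t(x) = (2πt)^{-d/2} exp(-|x|²/(2t))`, used for `t > 0`. -/
def gaussKernel {d : ℕ} (t : ℝ) (x : SpaceE d) : ℝ :=
  1 / (2 * Real.pi * t) ^ ((d : ℝ) / 2) * Real.exp (-(‖x‖ ^ 2 / (2 * t)))

/-- Solution `I_0(t,x) = (u_0 * G_t)(x)` of the deterministic linear heat equation, with
`I_0(0,x) = u_0(x)`. -/
def heatFlow {d : ℕ} (u₀ : SpaceE d → ℝ) (t : ℝ) (x : SpaceE d) : ℝ :=
  if 0 < t then ∫ y, gaussKernel t (x - y) * u₀ y else u₀ x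

/-- The deterministic integrand `(s,y) ↦ 1_{[0,t)}(s) G_{t-s}(x-y)` of the stochastic
convolution. -/
def convolutionIntegrand {d : ℕ} (t : ℝ) (x : SpaceE d) (s : ℝ) (y : SpaceE d) : ℝ :=
  (Set.Ico 0 t).indicator (fun r => gaussKernel (t - r) (x - y)) s

/-- `u` is a mild solution on `[0,T] × ℝ^d` of the stochastic heat equation
`∂_t u - (1/2) Δu = b(u) + Ẇ`, `u(0,·) = u₀`: it is jointly measurable, adapted, and for all
`(t,x) ∈ [0,T] × ℝ^d` almost surely
`u(t,x) = I_0(t,x) + ∫_0^t ∫ G_{t-s}(x-y) W(ds,dy) + ∫_0^t (b(u(s,·)) * G_{t-s})(x) ds`,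
where the last integral converges absolutely. -/
structure IsMildHeatSolution {d : ℕ} {Ω : Type*} [MeasurableSpace Ω] (P : Measure Ω)
    (μ : Measure (SpaceE d)) (W : TestFn d → Ω → ℝ) (b : ℝ → ℝ) (u₀ : SpaceE d → ℝ) (T : ℝ)
    (u : ℝ → SpaceE d → Ω → ℝ) : Prop where
  jointly_measurable :
    Measurable (fun z : Set.Icc (0 : ℝ) T × SpaceE d × Ω => u z.1 z.2.1 z.2.2)
  adapted : ∀ t ∈ Set.Icc (0 : ℝ) T, ∀ x, Measurable[noiseSigma P μ W t] (u t x)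
  integrable : ∀ t ∈ Set.Icc (0 : ℝ) T, ∀ x, ∀ᵐ ω ∂P,
    Integrable (fun z : ℝ × SpaceE d => b (u z.1 z.2 ω) * gaussKernel (t - z.1) (x - z.2))
      ((volume.restrict (Set.Ioo 0 t)).prod volume)
  mild : ∀ t ∈ Set.Icc (0 : ℝ) T, ∀ x, ∃ v : Ω → ℝ,
    IsWienerIntegral P μ W (convolutionIntegrand t x) v ∧
    ∀ᵐ ω ∂P, u t x ω = heatFlow u₀ t x + v ω +
      ∫ s in Set.Ioo 0 t, ∫ y, b (u s y ω) * gaussKernel (t - s) (x - y)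

end

/-! By the mild formula, an increment of `u` is the sum of an increment of the heat flow of `u₀`, of
a Wiener integral and of the drift integral. Each has `L^p` norm at most a constant times `ρ`, where
`ρ = |x-z|^β` in space and `ρ = |t-s|^(β/2)` in time.

Heat flow: after Brownian scaling it averages `u₀` over a fixed Gaussian
(`heatFlow_eq_integral_gaussKernel_one`), so the Hölder modulus of `u₀` passes through.

Wiener integral: it is a limit of Gaussian variables, so every moment is controlled by the squared
distance of the integrands in the noise space (`IsWienerIntegral.eLpNorm_sub_le`). On the Fourier
side the squared kernel is `exp(-r|ξ|²)`, whose time integral is of order `1/(1+|ξ|²)`. A shift by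
`h` in squared space or in time costs a factor `(h|ξ|²)^β`. What remains is the `μ`-integral of
`(1+|ξ|²)^(-(1-β))`, finite because `2(1-β) ≥ q`.

Drift: the whole increment is put on the kernel, so no regularity of `u` is needed. The `L¹`
distance of two heat kernels, obtained from their Hellinger affinity, has a singularity `r^(-β/2)`
that is integrable in time. A Minkowski-type inequality then needs only moments of `b(u)` that are
uniform in `(t,x)`. These moments, for every `p`, come from the second moment bound by Gronwall.
Since Gronwall in `L^p` would presuppose finite `p`-th moments, the inequality is first paired with
a bounded random variable and the `L^p` norm is recovered by duality
(`lintegral_rpow_le_of_volterra`).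

Finally, moments of all orders in the parabolic distance `√|t-s| + |x-z|` feed a chaining argument
on dyadic grids (`exists_holder_modification`). Taking `p` large beats the polynomial growth of the
grids, so every exponent below `β` is reached. -/

/-! ### The heat kernel and its `L¹` modulus of continuity -/

/-- The `L¹` distance of two densities is controlled by their Hellinger affinity `∫ h`. -/
theorem integral_abs_sub_le_sqrt_of_affinity {E : Type*} [MeasurableSpace E] {m : Measure E}
    {f g h : E → ℝ} (hf0 : ∀ x, 0 ≤ f x) (hg0 : ∀ x, 0 ≤ g x) (hh0 : ∀ x, 0 ≤ h x)
    (hsq : ∀ x, h x ^ 2 = f x * g x) (hf : Integrable f m) (hg : Integrable g m)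
    (hh : Integrable h m) (hf1 : ∫ x, f x ∂m = 1) (hg1 : ∫ x, g x ∂m = 1) {a : ℝ} (ha : 0 < a)
    (hA : 1 - ∫ x, h x ∂m ≤ a) :
    ∫ x, |f x - g x| ∂m ≤ 3 * √a := by
  have hs : 0 < √a := Real.sqrt_pos.2 ha
  have hss : √a * √a = a := Real.mul_self_sqrt ha.le
  have hle : ∫ x, h x ∂m ≤ 1 := by
    have h1 : ∫ x, h x ∂m ≤ ∫ x, (f x + g x) / 2 ∂m := by
      refine integral_mono hh ((hf.add hg).div_const 2) fun x => ?_
      have := hsq x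
      have := hf0 x
      have := hg0 x
      have := hh0 x
      refine abs_le_of_sq_le_sq' ?_ (by positivity) |>.2
      nlinarith [sq_nonneg (f x - g x)]
    rw [integral_div, integral_add hf hg, hf1, hg1] at h1
    linarith
  -- With `h = √(fg)`, `(f-g)²` is the product of `(√f-√g)²` and `(√f+√g)²`, and AM–GM with weights
  -- `1/(2√a)` and `√a/2` splits its root. The two factors have integrals at most `2a` and `4`, so
  -- the weights yield `√a + 2√a`.
  have key : ∀ x, |f x - g x| ≤ (1 / (2 * √a)) * (f x + g x - 2 * h x)
      + (√a / 2) * (f x + g x + 2 * h x) := by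
    intro x
    have e := hsq x
    have h1 := hf0 x
    have h2 := hg0 x
    have h3 := hh0 x
    have hp : 0 ≤ f x + g x - 2 * h x := by
      have : |2 * h x| ≤ f x + g x := by
        refine abs_le_of_sq_le_sq ?_ (by positivity)
        nlinarith [sq_nonneg (f x - g x)]
      linarith [le_abs_self (2 * h x)]
    refine abs_le_of_sq_le_sq ?_ (by positivity)
    have e2 : (f x - g x) ^ 2 = (f x + g x - 2 * h x) * (f x + g x + 2 * h x) := by
      linear_combination 4 * e
    rw [e2]
    set P := f x + g x - 2 * h x
    set Q := f x + g x + 2 * h x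
    have e3 : P * Q = 4 * ((1 / (2 * √a)) * P) * ((√a / 2) * Q) := by field_simp; ring
    rw [e3]
    nlinarith [sq_nonneg ((1 / (2 * √a)) * P - (√a / 2) * Q)]
  calc ∫ x, |f x - g x| ∂m
      ≤ ∫ x, ((1 / (2 * √a)) * (f x + g x - 2 * h x) + (√a / 2) * (f x + g x + 2 * h x)) ∂m := by
        refine integral_mono (hf.sub hg).abs ?_ key
        exact (((hf.add hg).sub (hh.const_mul 2)).const_mul _).add
          (((hf.add hg).add (hh.const_mul 2)).const_mul _)
    _ = (1 / (2 * √a)) * (2 - 2 * ∫ x, h x ∂m) + (√a / 2) * (2 + 2 * ∫ x, h x ∂m) := by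
        rw [integral_add, integral_const_mul, integral_const_mul, integral_sub, integral_add,
          integral_add, integral_add, integral_const_mul, hf1, hg1]
        · ring
        · exact hf
        · exact hg
        · exact hf.add hg
        · exact hh.const_mul 2
        · exact hf
        · exact hg
        · exact hf.add hg
        · exact hh.const_mul 2
        · exact ((hf.add hg).sub (hh.const_mul 2)).const_mul _
        · exact ((hf.add hg).add (hh.const_mul 2)).const_mul _
    _ ≤ (1 / (2 * √a)) * (2 * a) + (√a / 2) * (2 + 2 * 1) := by
        gcongr
        linarith
    _ = 3 * √a := by
        rw [← hss]; field_simp; rw [Real.sqrt_sq hs.le]; ring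

/-- Interpolation of the affinity bound with the trivial bound `2`. -/
theorem lintegral_enorm_sub_le_rpow_of_affinity {E : Type*} [MeasurableSpace E] {m : Measure E}
    {f g h : E → ℝ} (hf0 : ∀ x, 0 ≤ f x) (hg0 : ∀ x, 0 ≤ g x) (hh0 : ∀ x, 0 ≤ h x)
    (hsq : ∀ x, h x ^ 2 = f x * g x) (hf : Integrable f m) (hg : Integrable g m)
    (hh : Integrable h m) (hf1 : ∫ x, f x ∂m = 1) (hg1 : ∫ x, g x ∂m = 1) {a : ℝ} (ha : 0 < a)
    (hA : 1 - ∫ x, h x ∂m ≤ a) {β : ℝ} (hβ0 : 0 ≤ β) (hβ1 : β ≤ 1) :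
    ∫⁻ x, ‖f x - g x‖ₑ ∂m ≤ ENNReal.ofReal (3 * a ^ (β / 2)) := by
  have h1 := integral_abs_sub_le_sqrt_of_affinity hf0 hg0 hh0 hsq hf hg hh hf1 hg1 ha hA
  have h2 : ∫ x, |f x - g x| ∂m ≤ 2 := by
    calc ∫ x, |f x - g x| ∂m ≤ ∫ x, (f x + g x) ∂m := by
          refine integral_mono (hf.sub hg).abs (hf.add hg) fun x => ?_
          exact abs_le.2 ⟨by linarith [hf0 x, hg0 x], by linarith [hf0 x, hg0 x]⟩
      _ = 2 := by rw [integral_add hf hg, hf1, hg1]; norm_num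
  have h3 : ∫ x, |f x - g x| ∂m ≤ 3 * a ^ (β / 2) := by
    rcases le_total a 1 with h | h
    · refine h1.trans ?_
      rw [Real.sqrt_eq_rpow]
      gcongr 3 * ?_
      exact Real.rpow_le_rpow_of_exponent_ge ha h (by linarith)
    · have : 1 ≤ a ^ (β / 2) := Real.one_le_rpow h (by linarith)
      linarith
  calc ∫⁻ x, ‖f x - g x‖ₑ ∂m = ENNReal.ofReal (∫ x, ‖f x - g x‖ ∂m) :=
        (ofReal_integral_norm_eq_lintegral_enorm (hf.sub hg)).symm
    _ ≤ _ := ENNReal.ofReal_le_ofReal h3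

theorem gaussKernel_nonneg {d : ℕ} {t : ℝ} (ht : 0 ≤ t) (x : SpaceE d) : 0 ≤ gaussKernel t x := by
  unfold gaussKernel
  have := Real.pi_pos
  positivity

theorem measurable_gaussKernel {d : ℕ} :
    Measurable (fun p : ℝ × SpaceE d => gaussKernel p.1 p.2) := by
  unfold gaussKernel
  fun_prop

theorem integrable_rexp_neg_mul_sq_norm {d : ℕ} {b : ℝ} (hb : 0 < b) :
    Integrable (fun x : SpaceE d => Real.exp (-b * ‖x‖ ^ 2)) := by
  have h := (GaussianFourier.integrable_cexp_neg_mul_sq_norm_add (V := SpaceE d) (b := (b : ℂ))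
    (by simpa using hb) 0 0).norm
  refine h.congr (Eventually.of_forall fun x => ?_)
  simp [Complex.norm_exp, ← Complex.ofReal_pow]

theorem gaussKernel_eq {d : ℕ} (t : ℝ) (x : SpaceE d) :
    gaussKernel t x = 1 / (2 * Real.pi * t) ^ ((d : ℝ) / 2) *
      Real.exp (-(1 / (2 * t)) * ‖x‖ ^ 2) := by
  unfold gaussKernel
  congr 2
  ring

theorem integrable_gaussKernel {d : ℕ} {t : ℝ} (ht : 0 < t) :
    Integrable (fun x : SpaceE d => gaussKernel t x) := by
  simp_rw [gaussKernel_eq]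
  exact (integrable_rexp_neg_mul_sq_norm (by positivity)).const_mul _

theorem integral_gaussKernel {d : ℕ} {t : ℝ} (ht : 0 < t) :
    ∫ x : SpaceE d, gaussKernel t x = 1 := by
  have := Real.pi_pos
  simp_rw [gaussKernel_eq]
  rw [integral_const_mul, GaussianFourier.integral_rexp_neg_mul_sq_norm (by positivity)]
  have e : Real.pi / (1 / (2 * t)) = 2 * Real.pi * t := by field_simp
  rw [e, finrank_euclideanSpace, Fintype.card_fin]
  have : (2 * Real.pi * t) ^ ((d : ℝ) / 2) ≠ 0 := by positivity
  field_simp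

theorem integrable_gaussKernel_sub {d : ℕ} {t : ℝ} (ht : 0 < t) (x : SpaceE d) :
    Integrable (fun y : SpaceE d => gaussKernel t (x - y)) :=
  (integrable_gaussKernel ht).comp_sub_left x

theorem integral_gaussKernel_sub {d : ℕ} {t : ℝ} (ht : 0 < t) (x : SpaceE d) :
    ∫ y : SpaceE d, gaussKernel t (x - y) = 1 := by
  rw [integral_sub_left_eq_self (fun y : SpaceE d => gaussKernel t y) volume x,
    integral_gaussKernel ht]

theorem lintegral_enorm_gaussKernel_sub {d : ℕ} {t : ℝ} (ht : 0 < t) (x : SpaceE d) :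
    ∫⁻ y : SpaceE d, ‖gaussKernel t (x - y)‖ₑ = 1 := by
  rw [← ofReal_integral_norm_eq_lintegral_enorm (integrable_gaussKernel_sub ht x)]
  simp_rw [Real.norm_of_nonneg (gaussKernel_nonneg ht.le _)]
  rw [integral_gaussKernel_sub ht, ENNReal.ofReal_one]

/-- The geometric mean of the Gaussians centred at `x` and `z` is `exp(-|x-z|²/(8r))` times the
Gaussian centred at the midpoint, by the parallelogram law. The affinity therefore falls short of
`1` by at most `|x-z|²/r`. -/
theorem lintegral_gaussKernel_sub_sub_le {d : ℕ} {r : ℝ} (hr : 0 < r) (x z : SpaceE d) {β : ℝ}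
    (hβ0 : 0 < β) (hβ1 : β ≤ 1) :
    ∫⁻ y : SpaceE d, ‖gaussKernel r (x - y) - gaussKernel r (z - y)‖ₑ ≤
      ENNReal.ofReal (3 * ‖x - z‖ ^ β * r ^ (-(β / 2))) := by
  rcases eq_or_ne x z with rfl | hxz
  · simp [Real.zero_rpow hβ0.ne']
  have hd : 0 < ‖x - z‖ := norm_pos_iff.2 (sub_ne_zero.2 hxz)
  set m : SpaceE d := (1 / 2 : ℝ) • (x + z)
  have hm : ∀ y : SpaceE d,
      ‖x - y‖ ^ 2 + ‖z - y‖ ^ 2 = 2 * ‖m - y‖ ^ 2 + ‖x - z‖ ^ 2 / 2 := by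
    intro y
    have e1 : m - y = (1 / 2 : ℝ) • ((x - y) + (z - y)) := by
      simp only [m]; module
    have e2 : x - z = (x - y) - (z - y) := by abel
    have e3 : ‖(1 / 2 : ℝ)‖ = 1 / 2 := by norm_num
    have := parallelogram_law_with_norm ℝ (x - y) (z - y)
    rw [← e2] at this
    rw [e1, norm_smul, mul_pow, e3]
    nlinarith
  have key := lintegral_enorm_sub_le_rpow_of_affinity (m := volume)
    (f := fun y => gaussKernel r (x - y)) (g := fun y => gaussKernel r (z - y))
    (h := fun y => Real.exp (-(‖x - z‖ ^ 2 / (8 * r))) * gaussKernel r (m - y))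
    (fun y => gaussKernel_nonneg hr.le _) (fun y => gaussKernel_nonneg hr.le _)
    (fun y => mul_nonneg (Real.exp_pos _).le (gaussKernel_nonneg hr.le _)) ?_
    (integrable_gaussKernel_sub hr x) (integrable_gaussKernel_sub hr z)
    ((integrable_gaussKernel_sub hr m).const_mul _) (integral_gaussKernel_sub hr x)
    (integral_gaussKernel_sub hr z) (a := ‖x - z‖ ^ 2 / r) (by positivity) ?_ hβ0.le hβ1
  · refine key.trans (ENNReal.ofReal_le_ofReal (le_of_eq ?_))
    rw [Real.div_rpow (by positivity) hr.le, Real.rpow_neg hr.le, ← Real.rpow_natCast,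
      ← Real.rpow_mul hd.le, mul_assoc, div_eq_mul_inv]
    congr 3
    push_cast
    ring_nf
  · intro y
    simp only [gaussKernel]
    have : Real.exp (-(‖x - z‖ ^ 2 / (8 * r))) * Real.exp (-(‖x - z‖ ^ 2 / (8 * r))) *
        (Real.exp (-(‖m - y‖ ^ 2 / (2 * r))) * Real.exp (-(‖m - y‖ ^ 2 / (2 * r)))) =
        Real.exp (-(‖x - y‖ ^ 2 / (2 * r))) * Real.exp (-(‖z - y‖ ^ 2 / (2 * r))) := by
      rw [← Real.exp_add, ← Real.exp_add, ← Real.exp_add, ← Real.exp_add]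
      congr 1
      field_simp
      linear_combination (8 : ℝ) * hm y
    linear_combination (1 / (2 * Real.pi * r) ^ ((d : ℝ) / 2)) ^ 2 * this
  · rw [integral_const_mul, integral_gaussKernel_sub hr, mul_one]
    have h1 := Real.add_one_le_exp (-(‖x - z‖ ^ 2 / (8 * r)))
    have h2 : ‖x - z‖ ^ 2 / (8 * r) ≤ ‖x - z‖ ^ 2 / r := by
      gcongr; linarith
    linarith

/-- The geometric mean of centred Gaussians of variances `r` and `r'` is `c^(d/2)` times the one
whose variance is their harmonic mean, `c` being the ratio of the geometric to the arithmetic mean.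
Only the larger time `r'` enters the singular factor. -/
theorem lintegral_gaussKernel_time_sub_le {d : ℕ} (hd : 1 ≤ d) {r r' : ℝ} (hr : 0 < r)
    (hrr : r ≤ r') (x : SpaceE d) {β : ℝ} (hβ0 : 0 < β) (hβ1 : β ≤ 1) :
    ∫⁻ y : SpaceE d, ‖gaussKernel r' (x - y) - gaussKernel r (x - y)‖ₑ ≤
      ENNReal.ofReal (3 * d * (r' - r) ^ (β / 2) * r' ^ (-(β / 2))) := by
  rcases hrr.eq_or_lt with rfl | hlt
  · simp
  have hr' : 0 < r' := hr.trans hlt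
  have hd0 : (1 : ℝ) ≤ d := by exact_mod_cast hd
  have hpi := Real.pi_pos
  set σ : ℝ := 2 * (r * r') / (r + r') with hσ
  have hσ0 : 0 < σ := by positivity
  set c : ℝ := 2 * √(r * r') / (r + r') with hc
  have hs : √(r * r') ^ 2 = r * r' := Real.sq_sqrt (by positivity)
  have hs0 : 0 < √(r * r') := Real.sqrt_pos.2 (by positivity)
  have hc0 : 0 < c := by positivity
  have hrs : r ≤ √(r * r') := Real.le_sqrt_of_sq_le (by nlinarith)
  have hc1 : 1 - c ≤ (r' - r) / r' := by
    have : 1 - c = (r + r' - 2 * √(r * r')) / (r + r') := by rw [hc]; field_simp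
    rw [this]
    have h1 : (r + r' - 2 * √(r * r')) ≤ r' - r := by linarith
    calc _ ≤ (r' - r) / (r + r') := by gcongr
      _ ≤ _ := by
        apply div_le_div_of_nonneg_left (by linarith) hr' (by linarith)
  have hcle : c ≤ 1 := by
    rw [hc, div_le_one (by positivity)]
    nlinarith [sq_nonneg (r - r'), Real.sqrt_nonneg (r * r')]
  have hcd : c * c = 4 * (r * r') / (r + r') ^ 2 := by
    rw [hc]; field_simp; rw [hs]; ring
  have key := lintegral_enorm_sub_le_rpow_of_affinity (m := volume)
    (f := fun y => gaussKernel r' (x - y)) (g := fun y => gaussKernel r (x - y))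
    (h := fun y => c ^ ((d : ℝ) / 2) * gaussKernel σ (x - y))
    (fun y => gaussKernel_nonneg hr'.le _) (fun y => gaussKernel_nonneg hr.le _)
    (fun y => mul_nonneg (by positivity) (gaussKernel_nonneg hσ0.le _)) ?_
    (integrable_gaussKernel_sub hr' x) (integrable_gaussKernel_sub hr x)
    ((integrable_gaussKernel_sub hσ0 x).const_mul _) (integral_gaussKernel_sub hr' x)
    (integral_gaussKernel_sub hr x) (a := d * ((r' - r) / r'))
    (mul_pos (by positivity) (div_pos (by linarith) hr')) ?_ hβ0.le hβ1
  · refine key.trans (ENNReal.ofReal_le_ofReal ?_)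
    have h0 : 0 ≤ r' - r := by linarith
    rw [Real.mul_rpow (by positivity) (by positivity), Real.div_rpow h0 hr'.le,
      Real.rpow_neg hr'.le, ← div_eq_mul_inv]
    have : (d : ℝ) ^ (β / 2) ≤ d := by
      calc (d : ℝ) ^ (β / 2) ≤ (d : ℝ) ^ (1 : ℝ) :=
            Real.rpow_le_rpow_of_exponent_le hd0 (by linarith)
        _ = d := Real.rpow_one _
    have h2 : 0 ≤ (r' - r) ^ (β / 2) / r' ^ (β / 2) := by positivity
    calc 3 * ((d : ℝ) ^ (β / 2) * ((r' - r) ^ (β / 2) / r' ^ (β / 2)))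
        ≤ 3 * ((d : ℝ) * ((r' - r) ^ (β / 2) / r' ^ (β / 2))) := by gcongr
      _ = _ := by ring
  · intro y
    simp only [gaussKernel]
    set n := ‖x - y‖ ^ 2
    have e1 : Real.exp (-(n / (2 * σ))) * Real.exp (-(n / (2 * σ))) =
        Real.exp (-(n / (2 * r'))) * Real.exp (-(n / (2 * r))) := by
      rw [← Real.exp_add, ← Real.exp_add]
      congr 1
      rw [hσ]; field_simp; ring
    have e2 : c ^ ((d : ℝ) / 2) * c ^ ((d : ℝ) / 2) *
        ((1 / (2 * Real.pi * σ) ^ ((d : ℝ) / 2)) * (1 / (2 * Real.pi * σ) ^ ((d : ℝ) / 2))) =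
        (1 / (2 * Real.pi * r') ^ ((d : ℝ) / 2)) * (1 / (2 * Real.pi * r) ^ ((d : ℝ) / 2)) := by
      rw [one_div_mul_one_div, one_div_mul_one_div, ← Real.mul_rpow hc0.le hc0.le,
        ← Real.mul_rpow (by positivity) (by positivity),
        ← Real.mul_rpow (by positivity) (by positivity), mul_one_div,
        ← Real.div_rpow (by positivity) (by positivity), one_div,
        ← Real.inv_rpow (by positivity)]
      congr 1
      rw [hcd, hσ]
      field_simp
      norm_num
    linear_combination (Real.exp (-(n / (2 * r'))) * Real.exp (-(n / (2 * r)))) * e2 +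
      (c ^ ((d : ℝ) / 2) * c ^ ((d : ℝ) / 2) *
        ((1 / (2 * Real.pi * σ) ^ ((d : ℝ) / 2)) *
          (1 / (2 * Real.pi * σ) ^ ((d : ℝ) / 2)))) * e1
  · rw [integral_const_mul, integral_gaussKernel_sub hσ0, mul_one]
    -- Since `c ≤ 1`, the exponent may be raised to the integer `d`, where Bernoulli's inequality
    -- gives `1 - c^d ≤ d(1-c)`.
    have h1 : c ^ d ≤ c ^ ((d : ℝ) / 2) := by
      rw [← Real.rpow_natCast]
      exact Real.rpow_le_rpow_of_exponent_ge hc0 hcle (by linarith)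
    have h2 := one_add_mul_le_pow (a := c - 1) (by linarith) d
    have h3 : (d : ℝ) * (1 - c) ≤ d * ((r' - r) / r') := by gcongr
    have e : 1 + (c - 1) = c := by ring
    rw [e] at h2
    linarith

/-! ### The solution of the deterministic heat equation -/

/-- For a bounded function the Hölder exponent can be lowered globally: at distances below `1` the
power increases, at larger distances the bound `2M` suffices. This is needed because `β` may be
smaller than `α`. -/
theorem MemHolder.exists_abs_sub_le_of_bounded {E : Type*} [NormedAddCommGroup E] {f : E → ℝ}
    {α : ℝ≥0} {M : ℝ} (hf : MemHolder α f) (hM : ∀ x, |f x| ≤ M) {β : ℝ} (hβ0 : 0 < β)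
    (hβ : β ≤ α) : ∃ H : ℝ, 0 ≤ H ∧ ∀ x y, |f x - f y| ≤ H * ‖x - y‖ ^ β := by
  obtain ⟨C, hC⟩ := hf
  have hM0 : 0 ≤ M := (abs_nonneg _).trans (hM 0)
  refine ⟨C + 2 * M, by positivity, fun x y => ?_⟩
  have h1 : |f x - f y| ≤ C * ‖x - y‖ ^ (α : ℝ) := by
    have := hC.dist_le x y
    rwa [Real.dist_eq, dist_eq_norm] at this
  have h2 : |f x - f y| ≤ 2 * M := (abs_sub _ _).trans (by linarith [hM x, hM y])
  have hn : 0 ≤ ‖x - y‖ := norm_nonneg _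
  have hp : 0 ≤ ‖x - y‖ ^ β := by positivity
  rcases le_total ‖x - y‖ 1 with h | h
  · have h3 : ‖x - y‖ ^ (α : ℝ) ≤ ‖x - y‖ ^ β := Real.rpow_le_rpow_of_exponent_ge' hn h hβ0.le hβ
    calc _ ≤ C * ‖x - y‖ ^ (α : ℝ) := h1
      _ ≤ C * ‖x - y‖ ^ β := by gcongr
      _ ≤ _ := by nlinarith
  · have h3 : 1 ≤ ‖x - y‖ ^ β := Real.one_le_rpow h hβ0.le
    have : (0 : ℝ) ≤ C := C.2
    nlinarith

/-- The substitution `y = x - √t n` moves all dependence on `(t,x)` into the argument of `u₀`. The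
formula includes `t = 0`, so the regularity estimates need no separate treatment of the initial
time. -/
theorem heatFlow_eq_integral_gaussKernel_one {d : ℕ} (u₀ : SpaceE d → ℝ) {t : ℝ} (ht : 0 ≤ t)
    (x : SpaceE d) :
    heatFlow u₀ t x = ∫ n, gaussKernel 1 n * u₀ (x - √t • n) := by
  unfold heatFlow
  rcases ht.eq_or_lt with rfl | ht
  · simp [integral_mul_const, integral_gaussKernel]
  rw [if_pos ht]
  have hs : 0 < √t := Real.sqrt_pos.2 ht
  have hpi := Real.pi_pos
  have h1 : ∫ y, gaussKernel t (x - y) * u₀ y = ∫ y, gaussKernel t y * u₀ (x - y) := by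
    rw [← integral_sub_left_eq_self (fun y : SpaceE d => gaussKernel t y * u₀ (x - y)) volume x]
    simp
  have h2 := Measure.integral_comp_smul (volume : Measure (SpaceE d))
    (fun y => gaussKernel t y * u₀ (x - y)) (√t)
  rw [h1]
  have hsd : √t ^ d = t ^ ((d : ℝ) / 2) := by
    rw [Real.sqrt_eq_rpow, ← Real.rpow_natCast, ← Real.rpow_mul ht.le]
    congr 1
    ring
  have e : ∀ n : SpaceE d, gaussKernel t (√t • n) = (√t ^ d)⁻¹ * gaussKernel 1 n := by
    intro n
    simp only [gaussKernel]
    rw [norm_smul, mul_pow, Real.norm_of_nonneg hs.le, Real.sq_sqrt ht.le,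
      Real.mul_rpow (by positivity) ht.le, mul_one, hsd]
    have : t * ‖n‖ ^ 2 / (2 * t) = ‖n‖ ^ 2 / (2 * 1) := by field_simp
    rw [this]
    field_simp
  simp_rw [e, mul_assoc] at h2
  rw [integral_const_mul, finrank_euclideanSpace, Fintype.card_fin, abs_of_pos (by positivity),
    smul_eq_mul] at h2
  exact (mul_left_cancel₀ (by positivity) h2).symm

theorem integrable_gaussKernel_one_mul_norm_rpow {d : ℕ} {β : ℝ} (hβ0 : 0 < β) (hβ1 : β ≤ 1) :
    Integrable (fun n : SpaceE d => gaussKernel 1 n * ‖n‖ ^ β) := by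
  have hb : Integrable (fun n : SpaceE d =>
      (1 / (2 * Real.pi * 1) ^ ((d : ℝ) / 2)) * (3 * Real.exp (-(1 / 4) * ‖n‖ ^ 2))) :=
    ((integrable_rexp_neg_mul_sq_norm (by norm_num)).const_mul _).const_mul _
  refine hb.mono' ?_ (Eventually.of_forall fun n => ?_)
  · unfold gaussKernel
    exact (by fun_prop : Measurable _).aestronglyMeasurable
  · have hn : 0 ≤ ‖n‖ := norm_nonneg _
    have hpi := Real.pi_pos
    rw [Real.norm_of_nonneg (mul_nonneg (gaussKernel_nonneg zero_le_one _) (by positivity)),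
      gaussKernel_eq, mul_assoc]
    refine mul_le_mul_of_nonneg_left ?_ (by positivity)
    have h1 : ‖n‖ ^ β ≤ 1 + ‖n‖ := by
      rcases le_total ‖n‖ 1 with h | h
      · linarith [Real.rpow_le_one hn h hβ0.le]
      · have := Real.rpow_le_rpow_of_exponent_le h hβ1
        rw [Real.rpow_one] at this
        linarith
    -- Of the coefficient `1/2` in the Gaussian exponent, `1/4` absorbs the growth of `‖n‖` and
    -- `1/4` is left for integrability.
    have h2 : 1 + ‖n‖ ≤ 3 * Real.exp ((1 / 4) * ‖n‖ ^ 2) := by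
      have := Real.add_one_le_exp ((1 / 4) * ‖n‖ ^ 2)
      nlinarith [sq_nonneg (‖n‖ - 1)]
    calc _ ≤ Real.exp (-(1 / (2 * 1)) * ‖n‖ ^ 2) * (3 * Real.exp ((1 / 4) * ‖n‖ ^ 2)) := by
          gcongr; exact h1.trans h2
      _ = 3 * (Real.exp (-(1 / (2 * 1)) * ‖n‖ ^ 2) * Real.exp ((1 / 4) * ‖n‖ ^ 2)) := by ring
      _ = _ := by rw [← Real.exp_add]; ring_nf

section HeatFlow

variable {d : ℕ} {u₀ : SpaceE d → ℝ} {M : ℝ}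

theorem integrable_gaussKernel_one_mul_comp (hm : Measurable u₀) (hM : ∀ x, |u₀ x| ≤ M)
    (s : ℝ) (x : SpaceE d) : Integrable (fun n => gaussKernel 1 n * u₀ (x - s • n)) := by
  refine (integrable_gaussKernel zero_lt_one).mul_bdd (c := M) ?_ (Eventually.of_forall fun n => ?_)
  · exact (hm.comp (by fun_prop)).aestronglyMeasurable
  · exact hM _

theorem abs_heatFlow_le (hM : ∀ x, |u₀ x| ≤ M) {t : ℝ} (ht : 0 ≤ t) (x : SpaceE d) :
    |heatFlow u₀ t x| ≤ M := by
  rw [heatFlow_eq_integral_gaussKernel_one u₀ ht, ← Real.norm_eq_abs]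
  calc _ ≤ ∫ n : SpaceE d, gaussKernel 1 n * M := by
        refine norm_integral_le_of_norm_le ((integrable_gaussKernel zero_lt_one).mul_const _)
          (Eventually.of_forall fun n => ?_)
        rw [norm_mul, Real.norm_of_nonneg (gaussKernel_nonneg zero_le_one _)]
        exact mul_le_mul_of_nonneg_left (hM _) (gaussKernel_nonneg zero_le_one _)
    _ = M := by rw [integral_mul_const, integral_gaussKernel zero_lt_one, one_mul]

variable {H β : ℝ}

theorem abs_heatFlow_sub_le (hm : Measurable u₀) (hM : ∀ x, |u₀ x| ≤ M)
    (hH : ∀ x y, |u₀ x - u₀ y| ≤ H * ‖x - y‖ ^ β) {t : ℝ} (ht : 0 ≤ t) (x z : SpaceE d) :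
    |heatFlow u₀ t x - heatFlow u₀ t z| ≤ H * ‖x - z‖ ^ β := by
  rw [heatFlow_eq_integral_gaussKernel_one u₀ ht, heatFlow_eq_integral_gaussKernel_one u₀ ht,
    ← integral_sub (integrable_gaussKernel_one_mul_comp hm hM _ _)
      (integrable_gaussKernel_one_mul_comp hm hM _ _), ← Real.norm_eq_abs]
  calc _ ≤ ∫ n : SpaceE d, gaussKernel 1 n * (H * ‖x - z‖ ^ β) := by
        refine norm_integral_le_of_norm_le ((integrable_gaussKernel zero_lt_one).mul_const _)
          (Eventually.of_forall fun n => ?_)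
        rw [← mul_sub, norm_mul, Real.norm_of_nonneg (gaussKernel_nonneg zero_le_one _)]
        refine mul_le_mul_of_nonneg_left ?_ (gaussKernel_nonneg zero_le_one _)
        simpa using hH (x - √t • n) (z - √t • n)
    _ = _ := by rw [integral_mul_const, integral_gaussKernel zero_lt_one, one_mul]

/-- The two evaluation points differ by `(√s-√t) n`, and `|√t-√s| ≤ √|t-s|`; this halves the
exponent and leaves the Gaussian moment of order `β` as a constant. -/
theorem abs_heatFlow_time_sub_le (hm : Measurable u₀) (hM : ∀ x, |u₀ x| ≤ M)
    (hH0 : 0 ≤ H) (hH : ∀ x y, |u₀ x - u₀ y| ≤ H * ‖x - y‖ ^ β) (hβ0 : 0 < β) (hβ1 : β ≤ 1)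
    {s t : ℝ} (hs : 0 ≤ s) (ht : 0 ≤ t) (x : SpaceE d) :
    |heatFlow u₀ t x - heatFlow u₀ s x| ≤
      (H * ∫ n : SpaceE d, gaussKernel 1 n * ‖n‖ ^ β) * |t - s| ^ (β / 2) := by
  rw [heatFlow_eq_integral_gaussKernel_one u₀ ht, heatFlow_eq_integral_gaussKernel_one u₀ hs,
    ← integral_sub (integrable_gaussKernel_one_mul_comp hm hM _ _)
      (integrable_gaussKernel_one_mul_comp hm hM _ _), ← Real.norm_eq_abs]
  have hsq : |√t - √s| ≤ √|t - s| := by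
    refine Real.abs_le_sqrt ?_
    have h1 := Real.sq_sqrt ht
    have h2 := Real.sq_sqrt hs
    have h3 := Real.sqrt_nonneg t
    have h4 := Real.sqrt_nonneg s
    rcases le_total s t with h | h
    · have := Real.sqrt_le_sqrt h
      rw [abs_of_nonneg (by linarith)]; nlinarith
    · have := Real.sqrt_le_sqrt h
      rw [abs_of_nonpos (by linarith)]; nlinarith
  calc _ ≤ ∫ n : SpaceE d, (gaussKernel 1 n * ‖n‖ ^ β) * (H * |t - s| ^ (β / 2)) := by
        refine norm_integral_le_of_norm_le
          ((integrable_gaussKernel_one_mul_norm_rpow hβ0 hβ1).mul_const _)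
          (Eventually.of_forall fun n => ?_)
        rw [← mul_sub, norm_mul, Real.norm_of_nonneg (gaussKernel_nonneg zero_le_one _), mul_assoc]
        refine mul_le_mul_of_nonneg_left ?_ (gaussKernel_nonneg zero_le_one _)
        refine (hH _ _).trans ?_
        have e : x - √t • n - (x - √s • n) = (√s - √t) • n := by module
        rw [e, norm_smul, Real.norm_eq_abs, abs_sub_comm,
          Real.mul_rpow (abs_nonneg _) (norm_nonneg _)]
        have h5 : |√t - √s| ^ β ≤ |t - s| ^ (β / 2) := by
          calc |√t - √s| ^ β ≤ (√|t - s|) ^ β := by gcongr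
            _ = _ := by
              rw [Real.sqrt_eq_rpow, ← Real.rpow_mul (abs_nonneg _)]; ring_nf
        calc H * (|√t - √s| ^ β * ‖n‖ ^ β) ≤ H * (|t - s| ^ (β / 2) * ‖n‖ ^ β) := by gcongr
          _ = _ := by ring
    _ = _ := by rw [integral_mul_const]; ring

end HeatFlow

/-! ### Spectral estimates for the stochastic convolution -/

/-- The squared distance of `g` and `h` in the Hilbert space of the noise. -/
noncomputable def noiseDistSq {d : ℕ} (μ : Measure (SpaceE d)) (g h : ℝ → SpaceE d → ℝ) : ℝ≥0∞ :=
  ∫⁻ t in Set.Ioi (0 : ℝ), ∫⁻ ξ, ‖spaceFourier g t ξ - spaceFourier h t ξ‖ₑ ^ 2 ∂μ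

theorem integral_cexp_mul_gaussKernel {d : ℕ} {r : ℝ} (hr : 0 < r) (x ξ : SpaceE d) :
    ∫ y : SpaceE d, Complex.exp (-(Complex.I * ((inner ℝ ξ y : ℝ) : ℂ))) *
      (gaussKernel r (x - y) : ℂ) =
    Complex.exp (-(Complex.I * ((inner ℝ ξ x : ℝ) : ℂ))) *
      ((Real.exp (-(r * ‖ξ‖ ^ 2 / 2)) : ℝ) : ℂ) := by
  have hpi := Real.pi_pos
  have h1 := integral_sub_left_eq_self (fun y : SpaceE d =>
    Complex.exp (-(Complex.I * ((inner ℝ ξ (x - y) : ℝ) : ℂ))) * (gaussKernel r y : ℂ)) volume x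
  simp only [sub_sub_cancel] at h1
  rw [h1]
  have h2 : ∀ y : SpaceE d, Complex.exp (-(Complex.I * ((inner ℝ ξ (x - y) : ℝ) : ℂ))) *
      (gaussKernel r y : ℂ) = (Complex.exp (-(Complex.I * ((inner ℝ ξ x : ℝ) : ℂ))) *
        ((1 / (2 * Real.pi * r) ^ ((d : ℝ) / 2) : ℝ) : ℂ)) *
        Complex.exp (-((1 / (2 * r) : ℝ) : ℂ) * (‖y‖ : ℂ) ^ 2 + Complex.I * (inner ℝ ξ y : ℝ)) := by
    intro y
    rw [gaussKernel_eq, inner_sub_right]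
    push_cast
    rw [mul_sub, neg_sub, sub_eq_add_neg, Complex.exp_add, Complex.exp_add]
    ring
  simp_rw [h2]
  have hb : (0 : ℝ) < 1 / (2 * r) := by positivity
  rw [integral_const_mul, GaussianFourier.integral_cexp_neg_mul_sq_norm_add (by simpa using hb),
    finrank_euclideanSpace, Fintype.card_fin]
  have e1 : ((Real.pi : ℂ) / ((1 / (2 * r) : ℝ) : ℂ)) ^ ((d : ℂ) / 2) =
      (((2 * Real.pi * r) ^ ((d : ℝ) / 2) : ℝ) : ℂ) := by
    rw [Complex.ofReal_cpow (by positivity)]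
    congr 1
    · push_cast; field_simp
    · push_cast; rfl
  have e2 : Complex.exp (Complex.I ^ 2 * (‖ξ‖ : ℂ) ^ 2 / (4 * ((1 / (2 * r) : ℝ) : ℂ))) =
      ((Real.exp (-(r * ‖ξ‖ ^ 2 / 2)) : ℝ) : ℂ) := by
    rw [Complex.ofReal_exp]
    congr 1
    have : (r : ℂ) ≠ 0 := by exact_mod_cast hr.ne'
    rw [Complex.I_sq]
    push_cast
    field_simp
    norm_num
  rw [e1, e2]
  have h3 : (((2 * Real.pi * r) ^ ((d : ℝ) / 2) : ℝ) : ℂ) ≠ 0 := by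
    have : (0 : ℝ) < (2 * Real.pi * r) ^ ((d : ℝ) / 2) := by positivity
    exact_mod_cast this.ne'
  rw [Complex.ofReal_div, Complex.ofReal_one]
  field_simp

theorem spaceFourier_convolutionIntegrand {d : ℕ} (t : ℝ) (x : SpaceE d) (s : ℝ) (ξ : SpaceE d) :
    spaceFourier (convolutionIntegrand t x) s ξ =
      (Set.Ico 0 t).indicator (fun r => Complex.exp (-(Complex.I * ((inner ℝ ξ x : ℝ) : ℂ))) *
        ((Real.exp (-((t - r) * ‖ξ‖ ^ 2 / 2)) : ℝ) : ℂ)) s := by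
  unfold spaceFourier convolutionIntegrand
  by_cases hs : s ∈ Set.Ico 0 t
  · simp only [Set.indicator_of_mem hs]
    exact integral_cexp_mul_gaussKernel (by linarith [hs.2]) x ξ
  · simp [Set.indicator_of_notMem hs]

theorem measurable_spaceFourier_convolutionIntegrand {d : ℕ} (t : ℝ) (x : SpaceE d) :
    Measurable (fun p : ℝ × SpaceE d => spaceFourier (convolutionIntegrand t x) p.1 p.2) := by
  have h : (fun p : ℝ × SpaceE d => spaceFourier (convolutionIntegrand t x) p.1 p.2) =
      {p : ℝ × SpaceE d | p.1 ∈ Set.Ico 0 t}.indicator (fun p =>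
        Complex.exp (-(Complex.I * ((inner ℝ p.2 x : ℝ) : ℂ))) *
        ((Real.exp (-((t - p.1) * ‖p.2‖ ^ 2 / 2)) : ℝ) : ℂ)) := by
    ext p
    rw [spaceFourier_convolutionIntegrand]
    by_cases hp : p.1 ∈ Set.Ico 0 t
    · rw [Set.indicator_of_mem hp, Set.indicator_of_mem (by exact hp)]
    · rw [Set.indicator_of_notMem hp, Set.indicator_of_notMem (by exact hp)]
  rw [h]
  exact Measurable.indicator (by fun_prop) (measurable_fst measurableSet_Ico)

/-- Multiply by `1 + c`: the part with `1` is at most the length `t-a`, and the part with `c`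
integrates a derivative and is at most `1`. Small and large frequencies are thus covered by one
bound. -/
theorem lintegral_indicator_exp_le {a t c : ℝ} (hat : a ≤ t) (hc : 0 ≤ c) :
    ∫⁻ s, ENNReal.ofReal ((Set.Ico a t).indicator (fun s => Real.exp (-((t - s) * c))) s) ≤
      ENNReal.ofReal ((t - a + 1) / (1 + c)) := by
  have h0 : ∀ s, ENNReal.ofReal ((Set.Ico a t).indicator (fun s => Real.exp (-((t - s) * c))) s) =
      (Set.Ico a t).indicator (fun s => ENNReal.ofReal (Real.exp (-((t - s) * c)))) s := by
    intro s
    by_cases hs : s ∈ Set.Ico a t <;> simp [hs]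
  simp_rw [h0]
  rw [lintegral_indicator measurableSet_Ico]
  have hcont : Continuous (fun s => Real.exp (-((t - s) * c))) := by fun_prop
  rw [restrict_Ico_eq_restrict_Ioc, ← ofReal_integral_eq_lintegral_ofReal
    ((hcont.intervalIntegrable a t).1) (Eventually.of_forall fun s => (Real.exp_pos _).le)]
  refine ENNReal.ofReal_le_ofReal ?_
  rw [← intervalIntegral.integral_of_le hat, le_div_iff₀ (by linarith)]
  have hder : ∀ s ∈ Set.uIcc a t, HasDerivAt (fun s => s + Real.exp (-((t - s) * c)))
      (1 + Real.exp (-((t - s) * c)) * c) s := by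
    intro s _
    have h1 : HasDerivAt (fun s : ℝ => -((t - s) * c)) c s := by
      have := (((hasDerivAt_id s).const_sub t).mul_const c).neg
      have h : HasDerivAt (-fun y => (t - y) * c) c s := by simpa using this
      exact h
    exact (hasDerivAt_id s).add h1.exp
  have hint : Continuous (fun s => 1 + Real.exp (-((t - s) * c)) * c) := by fun_prop
  have hF := intervalIntegral.integral_eq_sub_of_hasDerivAt hder (hint.intervalIntegrable a t)
  rw [← intervalIntegral.integral_mul_const]
  calc ∫ s in a..t, Real.exp (-((t - s) * c)) * (1 + c)
      ≤ ∫ s in a..t, (1 + Real.exp (-((t - s) * c)) * c) := by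
        refine intervalIntegral.integral_mono_on hat
          ((hcont.mul continuous_const).intervalIntegrable a t)
          (hint.intervalIntegrable a t) fun s hs => ?_
        have : Real.exp (-((t - s) * c)) ≤ 1 :=
          Real.exp_le_one_iff.2 (by nlinarith [hs.2])
        linarith
    _ ≤ t - a + 1 := by
        rw [hF]
        have := Real.exp_pos (-((t - a) * c))
        simp only [sub_self, zero_mul, neg_zero, Real.exp_zero]
        linarith

theorem lintegral_indicator_exp_le_length {a t c : ℝ} (hc : 0 ≤ c) :
    ∫⁻ s, ENNReal.ofReal ((Set.Ico a t).indicator (fun s => Real.exp (-((t - s) * c))) s) ≤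
      ENNReal.ofReal (t - a) := by
  calc _ ≤ ∫⁻ s, (Set.Ico a t).indicator (fun _ => 1) s := by
        refine lintegral_mono fun s => ?_
        by_cases hs : s ∈ Set.Ico a t
        · simp only [hs, Set.indicator_of_mem]
          rw [← ENNReal.ofReal_one]
          exact ENNReal.ofReal_le_ofReal (Real.exp_le_one_iff.2 (by nlinarith [hs.2]))
        · simp [hs]
    _ = _ := by rw [lintegral_indicator_const measurableSet_Ico]; simp

theorem min_le_rpow_mul_rpow {a b x β : ℝ} (ha : 0 ≤ a) (hxa : x ≤ a)
    (hxb : x ≤ b) (hβ0 : 0 ≤ β) (hβ1 : β ≤ 1) (hx : 0 ≤ x) : x ≤ a ^ β * b ^ (1 - β) := by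
  calc x = x ^ β * x ^ (1 - β) := by
        rw [← Real.rpow_add_of_nonneg hx hβ0 (by linarith)]; simp
    _ ≤ _ := by gcongr

theorem min_le_rpow {x y : ℝ} {β : ℝ} (hβ0 : 0 < β) (hβ1 : β ≤ 1) (hx1 : x ≤ 1) (hxy : x ≤ y)
    (hy : 0 ≤ y) : x ≤ y ^ β := by
  rcases le_total y 1 with h | h
  · exact hxy.trans (by
      simpa using Real.rpow_le_rpow_of_exponent_ge' hy h hβ0.le hβ1)
  · exact hx1.trans (Real.one_le_rpow h hβ0.le)

section Spectral

variable {d : ℕ} {μ : Measure (SpaceE d)} {β : ℝ}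

/-- The restriction `β ≤ 1 - q/2` originates here: it says `1-β ≥ q/2`, so `(1+|ξ|²)^(1-β)`
dominates both `1` and `|ξ|^q`, whence the factor `2`. -/
theorem lintegral_rpow_spectral_lt_top {q : ℝ}
    (hμ : ∫⁻ ξ, ENNReal.ofReal (1 / (1 + ‖ξ‖ ^ q)) ∂μ < ∞) (hq : 0 < q) (hβ : β ≤ 1 - q / 2) :
    ∫⁻ ξ, ENNReal.ofReal (1 / (1 + ‖ξ‖ ^ 2) ^ (1 - β)) ∂μ < ∞ := by
  refine lt_of_le_of_lt (b := ∫⁻ ξ, ENNReal.ofReal 2 * ENNReal.ofReal (1 / (1 + ‖ξ‖ ^ q)) ∂μ) ?_ ?_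
  · refine lintegral_mono fun ξ => ?_
    rw [← ENNReal.ofReal_mul (by norm_num)]
    refine ENNReal.ofReal_le_ofReal ?_
    have hn : 0 ≤ ‖ξ‖ := norm_nonneg _
    rw [mul_one_div, div_le_div_iff₀ (by positivity) (by positivity), one_mul]
    have h1 : (1 : ℝ) ≤ (1 + ‖ξ‖ ^ 2) ^ (1 - β) := Real.one_le_rpow (by nlinarith) (by linarith)
    have h2 : ‖ξ‖ ^ q ≤ (1 + ‖ξ‖ ^ 2) ^ (1 - β) := by
      calc ‖ξ‖ ^ q = (‖ξ‖ ^ 2) ^ (q / 2) := by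
            rw [← Real.rpow_natCast, ← Real.rpow_mul hn]; congr 1; push_cast; ring
        _ ≤ (1 + ‖ξ‖ ^ 2) ^ (q / 2) := by gcongr; linarith
        _ ≤ _ := Real.rpow_le_rpow_of_exponent_le (by nlinarith) (by linarith)
    linarith
  · rw [lintegral_const_mul' _ _ (by simp)]
    exact ENNReal.mul_lt_top (by simp) hμ

/-- Tonelli reduces a distance in the noise space to a time integral at each fixed frequency. -/
theorem noiseDistSq_le_of_lintegral_le [SFinite μ] {g h : ℝ → SpaceE d → ℝ}
    (hg : Measurable (fun p : ℝ × SpaceE d => spaceFourier g p.1 p.2))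
    (hh : Measurable (fun p : ℝ × SpaceE d => spaceFourier h p.1 p.2)) {B : ℝ} (hB : 0 ≤ B)
    (hle : ∀ ξ, ∫⁻ s, ENNReal.ofReal (‖spaceFourier g s ξ - spaceFourier h s ξ‖ ^ 2) ≤
      ENNReal.ofReal (B / (1 + ‖ξ‖ ^ 2) ^ (1 - β))) :
    noiseDistSq μ g h ≤
      ENNReal.ofReal B * ∫⁻ ξ, ENNReal.ofReal (1 / (1 + ‖ξ‖ ^ 2) ^ (1 - β)) ∂μ := by
  unfold noiseDistSq
  rw [lintegral_lintegral_swap ((hg.sub hh).enorm.pow_const 2).aemeasurable,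
    ← lintegral_const_mul' _ _ (by simp)]
  refine lintegral_mono fun ξ => ?_
  calc _ ≤ ∫⁻ s, ‖spaceFourier g s ξ - spaceFourier h s ξ‖ₑ ^ 2 := setLIntegral_le_lintegral _ _
    _ = ∫⁻ s, ENNReal.ofReal (‖spaceFourier g s ξ - spaceFourier h s ξ‖ ^ 2) := by
        refine lintegral_congr fun s => ?_
        rw [← ofReal_norm, ENNReal.ofReal_pow (norm_nonneg _)]
    _ ≤ _ := hle ξ
    _ = _ := by rw [← ENNReal.ofReal_mul hB, mul_one_div]

theorem spaceFourier_zero (t : ℝ) (ξ : SpaceE d) : spaceFourier (fun _ _ => 0) t ξ = 0 := by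
  simp [spaceFourier]

/-- The trade behind the noise estimates, used with `c = |ξ|²`: a factor `h^β` is gained at the
price of `(1+c)^β`, which still leaves the integrable weight of exponent `1-β`. -/
theorem rpow_mul_div_le {c h B : ℝ} (hc : 0 ≤ c) (hh : 0 ≤ h) (hB : 0 ≤ B) (hβ0 : 0 < β) :
    (h * c) ^ β * (B / (1 + c)) ≤ h ^ β * B / (1 + c) ^ (1 - β) := by
  have h1 : (1 + c) ^ (1 - β) = (1 + c) / (1 + c) ^ β := by
    rw [Real.rpow_sub (by linarith), Real.rpow_one]
  rw [h1, Real.mul_rpow hh hc]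
  have : c ^ β ≤ (1 + c) ^ β := by gcongr; linarith
  calc h ^ β * c ^ β * (B / (1 + c)) ≤ h ^ β * (1 + c) ^ β * (B / (1 + c)) := by gcongr
    _ = _ := by field_simp

theorem div_one_add_le {c B : ℝ} (hc : 0 ≤ c) (hB : 0 ≤ B) (hβ0 : 0 < β) :
    B / (1 + c) ≤ B / (1 + c) ^ (1 - β) := by
  gcongr
  calc (1 + c) ^ (1 - β) ≤ (1 + c) ^ (1 : ℝ) :=
        Real.rpow_le_rpow_of_exponent_le (by linarith) (by linarith)
    _ = _ := Real.rpow_one _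

/-- Bounds the variance of the stochastic convolution uniformly on `[0,T] × ℝ^d`; it serves the a
priori moments of `u`. -/
theorem noiseDistSq_convolutionIntegrand_zero_le [SFinite μ] (hβ0 : 0 < β) {t T : ℝ} (ht : 0 ≤ t)
    (htT : t ≤ T) (x : SpaceE d) :
    noiseDistSq μ (convolutionIntegrand t x) (fun _ _ => 0) ≤
      ENNReal.ofReal (T + 1) * ∫⁻ ξ, ENNReal.ofReal (1 / (1 + ‖ξ‖ ^ 2) ^ (1 - β)) ∂μ := by
  refine noiseDistSq_le_of_lintegral_le (measurable_spaceFourier_convolutionIntegrand t x)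
    (by simp_rw [spaceFourier_zero]; exact measurable_const) (by linarith) fun ξ => ?_
  have hc : 0 ≤ ‖ξ‖ ^ 2 := by positivity
  calc _ = ∫⁻ s, ENNReal.ofReal
          ((Set.Ico 0 t).indicator (fun s => Real.exp (-((t - s) * ‖ξ‖ ^ 2))) s) := by
        refine lintegral_congr fun s => ?_
        rw [spaceFourier_zero, sub_zero, spaceFourier_convolutionIntegrand]
        by_cases hs : s ∈ Set.Ico 0 t
        · simp only [hs, Set.indicator_of_mem]
          rw [norm_mul, Complex.norm_exp, Complex.norm_real, Real.norm_of_nonneg (Real.exp_pos _).le,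
            mul_pow, ← Real.exp_nat_mul, ← Real.exp_nat_mul]
          congr 1
          simp
          ring
        · simp [hs]
    _ ≤ ENNReal.ofReal ((t - 0 + 1) / (1 + ‖ξ‖ ^ 2)) := lintegral_indicator_exp_le ht hc
    _ ≤ _ := by
        refine ENNReal.ofReal_le_ofReal ?_
        refine le_trans ?_ (div_one_add_le hc (by linarith) hβ0)
        gcongr; linarith

/-- Up to a phase this is `|exp(iθ)-1| ≤ min(2,|θ|)` with `|θ| ≤ |ξ||x-z|`. A quarter of the square
is at most `1` and at most `θ²`, hence at most the `β`-th power of the upper bound for `θ²`. -/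
theorem norm_cexp_sub_sq_le (hβ0 : 0 < β) (hβ1 : β ≤ 1) (x z ξ : SpaceE d) :
    ‖Complex.exp (-(Complex.I * ((inner ℝ ξ x : ℝ) : ℂ))) -
      Complex.exp (-(Complex.I * ((inner ℝ ξ z : ℝ) : ℂ)))‖ ^ 2 ≤
      4 * (‖x - z‖ ^ 2 * ‖ξ‖ ^ 2) ^ β := by
  set a : ℝ := inner ℝ ξ x
  set b : ℝ := inner ℝ ξ z
  have e : Complex.exp (-(Complex.I * (a : ℂ))) - Complex.exp (-(Complex.I * (b : ℂ))) =
      Complex.exp (Complex.I * ((-b : ℝ) : ℂ)) *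
        (Complex.exp (Complex.I * ((b - a : ℝ) : ℂ)) - 1) := by
    rw [mul_sub, ← Complex.exp_add]
    push_cast
    ring_nf
  have hab : |b - a| ≤ ‖x - z‖ * ‖ξ‖ := by
    have : b - a = inner ℝ ξ (z - x) := by rw [inner_sub_right]
    rw [this, ← norm_sub_rev z x, mul_comm]
    exact abs_real_inner_le_norm _ _
  have hn : ‖Complex.exp (Complex.I * ((-b : ℝ) : ℂ))‖ = 1 := by
    simp [Complex.norm_exp]
  rw [e, norm_mul, hn, one_mul]
  set N := ‖Complex.exp (Complex.I * ((b - a : ℝ) : ℂ)) - 1‖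
  have hN0 : 0 ≤ N := norm_nonneg _
  have hN1 : N ≤ |b - a| := by
    exact Real.norm_exp_I_mul_ofReal_sub_one_le
  have hN2 : N ≤ 2 := by
    calc N ≤ ‖Complex.exp (Complex.I * ((b - a : ℝ) : ℂ))‖ + ‖(1 : ℂ)‖ := norm_sub_le _ _
      _ = 2 := by simp [Complex.norm_exp]; norm_num
  have := min_le_rpow (x := N ^ 2 / 4) (y := ‖x - z‖ ^ 2 * ‖ξ‖ ^ 2) hβ0 hβ1 (by nlinarith)
    (by nlinarith [sq_nonneg N, hN1.trans hab]) (by positivity)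
  linarith

theorem noiseDistSq_convolutionIntegrand_space_le [SFinite μ] (hβ0 : 0 < β) (hβ1 : β ≤ 1)
    {t T : ℝ} (ht : 0 ≤ t) (htT : t ≤ T) (x z : SpaceE d) :
    noiseDistSq μ (convolutionIntegrand t x) (convolutionIntegrand t z) ≤
      ENNReal.ofReal (4 * (T + 1) * (‖x - z‖ ^ 2) ^ β) *
        ∫⁻ ξ, ENNReal.ofReal (1 / (1 + ‖ξ‖ ^ 2) ^ (1 - β)) ∂μ := by
  have hT : 0 ≤ T := ht.trans htT
  refine noiseDistSq_le_of_lintegral_le (measurable_spaceFourier_convolutionIntegrand t x)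
    (measurable_spaceFourier_convolutionIntegrand t z) (by positivity) fun ξ => ?_
  have hc : 0 ≤ ‖ξ‖ ^ 2 := by positivity
  calc _ ≤ ∫⁻ s, ENNReal.ofReal (4 * (‖x - z‖ ^ 2 * ‖ξ‖ ^ 2) ^ β) * ENNReal.ofReal
          ((Set.Ico 0 t).indicator (fun s => Real.exp (-((t - s) * ‖ξ‖ ^ 2))) s) := by
        refine lintegral_mono fun s => ?_
        rw [← ENNReal.ofReal_mul (by positivity), spaceFourier_convolutionIntegrand,
          spaceFourier_convolutionIntegrand]
        refine ENNReal.ofReal_le_ofReal ?_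
        by_cases hs : s ∈ Set.Ico 0 t
        · simp only [hs, Set.indicator_of_mem]
          rw [← sub_mul, norm_mul, mul_pow, Complex.norm_real,
            Real.norm_of_nonneg (Real.exp_pos _).le]
          have e : Real.exp (-((t - s) * ‖ξ‖ ^ 2 / 2)) ^ 2 = Real.exp (-((t - s) * ‖ξ‖ ^ 2)) := by
            rw [← Real.exp_nat_mul]; congr 1; push_cast; ring
          rw [e]
          exact mul_le_mul_of_nonneg_right (norm_cexp_sub_sq_le hβ0 hβ1 x z ξ) (Real.exp_pos _).le
        · simp [hs]
    _ = ENNReal.ofReal (4 * (‖x - z‖ ^ 2 * ‖ξ‖ ^ 2) ^ β) * ∫⁻ s, ENNReal.ofReal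
          ((Set.Ico 0 t).indicator (fun s => Real.exp (-((t - s) * ‖ξ‖ ^ 2))) s) :=
        lintegral_const_mul' _ _ ENNReal.ofReal_ne_top
    _ ≤ ENNReal.ofReal (4 * (‖x - z‖ ^ 2 * ‖ξ‖ ^ 2) ^ β) *
          ENNReal.ofReal ((t - 0 + 1) / (1 + ‖ξ‖ ^ 2)) := by
        gcongr
        exact lintegral_indicator_exp_le ht hc
    _ ≤ _ := by
        rw [← ENNReal.ofReal_mul (by positivity)]
        refine ENNReal.ofReal_le_ofReal ?_
        have h1 := rpow_mul_div_le (h := ‖x - z‖ ^ 2) (B := T + 1) hc (by positivity)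
          (by positivity) hβ0
        calc 4 * (‖x - z‖ ^ 2 * ‖ξ‖ ^ 2) ^ β * ((t - 0 + 1) / (1 + ‖ξ‖ ^ 2))
            ≤ 4 * ((‖x - z‖ ^ 2 * ‖ξ‖ ^ 2) ^ β * ((T + 1) / (1 + ‖ξ‖ ^ 2))) := by
              rw [mul_assoc]; gcongr; linarith
          _ ≤ 4 * ((‖x - z‖ ^ 2) ^ β * (T + 1) / (1 + ‖ξ‖ ^ 2) ^ (1 - β)) := by gcongr
          _ = _ := by ring

/-- The time axis splits at `s`. On `[0,s)` both kernels are present and differ by the factor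
`exp(-(t-s)|ξ|²/2)`; on `[s,t)` only the kernel of `t` survives. Each part contributes `(t-s)^β
(T+1)`, whence the `2`. -/
theorem noiseDistSq_convolutionIntegrand_time_le [SFinite μ] (hβ0 : 0 < β) (hβ1 : β ≤ 1)
    {s t T : ℝ} (hs : 0 ≤ s) (hst : s ≤ t) (htT : t ≤ T) (x : SpaceE d) :
    noiseDistSq μ (convolutionIntegrand t x) (convolutionIntegrand s x) ≤
      ENNReal.ofReal (2 * (T + 1) * (t - s) ^ β) *
        ∫⁻ ξ, ENNReal.ofReal (1 / (1 + ‖ξ‖ ^ 2) ^ (1 - β)) ∂μ := by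
  have hT : 0 ≤ T := hs.trans (hst.trans htT)
  have hh : 0 ≤ t - s := by linarith
  refine noiseDistSq_le_of_lintegral_le (measurable_spaceFourier_convolutionIntegrand t x)
    (measurable_spaceFourier_convolutionIntegrand s x) (by positivity) fun ξ => ?_
  have hc : 0 ≤ ‖ξ‖ ^ 2 := by positivity
  set c := ‖ξ‖ ^ 2
  have hpt : ∀ r, ‖spaceFourier (convolutionIntegrand t x) r ξ -
      spaceFourier (convolutionIntegrand s x) r ξ‖ ^ 2 ≤
      ((t - s) * c) ^ β * (Set.Ico 0 s).indicator (fun r => Real.exp (-((s - r) * c))) r +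
        (Set.Ico s t).indicator (fun r => Real.exp (-((t - r) * c))) r := by
    intro r
    rw [spaceFourier_convolutionIntegrand, spaceFourier_convolutionIntegrand]
    have hn : ‖Complex.exp (-(Complex.I * ((inner ℝ ξ x : ℝ) : ℂ)))‖ = 1 := by
      simp [Complex.norm_exp]
    have he : ∀ y : ℝ, Real.exp (-(y * c / 2)) ^ 2 = Real.exp (-(y * c)) := by
      intro y; rw [← Real.exp_nat_mul]; congr 1; push_cast; ring
    by_cases h1 : r ∈ Set.Ico 0 s
    · have h2 : r ∈ Set.Ico 0 t := ⟨h1.1, h1.2.trans_le hst⟩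
      have h3 : r ∉ Set.Ico s t := fun h => absurd h1.2 (not_lt.2 h.1)
      simp only [h1, h2, h3, Set.indicator_of_mem, Set.indicator_of_notMem, not_false_eq_true,
        add_zero]
      rw [← mul_sub, norm_mul, hn, one_mul, ← Complex.ofReal_sub, Complex.norm_real,
        Real.norm_eq_abs, sq_abs]
      have e1 : Real.exp (-((t - r) * c / 2)) - Real.exp (-((s - r) * c / 2)) =
          (Real.exp (-((t - s) * c / 2)) - 1) * Real.exp (-((s - r) * c / 2)) := by
        rw [sub_mul (Real.exp _), ← Real.exp_add]; ring_nf
      rw [e1, mul_pow, he]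
      gcongr
      have h5 : 0 ≤ (t - s) * c := by positivity
      have h6 : Real.exp (-((t - s) * c / 2)) ≤ 1 := Real.exp_le_one_iff.2 (by linarith)
      have h7 := Real.exp_pos (-((t - s) * c / 2))
      have h8 := Real.add_one_le_exp (-((t - s) * c / 2))
      exact min_le_rpow hβ0 hβ1 (by nlinarith) (by nlinarith) h5
    · by_cases h2 : r ∈ Set.Ico s t
      · have h3 : r ∈ Set.Ico 0 t := ⟨hs.trans h2.1, h2.2⟩
        simp only [h1, h2, h3, Set.indicator_of_mem, Set.indicator_of_notMem, not_false_eq_true,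
          sub_zero, mul_zero, zero_add]
        rw [norm_mul, hn, one_mul, Complex.norm_real, Real.norm_of_nonneg (Real.exp_pos _).le, he]
      · have h3 : r ∉ Set.Ico 0 t := by
          intro h
          rcases lt_or_ge r s with h' | h'
          · exact h1 ⟨h.1, h'⟩
          · exact h2 ⟨h', h.2⟩
        simp [h1, h2, h3]
  calc _ ≤ ∫⁻ r, (ENNReal.ofReal (((t - s) * c) ^ β) * ENNReal.ofReal
          ((Set.Ico 0 s).indicator (fun r => Real.exp (-((s - r) * c))) r) +
        ENNReal.ofReal ((Set.Ico s t).indicator (fun r => Real.exp (-((t - r) * c))) r)) := by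
        refine lintegral_mono fun r => ?_
        rw [← ENNReal.ofReal_mul (by positivity), ← ENNReal.ofReal_add]
        · exact ENNReal.ofReal_le_ofReal (hpt r)
        · exact mul_nonneg (by positivity)
            (Set.indicator_nonneg (fun _ _ => (Real.exp_pos _).le) _)
        · exact Set.indicator_nonneg (fun _ _ => (Real.exp_pos _).le) _
    _ = ENNReal.ofReal (((t - s) * c) ^ β) * (∫⁻ r, ENNReal.ofReal
          ((Set.Ico 0 s).indicator (fun r => Real.exp (-((s - r) * c))) r)) +
        ∫⁻ r, ENNReal.ofReal ((Set.Ico s t).indicator (fun r => Real.exp (-((t - r) * c))) r) := by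
        rw [lintegral_add_right, lintegral_const_mul' _ _ (by simp)]
        exact (Measurable.indicator (by fun_prop) measurableSet_Ico).ennreal_ofReal
    _ ≤ ENNReal.ofReal (((t - s) * c) ^ β) * ENNReal.ofReal ((s - 0 + 1) / (1 + c)) +
        ENNReal.ofReal ((t - s) ^ β * ((t - s + 1) / (1 + c)) ^ (1 - β)) := by
        gcongr
        · exact lintegral_indicator_exp_le hs hc
        -- The integral over `[s,t)` is at most `t-s` and at most `(t-s+1)/(1+c)`; the product of
        -- the powers `β` and `1-β` of these bounds has the desired form.
        · have h1 := lintegral_indicator_exp_le hst hc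
          have h2 := lintegral_indicator_exp_le_length (a := s) (t := t) hc
          set L := ∫⁻ r, ENNReal.ofReal
            ((Set.Ico s t).indicator (fun r => Real.exp (-((t - r) * c))) r)
          have hL : L ≠ ∞ := ne_top_of_le_ne_top ENNReal.ofReal_ne_top h2
          rw [← ENNReal.ofReal_toReal hL]
          refine ENNReal.ofReal_le_ofReal (min_le_rpow_mul_rpow hh
            (ENNReal.toReal_le_of_le_ofReal hh h2)
            (ENNReal.toReal_le_of_le_ofReal (by positivity) h1) hβ0.le hβ1 ENNReal.toReal_nonneg)
    _ ≤ _ := by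
        rw [← ENNReal.ofReal_mul (by positivity), ← ENNReal.ofReal_add (by positivity)
          (by positivity)]
        refine ENNReal.ofReal_le_ofReal ?_
        have h1 := rpow_mul_div_le (h := t - s) (B := T + 1) hc hh (by positivity) hβ0
        have h2 : ((t - s) * c) ^ β * ((s - 0 + 1) / (1 + c)) ≤
            ((t - s) * c) ^ β * ((T + 1) / (1 + c)) := by gcongr; linarith
        have h3 : (t - s) ^ β * ((t - s + 1) / (1 + c)) ^ (1 - β) ≤
            (t - s) ^ β * (T + 1) / (1 + c) ^ (1 - β) := by
          rw [Real.div_rpow (by positivity) (by positivity), mul_div_assoc]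
          gcongr
          calc (t - s + 1) ^ (1 - β) ≤ (T + 1) ^ (1 - β) := by
                gcongr
                all_goals linarith
            _ ≤ (T + 1) ^ (1 : ℝ) :=
                Real.rpow_le_rpow_of_exponent_le (by linarith) (by linarith)
            _ = _ := Real.rpow_one _
        calc _ ≤ (t - s) ^ β * (T + 1) / (1 + c) ^ (1 - β) +
              (t - s) ^ β * (T + 1) / (1 + c) ^ (1 - β) := by linarith
          _ = _ := by ring

end Spectral

/-! ### Partial Fourier transforms of test functions -/

section TestFunctions

variable {d : ℕ}

/-- A test function, as a complex valued function. -/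
noncomputable def TestFunction.toComplexFun (φ : TestFn d) (p : ℝ × SpaceE d) : ℂ := (φ p : ℂ)

theorem TestFunction.contDiff_toComplexFun (φ : TestFn d) : ContDiff ℝ (⊤ : ℕ∞) φ.toComplexFun :=
  Complex.ofRealCLM.contDiff.comp φ.contDiff

theorem TestFunction.hasCompactSupport_toComplexFun (φ : TestFn d) :
    HasCompactSupport φ.toComplexFun :=
  φ.hasCompactSupport.comp_left (g := fun r : ℝ => (r : ℂ)) Complex.ofReal_zero

theorem HasCompactSupport.exists_norm_lt_of_ne_zero {E F : Type*} [NormedAddCommGroup E] [Zero F]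
    {f : E → F} (hf : HasCompactSupport f) : ∃ R : ℝ, ∀ p, R < ‖p‖ → f p = 0 := by
  obtain ⟨R, hR⟩ := hf.isCompact.isBounded.exists_norm_le
  exact ⟨R, fun p hp => image_eq_zero_of_notMem_tsupport fun h => absurd (hR p h) (not_le.2 hp)⟩

/-- A slice is a translate of `f` composed with the inclusion of `E`, a linear map of norm at most
`1`. -/
theorem norm_iteratedFDeriv_comp_prodMk_le {E F : Type*} [NormedAddCommGroup E] [NormedSpace ℝ E]
    [NormedAddCommGroup F] [NormedSpace ℝ F] {f : ℝ × E → F} (hf : ContDiff ℝ (⊤ : ℕ∞) f) (t : ℝ) (n : ℕ)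
    (x : E) :
    ‖iteratedFDeriv ℝ n (fun y => f (t, y)) x‖ ≤ ‖iteratedFDeriv ℝ n f (t, x)‖ := by
  have h1 : (fun y => f (t, y)) =
      (fun p => f (p + (t, 0))) ∘ (ContinuousLinearMap.inr ℝ ℝ E) := by
    ext y; simp
  have hf' : ContDiff ℝ (⊤ : ℕ∞) (fun p : ℝ × E => f (p + (t, 0))) :=
    hf.comp (contDiff_id.add contDiff_const)
  rw [h1, ContinuousLinearMap.iteratedFDeriv_comp_right _ hf' x (i := n) (by exact_mod_cast le_top),
    iteratedFDeriv_comp_add_right]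
  refine (ContinuousMultilinearMap.norm_compContinuousLinearMap_le _ _).trans ?_
  have h2 : ∏ _i : Fin n, ‖ContinuousLinearMap.inr ℝ ℝ E‖ ≤ 1 :=
    Finset.prod_le_one (fun _ _ => norm_nonneg _)
      fun _ _ => ContinuousLinearMap.norm_inr_le_one ℝ ℝ E
  have e : (ContinuousLinearMap.inr ℝ ℝ E) x + (t, 0) = (t, x) := by simp
  rw [e]
  exact mul_le_of_le_one_right (norm_nonneg _) h2

theorem spaceFourier_testFn_eq_fourier (φ : TestFn d) (t : ℝ) (ξ : SpaceE d) :
    spaceFourier (fun s x => φ (s, x)) t ξ =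
      FourierTransform.fourier (fun x => φ.toComplexFun (t, x)) ((1 / (2 * Real.pi)) • ξ) := by
  rw [Real.fourier_eq']
  unfold spaceFourier
  refine integral_congr_ae (Eventually.of_forall fun x => ?_)
  have hpi := Real.pi_pos
  have e : -2 * Real.pi * inner ℝ x ((1 / (2 * Real.pi)) • ξ) = -inner ℝ ξ x := by
    rw [inner_smul_right, real_inner_comm]; field_simp
  simp only [smul_eq_mul, e, TestFunction.toComplexFun]
  congr 2
  push_cast
  ring

/-- Compact support in space-time gives one ball and one supremum valid for all slices. Uniformity
in `t` is what the Fourier decay below requires. -/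
theorem TestFunction.exists_integral_norm_iteratedFDeriv_le (φ : TestFn d) (n : ℕ) :
    ∃ C : ℝ, 0 ≤ C ∧ ∀ t, ∫ x, ‖iteratedFDeriv ℝ n (fun y => φ.toComplexFun (t, y)) x‖ ≤ C := by
  have hc : Continuous (iteratedFDeriv ℝ n φ.toComplexFun) :=
    φ.contDiff_toComplexFun.continuous_iteratedFDeriv (by exact_mod_cast le_top)
  have hs := φ.hasCompactSupport_toComplexFun.iteratedFDeriv (𝕜 := ℝ) n
  obtain ⟨R, hR⟩ := hs.exists_norm_lt_of_ne_zero
  obtain ⟨B, hB⟩ := hc.bounded_above_of_compact_support hs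
  have hB0 : 0 ≤ B := (norm_nonneg _).trans (hB 0)
  refine ⟨B * volume.real (Metric.closedBall (0 : SpaceE d) R), by positivity, fun t => ?_⟩
  have hb : Integrable ((Metric.closedBall (0 : SpaceE d) R).indicator fun _ => B) :=
    (integrable_indicator_iff measurableSet_closedBall).2
      (integrableOn_const (isCompact_closedBall 0 R).measure_lt_top.ne)
  calc _ ≤ ∫ x, (Metric.closedBall (0 : SpaceE d) R).indicator (fun _ => B) x := by
        refine integral_mono_of_nonneg (Eventually.of_forall fun _ => norm_nonneg _) hb
          (Eventually.of_forall fun x => ?_)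
        refine (norm_iteratedFDeriv_comp_prodMk_le φ.contDiff_toComplexFun t n x).trans ?_
        by_cases hx : x ∈ Metric.closedBall (0 : SpaceE d) R
        · simpa [hx] using hB (t, x)
        · have h1 : R < ‖((t, x) : ℝ × SpaceE d)‖ := by
            simp only [Metric.mem_closedBall, dist_zero_right, not_le] at hx
            exact hx.trans_le (norm_snd_le ((t, x) : ℝ × SpaceE d))
          simp [hx, hR _ h1]
    _ = _ := by
        rw [integral_indicator measurableSet_closedBall, setIntegral_const, smul_eq_mul, mul_comm]

theorem TestFunction.exists_pow_mul_norm_spaceFourier_le (φ : TestFn d) (n : ℕ) :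
    ∃ C : ℝ, 0 ≤ C ∧ ∀ t ξ, ‖ξ‖ ^ n * ‖spaceFourier (fun s x => φ (s, x)) t ξ‖ ≤ C := by
  choose C hC0 hC using fun k => φ.exists_integral_norm_iteratedFDeriv_le k
  have hpi := Real.pi_pos
  refine ⟨(2 * Real.pi) ^ n * (2 ^ n * ∑ k ∈ Finset.range (n + 1), C k),
    mul_nonneg (by positivity) (mul_nonneg (by positivity) (Finset.sum_nonneg fun k _ => hC0 k)),
    fun t ξ => ?_⟩
  have hsm : ContDiff ℝ (⊤ : ℕ∞) (fun y => φ.toComplexFun (t, y)) :=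
    φ.contDiff_toComplexFun.comp (contDiff_const.prodMk contDiff_id)
  have hcs : HasCompactSupport (fun y => φ.toComplexFun (t, y)) := by
    obtain ⟨R, hR⟩ := φ.hasCompactSupport_toComplexFun.exists_norm_lt_of_ne_zero
    refine HasCompactSupport.intro (isCompact_closedBall (0 : SpaceE d) R) fun y hy => hR _ ?_
    simp only [Metric.mem_closedBall, dist_zero_right, not_le] at hy
    exact hy.trans_le (norm_snd_le ((t, y) : ℝ × SpaceE d))
  -- Only decay of the transform itself is wanted, so no derivative is taken on the Fourier side (`K
  -- = 0`, `k = 0`).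
  have h := Real.pow_mul_norm_iteratedFDeriv_fourier_le (K := 0) (N := ⊤) hsm
    (fun k m hk _ => by
      have hk0 : k = 0 := by simpa using hk
      subst hk0
      simp only [pow_zero, one_mul]
      exact ((hsm.continuous_iteratedFDeriv (by exact_mod_cast le_top)).integrable_of_hasCompactSupport
        (hcs.iteratedFDeriv m)).norm)
    (k := 0) (n := n) le_rfl le_top ((1 / (2 * Real.pi)) • ξ)
  rw [norm_iteratedFDeriv_zero, ← spaceFourier_testFn_eq_fourier, norm_smul, mul_pow,
    Real.norm_of_nonneg (by positivity)] at h
  simp only [pow_zero, one_mul, CharP.cast_eq_zero, mul_zero, zero_add, Finset.range_one,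
    Finset.singleton_product, Finset.sum_map, Function.Embedding.coeFn_mk] at h
  have h2 : ∑ x ∈ Finset.range (n + 1),
      ∫ v, ‖iteratedFDeriv ℝ x (fun y => φ.toComplexFun (t, y)) v‖ ≤
      ∑ k ∈ Finset.range (n + 1), C k := Finset.sum_le_sum fun k _ => hC k t
  calc _ = (2 * Real.pi) ^ n * ((1 / (2 * Real.pi)) ^ n * ‖ξ‖ ^ n *
        ‖spaceFourier (fun s x => φ (s, x)) t ξ‖) := by
        have : (2 * Real.pi) ^ n * (1 / (2 * Real.pi)) ^ n = 1 := by
          rw [← mul_pow, mul_one_div_cancel (by positivity), one_pow]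
        linear_combination (-(‖ξ‖ ^ n * ‖spaceFourier (fun s x => φ (s, x)) t ξ‖)) * this
    _ ≤ (2 * Real.pi) ^ n * (2 ^ n * ∑ k ∈ Finset.range (n + 1), C k) :=
        mul_le_mul_of_nonneg_left (h.trans (by gcongr)) (by positivity)

theorem TestFunction.exists_norm_spaceFourier_le (φ : TestFn d) (n : ℕ) :
    ∃ C : ℝ, 0 ≤ C ∧
      ∀ t ξ, ‖spaceFourier (fun s x => φ (s, x)) t ξ‖ ≤ C * (1 + ‖ξ‖) ^ (-(n : ℝ)) := by
  obtain ⟨C₁, h₁, hC₁⟩ := φ.exists_pow_mul_norm_spaceFourier_le 0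
  obtain ⟨C₂, h₂, hC₂⟩ := φ.exists_pow_mul_norm_spaceFourier_le n
  refine ⟨2 ^ n * (C₁ + C₂), by positivity, fun t ξ => ?_⟩
  have := pow_mul_le_of_le_of_pow_mul_le (k := 0) (l := n) (norm_nonneg ξ)
    (norm_nonneg (spaceFourier (fun s x => φ (s, x)) t ξ)) (by simpa using hC₁ t ξ)
    (by simpa using hC₂ t ξ)
  simpa using this

theorem TestFunction.exists_spaceFourier_eq_zero (φ : TestFn d) :
    ∃ R : ℝ, ∀ t, R < |t| → ∀ ξ, spaceFourier (fun s x => φ (s, x)) t ξ = 0 := by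
  obtain ⟨R, hR⟩ := φ.hasCompactSupport.exists_norm_lt_of_ne_zero
  refine ⟨R, fun t ht ξ => ?_⟩
  have : ∀ x, φ (t, x) = 0 := fun x => hR _ (ht.trans_le (norm_fst_le ((t, x) : ℝ × SpaceE d)))
  simp [spaceFourier, this]

theorem integrable_testFn_slice (φ : TestFn d) (t : ℝ) (ξ : SpaceE d) :
    Integrable (fun x => Complex.exp (-(Complex.I * ((inner ℝ ξ x : ℝ) : ℂ))) * (φ (t, x) : ℂ)) := by
  obtain ⟨R, hR⟩ := φ.hasCompactSupport.exists_norm_lt_of_ne_zero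
  refine Continuous.integrable_of_hasCompactSupport ?_ ?_
  · have := φ.continuous
    fun_prop
  · refine HasCompactSupport.intro (isCompact_closedBall (0 : SpaceE d) R) fun y hy => ?_
    simp only [Metric.mem_closedBall, dist_zero_right, not_le] at hy
    rw [hR (t, y) (hy.trans_le (norm_snd_le ((t, y) : ℝ × SpaceE d)))]
    simp

/-- Continuity supplies the joint measurability in `(t,ξ)` behind the product-measure form of the
noise distance. -/
theorem continuous_spaceFourier_testFn (φ : TestFn d) :
    Continuous (fun p : ℝ × SpaceE d => spaceFourier (fun s x => φ (s, x)) p.1 p.2) := by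
  obtain ⟨R, hR⟩ := φ.hasCompactSupport.exists_norm_lt_of_ne_zero
  obtain ⟨B, hB⟩ := φ.continuous.bounded_above_of_compact_support φ.hasCompactSupport
  have hφ := φ.continuous
  unfold spaceFourier
  refine continuous_of_dominated
    (bound := (Metric.closedBall (0 : SpaceE d) R).indicator fun _ => B) (fun p => ?_)
    (fun p => Eventually.of_forall fun x => ?_) ?_ (Eventually.of_forall fun x => ?_)
  · exact (integrable_testFn_slice φ p.1 p.2).aestronglyMeasurable
  · have hn : ‖Complex.exp (-(Complex.I * ((inner ℝ p.2 x : ℝ) : ℂ)))‖ = 1 := by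
      simp [Complex.norm_exp]
    rw [norm_mul, hn, one_mul, Complex.norm_real]
    by_cases hx : x ∈ Metric.closedBall (0 : SpaceE d) R
    · simpa [hx] using hB (p.1, x)
    · have h1 : R < ‖((p.1, x) : ℝ × SpaceE d)‖ := by
        simp only [Metric.mem_closedBall, dist_zero_right, not_le] at hx
        exact hx.trans_le (norm_snd_le ((p.1, x) : ℝ × SpaceE d))
      simp [hx, hR _ h1]
  · exact (integrable_indicator_iff measurableSet_closedBall).2
      (integrableOn_const (isCompact_closedBall 0 R).measure_lt_top.ne)
  · fun_prop

/-- The integrable weight `(1+|x|)^(-n)` is bounded below on balls, so `μ` is finite on compacts.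
Tonelli's theorem for `dt ⊗ μ` rests on this. -/
theorem MeasureTheory.Measure.HasTemperateGrowth.sigmaFinite {μ : Measure (SpaceE d)}
    (hμ : μ.HasTemperateGrowth) : SigmaFinite μ := by
  obtain ⟨n, hn⟩ := hμ.exists_integrable
  have : IsFiniteMeasureOnCompacts μ := by
    refine ⟨fun K hK => ?_⟩
    obtain ⟨R, hR⟩ := hK.isBounded.exists_norm_le
    have hR0 : 0 < 1 + |R| := by positivity
    refine lt_of_le_of_lt (measure_mono fun x hx => ?_)
      (hn.measure_norm_ge_lt_top (ε := (1 + |R|) ^ (-(n : ℝ))) (by positivity))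
    simp only [Set.mem_ofPred_eq]
    rw [Real.norm_of_nonneg (by positivity)]
    refine Real.rpow_le_rpow_of_nonpos (by positivity) ?_ (by simp)
    linarith [hR x hx, le_abs_self R]
  infer_instance

variable {μ : Measure (SpaceE d)}

/-- The covariance can be expanded bilinearly only if its Bochner integrals converge. One factor
carries the decay that `μ` demands; the other need only be bounded, hence the order `0` for `ψ`. -/
theorem integrable_spaceFourier_mul_conj (hμ : μ.HasTemperateGrowth) (φ ψ : TestFn d) (t : ℝ) :
    Integrable (fun ξ => spaceFourier (fun s x => φ (s, x)) t ξ *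
      conj (spaceFourier (fun s x => ψ (s, x)) t ξ)) μ := by
  obtain ⟨n, hn⟩ := hμ.exists_integrable
  obtain ⟨C, hC0, hC⟩ := φ.exists_norm_spaceFourier_le n
  obtain ⟨D, hD0, hD⟩ := ψ.exists_norm_spaceFourier_le 0
  have h1 := continuous_spaceFourier_testFn φ
  have h2 := continuous_spaceFourier_testFn ψ
  refine (hn.const_mul (C * D)).mono' ?_ (Eventually.of_forall fun ξ => ?_)
  · exact Continuous.aestronglyMeasurable (by fun_prop)
  · rw [norm_mul, RCLike.norm_conj]
    have h3 := hD t ξ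
    simp only [CharP.cast_eq_zero, neg_zero, Real.rpow_zero, mul_one] at h3
    calc _ ≤ (C * (1 + ‖ξ‖) ^ (-(n : ℝ))) * D := by
          gcongr
          exact hC t ξ
      _ = _ := by ring

theorem integrable_integral_spaceFourier_mul_conj (hμ : μ.HasTemperateGrowth) (φ ψ : TestFn d) :
    Integrable (fun t => ∫ ξ, spaceFourier (fun s x => φ (s, x)) t ξ *
      conj (spaceFourier (fun s x => ψ (s, x)) t ξ) ∂μ) := by
  obtain ⟨n, hn⟩ := hμ.exists_integrable
  obtain ⟨C, hC0, hC⟩ := φ.exists_norm_spaceFourier_le n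
  obtain ⟨D, hD0, hD⟩ := ψ.exists_norm_spaceFourier_le 0
  obtain ⟨R, hR⟩ := φ.exists_spaceFourier_eq_zero
  have h1 := continuous_spaceFourier_testFn φ
  have h2 := continuous_spaceFourier_testFn ψ
  refine Continuous.integrable_of_hasCompactSupport ?_ ?_
  · refine continuous_of_dominated (bound := fun ξ => (C * D) * (1 + ‖ξ‖) ^ (-(n : ℝ)))
      (fun t => ?_) (fun t => Eventually.of_forall fun ξ => ?_) (hn.const_mul (C * D))
      (Eventually.of_forall fun ξ => ?_)
    · exact Continuous.aestronglyMeasurable (by fun_prop)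
    · rw [norm_mul, RCLike.norm_conj]
      have h3 := hD t ξ
      simp only [CharP.cast_eq_zero, neg_zero, Real.rpow_zero, mul_one] at h3
      calc _ ≤ (C * (1 + ‖ξ‖) ^ (-(n : ℝ))) * D := by
            gcongr
            exact hC t ξ
        _ = _ := by ring
    · fun_prop
  · refine HasCompactSupport.intro (isCompact_closedBall (0 : ℝ) R) fun t ht => ?_
    simp only [Metric.mem_closedBall, dist_zero_right, not_le, Real.norm_eq_abs] at ht
    simp [hR t ht]

end TestFunctions

/-! ### Moments of Wiener integrals -/

section Wiener

variable {d : ℕ} {Ω : Type*} [MeasurableSpace Ω] {P : Measure Ω} {μ : Measure (SpaceE d)}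
  {W : TestFn d → Ω → ℝ}

/-- A centred Gaussian variable has the law of `√v` times a standard one, so each of its norms is
proportional to the standard deviation. -/
theorem ProbabilityTheory.HasGaussianLaw.eLpNorm_le [IsProbabilityMeasure P] {X : Ω → ℝ}
    (hX : HasGaussianLaw X P) (h0 : ∫ ω, X ω ∂P = 0) {V : ℝ≥0∞} (hV : ‖∫ ω, X ω ^ 2 ∂P‖ₑ ≤ V)
    (p : ℝ≥0∞) : eLpNorm X p P ≤ eLpNorm id p (gaussianReal 0 1) * V ^ (1 / 2 : ℝ) := by
  have hvar : Var[X; P] = ∫ ω, X ω ^ 2 ∂P := variance_of_integral_eq_zero hX.aemeasurable h0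
  have hnn : 0 ≤ ∫ ω, X ω ^ 2 ∂P := integral_nonneg fun ω => sq_nonneg _
  set v := ∫ ω, X ω ^ 2 ∂P with hv
  have hmap := hX.map_eq_gaussianReal
  rw [h0, hvar] at hmap
  have hsc : gaussianReal 0 v.toNNReal = (gaussianReal 0 1).map (√v * ·) := by
    rw [gaussianReal_map_const_mul, mul_zero, mul_one]
    congr 1
    ext
    simp [Real.sq_sqrt hnn, hnn]
  have e1 : eLpNorm X p P = eLpNorm id p (P.map X) := by
    rw [eLpNorm_map_measure aestronglyMeasurable_id hX.aemeasurable]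
    rfl
  have e2 : eLpNorm id p ((gaussianReal 0 1).map (√v * ·)) =
      ‖√v‖ₑ * eLpNorm id p (gaussianReal 0 1) := by
    rw [eLpNorm_map_measure aestronglyMeasurable_id (by fun_prop)]
    exact eLpNorm_const_smul (√v) id p (gaussianReal 0 1)
  rw [e1, hmap, hsc, e2, mul_comm]
  gcongr
  have e3 : ‖√v‖ₑ = ‖v‖ₑ ^ (1 / 2 : ℝ) := by
    rw [Real.sqrt_eq_rpow, Real.enorm_of_nonneg (by positivity), Real.enorm_of_nonneg hnn,
      ENNReal.ofReal_rpow_of_nonneg hnn (by norm_num)]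
  rw [e3]
  gcongr

theorem integral_add_sub_add {α E : Type*} [MeasurableSpace α] [NormedAddCommGroup E]
    [NormedSpace ℝ E] {m : Measure α} {f g h k : α → E} (hf : Integrable f m)
    (hg : Integrable g m) (hh : Integrable h m) (hk : Integrable k m) :
    ∫ x, ((f x + g x) - (h x + k x)) ∂m =
      (∫ x, f x ∂m + ∫ x, g x ∂m) - (∫ x, h x ∂m + ∫ x, k x ∂m) := by
  rw [← integral_add hf hg, ← integral_add hh hk]
  exact integral_sub (hf.add hg) (hh.add hk)

theorem spaceFourier_testFn_sub_mul_conj (φ ψ : TestFn d) (t : ℝ) (ξ : SpaceE d) :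
    (spaceFourier (fun s x => φ (s, x)) t ξ - spaceFourier (fun s x => ψ (s, x)) t ξ) *
      conj (spaceFourier (fun s x => φ (s, x)) t ξ - spaceFourier (fun s x => ψ (s, x)) t ξ) =
    (spaceFourier (fun s x => φ (s, x)) t ξ * conj (spaceFourier (fun s x => φ (s, x)) t ξ) +
      spaceFourier (fun s x => ψ (s, x)) t ξ * conj (spaceFourier (fun s x => ψ (s, x)) t ξ)) -
    (spaceFourier (fun s x => φ (s, x)) t ξ * conj (spaceFourier (fun s x => ψ (s, x)) t ξ) +
      spaceFourier (fun s x => ψ (s, x)) t ξ * conj (spaceFourier (fun s x => φ (s, x)) t ξ)) := by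
  rw [map_sub]
  ring

/-- The square is expanded and the four covariances recombine into one integral of `|ℱφ-ℱψ|²`. An
inequality suffices, so it is enough to move the norm inside both integrals. -/
theorem IsHomogeneousNoise.enorm_integral_sq_sub_le [IsProbabilityMeasure P]
    (hW : IsHomogeneousNoise P μ W) (φ ψ : TestFn d) :
    ‖∫ ω, (W φ ω - W ψ ω) ^ 2 ∂P‖ₑ ≤
      noiseDistSq μ (fun s x => φ (s, x)) (fun s x => ψ (s, x)) := by
  have hL : ∀ χ, MemLp (W χ) 2 P := fun χ => (hW.gaussian.hasGaussianLaw_eval χ).memLp_two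
  have hI : ∀ χ η, Integrable (fun ω => W χ ω * W η ω) P := fun χ η => (hL χ).integrable_mul (hL η)
  have h1 : ∫ ω, (W φ ω - W ψ ω) ^ 2 ∂P = (∫ ω, W φ ω * W φ ω ∂P + ∫ ω, W ψ ω * W ψ ω ∂P) -
      (∫ ω, W φ ω * W ψ ω ∂P + ∫ ω, W ψ ω * W φ ω ∂P) := by
    rw [← integral_add_sub_add (hI _ _) (hI _ _) (hI _ _) (hI _ _)]
    congr 1
    ext ω
    ring
  have hin := integrable_spaceFourier_mul_conj hW.tempered
  have hout := fun χ η => (integrable_integral_spaceFourier_mul_conj hW.tempered χ η).restrict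
    (s := Set.Ioi (0 : ℝ))
  have h2 : ((∫ ω, (W φ ω - W ψ ω) ^ 2 ∂P : ℝ) : ℂ) = ∫ t in Set.Ioi (0 : ℝ), ∫ ξ,
      (spaceFourier (fun s x => φ (s, x)) t ξ - spaceFourier (fun s x => ψ (s, x)) t ξ) *
      conj (spaceFourier (fun s x => φ (s, x)) t ξ -
        spaceFourier (fun s x => ψ (s, x)) t ξ) ∂μ := by
    rw [h1, Complex.ofReal_sub, Complex.ofReal_add, Complex.ofReal_add, hW.covariance,
      hW.covariance, hW.covariance, hW.covariance,
      ← integral_add_sub_add (hout _ _) (hout _ _) (hout _ _) (hout _ _)]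
    congr 1
    ext t
    simp_rw [spaceFourier_testFn_sub_mul_conj]
    rw [integral_add_sub_add (hin _ _ _) (hin _ _ _) (hin _ _ _) (hin _ _ _)]
  have h3 : ‖∫ ω, (W φ ω - W ψ ω) ^ 2 ∂P‖ₑ = ‖((∫ ω, (W φ ω - W ψ ω) ^ 2 ∂P : ℝ) : ℂ)‖ₑ := by
    rw [← ofReal_norm, ← ofReal_norm, Complex.norm_real]
  rw [h3, h2]
  refine (enorm_integral_le_lintegral_enorm _).trans (lintegral_mono fun t => ?_)
  refine (enorm_integral_le_lintegral_enorm _).trans (lintegral_mono fun ξ => le_of_eq ?_)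
  rw [← ofReal_norm, ← ofReal_norm, ← ENNReal.ofReal_pow (norm_nonneg _), norm_mul,
    RCLike.norm_conj, sq]

theorem noiseDistSq_comm (g h : ℝ → SpaceE d → ℝ) : noiseDistSq μ g h = noiseDistSq μ h g := by
  unfold noiseDistSq
  simp_rw [← ofReal_norm, norm_sub_rev]

theorem noiseDistSq_eq_lintegral_prod [SFinite μ] {g h : ℝ → SpaceE d → ℝ}
    (hg : Measurable (fun p : ℝ × SpaceE d => spaceFourier g p.1 p.2))
    (hh : Measurable (fun p : ℝ × SpaceE d => spaceFourier h p.1 p.2)) :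
    noiseDistSq μ g h = ∫⁻ p, ‖spaceFourier g p.1 p.2 - spaceFourier h p.1 p.2‖ₑ ^ 2
      ∂((volume.restrict (Set.Ioi (0 : ℝ))).prod μ) :=
  (lintegral_prod _ ((hg.sub hh).enorm.pow_const 2).aemeasurable).symm

/-- Squared triangle inequality through two intermediate points; it links the approximants of two
integrands, and the loss of a factor `3` is harmless. -/
theorem lintegral_enorm_sub_sq_le_three {α : Type*} [MeasurableSpace α] {m : Measure α}
    {a b c e : α → ℂ} (ha : Measurable a) (hb : Measurable b) (hc : Measurable c) :
    ∫⁻ x, ‖a x - e x‖ₑ ^ 2 ∂m ≤ 3 * (∫⁻ x, ‖a x - b x‖ₑ ^ 2 ∂m + ∫⁻ x, ‖b x - c x‖ₑ ^ 2 ∂m +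
      ∫⁻ x, ‖c x - e x‖ₑ ^ 2 ∂m) := by
  have h1 : Measurable (fun x => ‖a x - b x‖ₑ ^ 2) := (ha.sub hb).enorm.pow_const 2
  have h2 : Measurable (fun x => ‖b x - c x‖ₑ ^ 2) := (hb.sub hc).enorm.pow_const 2
  have h12 : Measurable (fun x => ‖a x - b x‖ₑ ^ 2 + ‖b x - c x‖ₑ ^ 2) := h1.add h2
  rw [← lintegral_add_left h1, ← lintegral_add_left h12, ← lintegral_const_mul' _ _ (by simp)]
  refine lintegral_mono fun x => ?_
  have h3 : (3 : ℝ≥0∞) = ENNReal.ofReal 3 := by simp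
  simp only [h3, ← ofReal_norm, ← ENNReal.ofReal_pow (norm_nonneg _)]
  rw [← ENNReal.ofReal_add (by positivity) (by positivity),
    ← ENNReal.ofReal_add (by positivity) (by positivity), ← ENNReal.ofReal_mul (by norm_num)]
  refine ENNReal.ofReal_le_ofReal ?_
  have h4 : ‖a x - e x‖ ≤ ‖a x - b x‖ + ‖b x - c x‖ + ‖c x - e x‖ := by
    calc ‖a x - e x‖ = ‖(a x - b x) + (b x - c x) + (c x - e x)‖ := by ring_nf
      _ ≤ _ := norm_add₃_le
  have h5 : ‖a x - e x‖ ^ 2 ≤ (‖a x - b x‖ + ‖b x - c x‖ + ‖c x - e x‖) ^ 2 := by gcongr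
  nlinarith [sq_nonneg (‖a x - b x‖ - ‖b x - c x‖), sq_nonneg (‖b x - c x‖ - ‖c x - e x‖),
    sq_nonneg (‖a x - b x‖ - ‖c x - e x‖)]

theorem noiseDistSq_le_three [SFinite μ] {f g h k : ℝ → SpaceE d → ℝ}
    (hf : Measurable (fun p : ℝ × SpaceE d => spaceFourier f p.1 p.2))
    (hg : Measurable (fun p : ℝ × SpaceE d => spaceFourier g p.1 p.2))
    (hh : Measurable (fun p : ℝ × SpaceE d => spaceFourier h p.1 p.2))
    (hk : Measurable (fun p : ℝ × SpaceE d => spaceFourier k p.1 p.2)) :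
    noiseDistSq μ f k ≤ 3 * (noiseDistSq μ f g + noiseDistSq μ g h + noiseDistSq μ h k) := by
  rw [noiseDistSq_eq_lintegral_prod hf hk, noiseDistSq_eq_lintegral_prod hf hg,
    noiseDistSq_eq_lintegral_prod hg hh, noiseDistSq_eq_lintegral_prod hh hk]
  exact lintegral_enorm_sub_sq_le_three hf hg hh

/-- The differences `W(φ_k) - W(ψ_k)` are Gaussian and obey the bound up to vanishing errors. Fatou
along an almost surely convergent subsequence carries it to `X - Y`, without identifying the law of
the limit. -/
theorem IsWienerIntegral.eLpNorm_sub_le [IsProbabilityMeasure P] (hW : IsHomogeneousNoise P μ W)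
    {g h : ℝ → SpaceE d → ℝ} {X Y : Ω → ℝ} (hX : IsWienerIntegral P μ W g X)
    (hY : IsWienerIntegral P μ W h Y)
    (hg : Measurable (fun p : ℝ × SpaceE d => spaceFourier g p.1 p.2))
    (hh : Measurable (fun p : ℝ × SpaceE d => spaceFourier h p.1 p.2)) {p : ℝ≥0∞} (hp : p ≠ ∞) :
    eLpNorm (X - Y) p P ≤
      eLpNorm id p (gaussianReal 0 1) * (3 * noiseDistSq μ g h) ^ (1 / 2 : ℝ) := by
  have := hW.tempered.sigmaFinite
  obtain ⟨hX2, φ, hφ, hφX⟩ := hX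
  obtain ⟨hY2, ψ, hψ, hψY⟩ := hY
  have hc : eLpNorm id p (gaussianReal 0 1) ≠ ∞ := (memLp_id_gaussianReal' p hp).2.ne
  have hWm : ∀ χ, AEStronglyMeasurable (W χ) P :=
    fun χ => (hW.gaussian.aemeasurable χ).aestronglyMeasurable
  have hm : ∀ χ : TestFn d,
      Measurable (fun p : ℝ × SpaceE d => spaceFourier (fun s x => χ (s, x)) p.1 p.2) :=
    fun χ => (continuous_spaceFourier_testFn χ).measurable
  have hbound : ∀ k, eLpNorm (W (φ k) - W (ψ k)) p P ≤ eLpNorm id p (gaussianReal 0 1) *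
      (3 * (noiseDistSq μ (fun s x => φ k (s, x)) g + noiseDistSq μ g h +
        noiseDistSq μ (fun s x => ψ k (s, x)) h)) ^ (1 / 2 : ℝ) := by
    intro k
    refine (hW.gaussian.hasGaussianLaw_sub).eLpNorm_le ?_ ?_ p
    · have hi : ∀ χ, Integrable (W χ) P := fun χ => (hW.gaussian.hasGaussianLaw_eval χ).integrable
      simp only [Pi.sub_apply]
      rw [integral_sub (hi _) (hi _), hW.mean_zero, hW.mean_zero, sub_zero]
    · refine (hW.enorm_integral_sq_sub_le (φ k) (ψ k)).trans ?_
      rw [noiseDistSq_comm (fun s x => ψ k (s, x)) h]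
      exact noiseDistSq_le_three (hm _) hg hh (hm _)
  have hlim : Tendsto (fun k => eLpNorm id p (gaussianReal 0 1) *
      (3 * (noiseDistSq μ (fun s x => φ k (s, x)) g + noiseDistSq μ g h +
        noiseDistSq μ (fun s x => ψ k (s, x)) h)) ^ (1 / 2 : ℝ)) atTop
      (𝓝 (eLpNorm id p (gaussianReal 0 1) * (3 * noiseDistSq μ g h) ^ (1 / 2 : ℝ))) := by
    have h1 : Tendsto (fun k => noiseDistSq μ (fun s x => φ k (s, x)) g + noiseDistSq μ g h +
        noiseDistSq μ (fun s x => ψ k (s, x)) h) atTop (𝓝 (0 + noiseDistSq μ g h + 0)) :=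
      (hφ.add tendsto_const_nhds).add hψ
    rw [zero_add, add_zero] at h1
    refine ENNReal.Tendsto.const_mul ?_ (Or.inr hc)
    exact (ENNReal.Tendsto.const_mul h1 (Or.inr (by simp))).ennrpow_const _
  have hL2 : Tendsto (fun k => eLpNorm ((W (φ k) - W (ψ k)) - (X - Y)) 2 P) atTop (𝓝 0) := by
    have h1 : Tendsto (fun k => eLpNorm (W (φ k) - X) 2 P + eLpNorm (W (ψ k) - Y) 2 P) atTop
        (𝓝 0) := by simpa using hφX.add hψY
    refine tendsto_of_tendsto_of_tendsto_of_le_of_le tendsto_const_nhds h1 (fun _ => zero_le)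
      fun k => ?_
    have e : (W (φ k) - W (ψ k)) - (X - Y) = (W (φ k) - X) - (W (ψ k) - Y) := by abel
    simp only [e]
    exact MeasureTheory.eLpNorm_sub_le ((hWm _).sub hX2.1) ((hWm _).sub hY2.1) (by norm_num)
  obtain ⟨ns, hns, hae⟩ := (tendstoInMeasure_of_tendsto_eLpNorm (by norm_num)
    (fun k => (hWm (φ k)).sub (hWm (ψ k))) (hX2.1.sub hY2.1) hL2).exists_seq_tendsto_ae
  refine (Lp.eLpNorm_lim_le_liminf_eLpNorm (fun k => (hWm (φ (ns k))).sub (hWm (ψ (ns k)))) _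
    hae).trans ?_
  refine (liminf_le_liminf (Eventually.of_forall fun k => hbound (ns k))).trans_eq ?_
  exact (hlim.comp hns.tendsto_atTop).liminf_eq

/-- Comparison with the zero integrand turns the estimate for differences into one for a single
Wiener integral. -/
theorem IsHomogeneousNoise.isWienerIntegral_zero [IsProbabilityMeasure P]
    (hW : IsHomogeneousNoise P μ W) : IsWienerIntegral P μ W (fun _ _ => 0) (0 : Ω → ℝ) := by
  refine ⟨MemLp.zero, fun _ => 0, ?_, ?_⟩
  · simp
  · have h0 := hW.covariance 0 0
    simp only [FunLike.coe_zero, Pi.zero_apply, spaceFourier_zero, map_zero, mul_zero,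
      integral_zero] at h0
    have h1 : ∫ ω, (W 0 ω) ^ 2 ∂P = 0 := by
      simp_rw [sq]; exact_mod_cast h0
    have h2 := (hW.gaussian.hasGaussianLaw_eval 0).eLpNorm_le (hW.mean_zero 0) (V := 0)
      (by simp [h1]) 2
    have h3 : eLpNorm (W 0) 2 P = 0 := by simpa using h2
    simp [h3]

end Wiener

/-! ### `L¹` estimates for the space-time heat kernel -/

theorem measurable_convolutionIntegrand {d : ℕ} (t : ℝ) (x : SpaceE d) :
    Measurable (fun z : ℝ × SpaceE d => convolutionIntegrand t x z.1 z.2) := by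
  have h : (fun z : ℝ × SpaceE d => convolutionIntegrand t x z.1 z.2) =
      {z : ℝ × SpaceE d | z.1 ∈ Set.Ico 0 t}.indicator
        (fun z => gaussKernel (t - z.1) (x - z.2)) := by
    ext z
    unfold convolutionIntegrand
    by_cases hz : z.1 ∈ Set.Ico 0 t
    · rw [Set.indicator_of_mem hz, Set.indicator_of_mem (by exact hz)]
    · rw [Set.indicator_of_notMem hz, Set.indicator_of_notMem (by exact hz)]
  rw [h]
  exact (measurable_gaussKernel.comp (by fun_prop : Measurable fun z : ℝ × SpaceE d =>
    (t - z.1, x - z.2))).indicator (measurable_fst measurableSet_Ico)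

theorem convolutionIntegrand_of_mem {d : ℕ} {s t : ℝ} (h : s ∈ Set.Ico 0 t) (x y : SpaceE d) :
    convolutionIntegrand t x s y = gaussKernel (t - s) (x - y) := by
  simp [convolutionIntegrand, h]

theorem convolutionIntegrand_of_le {d : ℕ} {s t : ℝ} (h : t ≤ s) (x y : SpaceE d) :
    convolutionIntegrand t x s y = 0 := by
  simp [convolutionIntegrand, h]

/-- Lebesgue measure on the strip `(0, T) × ℝ^d`. -/
noncomputable def stripMeasure (d : ℕ) (T : ℝ) : Measure (ℝ × SpaceE d) :=
  (volume.restrict (Set.Ioo 0 T)).prod volume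

instance (d : ℕ) (T : ℝ) : SFinite (stripMeasure d T) := by
  unfold stripMeasure; infer_instance

theorem lintegral_stripMeasure {d : ℕ} {T : ℝ} {f : ℝ × SpaceE d → ℝ≥0∞} (hf : Measurable f) :
    ∫⁻ z, f z ∂stripMeasure d T = ∫⁻ s in Set.Ioo 0 T, ∫⁻ y, f (s, y) :=
  lintegral_prod _ hf.aemeasurable

theorem lintegral_enorm_convolutionIntegrand_slice {d : ℕ} {s t : ℝ} (h : s ∈ Set.Ico 0 t)
    (x : SpaceE d) : ∫⁻ y, ‖convolutionIntegrand t x s y‖ₑ = 1 := by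
  simp_rw [convolutionIntegrand_of_mem h]
  exact lintegral_enorm_gaussKernel_sub (by linarith [h.2]) x

theorem lintegral_rpow_neg_le {a t T : ℝ} (ha0 : 0 ≤ a) (ha1 : a < 1) (ht : 0 ≤ t) (htT : t ≤ T) :
    ∫⁻ s in Set.Ioo 0 t, ENNReal.ofReal ((t - s) ^ (-a)) ≤ ENNReal.ofReal ((T + 1) / (1 - a)) := by
  have hi : IntervalIntegrable (fun s : ℝ => (t - s) ^ (-a)) volume 0 t := by
    have := (intervalIntegral.intervalIntegrable_rpow' (a := 0) (b := t) (r := -a)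
      (by linarith)).comp_sub_left t
    simpa using this.symm
  rw [restrict_Ioo_eq_restrict_Ioc, ← ofReal_integral_eq_lintegral_ofReal hi.1
    ((ae_restrict_iff' measurableSet_Ioc).2
      (Eventually.of_forall fun s hs => Real.rpow_nonneg (by linarith [hs.2]) _))]
  refine ENNReal.ofReal_le_ofReal ?_
  rw [← intervalIntegral.integral_of_le ht,
    intervalIntegral.integral_comp_sub_left (fun r : ℝ => r ^ (-a)) t, sub_self, sub_zero,
    integral_rpow (Or.inl (by linarith)), Real.zero_rpow (by linarith), sub_zero]
  have e : -a + 1 = 1 - a := by ring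
  rw [e]
  have h1 : 0 < 1 - a := by linarith
  gcongr
  calc t ^ (1 - a) ≤ (T + 1) ^ (1 - a) := by gcongr; linarith
    _ ≤ (T + 1) ^ (1 : ℝ) := Real.rpow_le_rpow_of_exponent_le (by linarith) (by linarith)
    _ = _ := Real.rpow_one _

/-- Common scheme for the three kernel bounds: a singularity of order `a < 1` at the final time is
integrable, and nothing is contributed after `t`. The exponent is `a = 0` for one kernel and `a =
β/2` for differences. -/
theorem lintegral_stripMeasure_le_of_slice_le {d : ℕ} {t T A a : ℝ} (hA : 0 ≤ A) (ha0 : 0 ≤ a)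
    (ha1 : a < 1) (ht : 0 ≤ t) (htT : t ≤ T) {f : ℝ × SpaceE d → ℝ≥0∞} (hf : Measurable f)
    (h1 : ∀ s, 0 < s → s < t → ∫⁻ y, f (s, y) ≤ ENNReal.ofReal (A * (t - s) ^ (-a)))
    (h2 : ∀ s, t ≤ s → ∀ y, f (s, y) = 0) :
    ∫⁻ z, f z ∂stripMeasure d T ≤ ENNReal.ofReal ((T + 1) / (1 - a) * A) := by
  rw [lintegral_stripMeasure hf]
  calc ∫⁻ s in Set.Ioo 0 T, ∫⁻ y, f (s, y)
      ≤ ∫⁻ s in Set.Ioo 0 T, (Set.Ioo 0 t).indicator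
          (fun s => ENNReal.ofReal A * ENNReal.ofReal ((t - s) ^ (-a))) s := by
        refine setLIntegral_mono' measurableSet_Ioo fun s hs => ?_
        rcases lt_or_ge s t with h | h
        · have hm : s ∈ Set.Ioo 0 t := ⟨hs.1, h⟩
          rw [Set.indicator_of_mem hm, ← ENNReal.ofReal_mul hA]
          exact h1 s hs.1 h
        · simp [h2 s h]
    _ ≤ ∫⁻ s, (Set.Ioo 0 t).indicator
          (fun s => ENNReal.ofReal A * ENNReal.ofReal ((t - s) ^ (-a))) s :=
        setLIntegral_le_lintegral _ _
    _ = ENNReal.ofReal A * ∫⁻ s in Set.Ioo 0 t, ENNReal.ofReal ((t - s) ^ (-a)) := by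
        rw [lintegral_indicator measurableSet_Ioo, lintegral_const_mul' _ _ ENNReal.ofReal_ne_top]
    _ ≤ ENNReal.ofReal A * ENNReal.ofReal ((T + 1) / (1 - a)) := by
        gcongr
        exact lintegral_rpow_neg_le ha0 ha1 ht htT
    _ = _ := by rw [← ENNReal.ofReal_mul hA, mul_comm]

section KernelDistance

variable {d : ℕ} {T : ℝ}

theorem lintegral_enorm_convolutionIntegrand_le {t : ℝ} (ht : 0 ≤ t) (htT : t ≤ T)
    (x : SpaceE d) :
    ∫⁻ z, ‖convolutionIntegrand t x z.1 z.2‖ₑ ∂stripMeasure d T ≤ ENNReal.ofReal (T + 1) := by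
  refine (lintegral_stripMeasure_le_of_slice_le (A := 1) (a := 0) zero_le_one le_rfl zero_lt_one ht
    htT (measurable_convolutionIntegrand t x).enorm (fun s hs hst => ?_)
    (fun s hs y => ?_)).trans_eq (by simp)
  · simp [lintegral_enorm_convolutionIntegrand_slice ⟨hs.le, hst⟩ x]
  · simp [convolutionIntegrand_of_le hs]

theorem lintegral_convolutionIntegrand_space_sub_le {β : ℝ} (hβ0 : 0 < β) (hβ1 : β ≤ 1) {t : ℝ}
    (ht : 0 ≤ t) (htT : t ≤ T) (x z : SpaceE d) :
    ∫⁻ w, ‖convolutionIntegrand t x w.1 w.2 - convolutionIntegrand t z w.1 w.2‖ₑ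
      ∂stripMeasure d T ≤ ENNReal.ofReal ((T + 1) / (1 - β / 2) * (3 * ‖x - z‖ ^ β)) := by
  refine lintegral_stripMeasure_le_of_slice_le (by positivity) (by linarith) (by linarith) ht htT
    ((measurable_convolutionIntegrand t x).sub (measurable_convolutionIntegrand t z)).enorm
    (fun s hs hst => ?_) (fun s hs y => ?_)
  · simp_rw [convolutionIntegrand_of_mem (⟨hs.le, hst⟩ : s ∈ Set.Ico 0 t)]
    exact lintegral_gaussKernel_sub_sub_le (by linarith) x z hβ0 hβ1
  · simp [convolutionIntegrand_of_le hs]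

theorem lintegral_convolutionIntegrand_time_sub_le (hd : 1 ≤ d) {β : ℝ} (hβ0 : 0 < β)
    (hβ1 : β ≤ 1) {s t : ℝ} (hs : 0 ≤ s) (hst : s ≤ t) (htT : t ≤ T) (x : SpaceE d) :
    ∫⁻ w, ‖convolutionIntegrand t x w.1 w.2 - convolutionIntegrand s x w.1 w.2‖ₑ
      ∂stripMeasure d T ≤
      ENNReal.ofReal ((T + 1) / (1 - β / 2) * (3 * d * (t - s) ^ (β / 2))) := by
  have h0 : 0 ≤ t - s := by linarith
  have hd0 : (1 : ℝ) ≤ d := by exact_mod_cast hd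
  refine lintegral_stripMeasure_le_of_slice_le (by positivity) (by linarith) (by linarith)
    (hs.trans hst) htT
    ((measurable_convolutionIntegrand t x).sub (measurable_convolutionIntegrand s x)).enorm
    (fun r hr hrt => ?_) (fun r hr y => ?_)
  · rcases lt_or_ge r s with h | h
    · simp_rw [convolutionIntegrand_of_mem (⟨hr.le, hrt⟩ : r ∈ Set.Ico 0 t),
        convolutionIntegrand_of_mem (⟨hr.le, h⟩ : r ∈ Set.Ico 0 s)]
      have := lintegral_gaussKernel_time_sub_le hd (r := s - r) (r' := t - r) (by linarith)
        (by linarith) x hβ0 hβ1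
      rwa [sub_sub_sub_cancel_right] at this
    -- For `s ≤ r < t` a single kernel of mass `1` remains, and `1 ≤ (t-s)^(β/2) (t-r)^(-β/2)`
    -- because `t-r ≤ t-s`. The slice bound thus has the same form on both sides of `s`.
    · simp_rw [convolutionIntegrand_of_le h, sub_zero]
      rw [lintegral_enorm_convolutionIntegrand_slice ⟨hr.le, hrt⟩, ← ENNReal.ofReal_one]
      refine ENNReal.ofReal_le_ofReal ?_
      have h1 : 0 < t - r := by linarith
      have h2 : (t - r) ^ (β / 2) ≤ (t - s) ^ (β / 2) := by gcongr
      have h3 : 1 ≤ (t - s) ^ (β / 2) * (t - r) ^ (-(β / 2)) := by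
        rw [Real.rpow_neg h1.le, ← div_eq_mul_inv, one_le_div (by positivity)]
        exact h2
      nlinarith
  · simp [convolutionIntegrand_of_le hr, convolutionIntegrand_of_le (hst.trans hr)]

end KernelDistance

/-! ### Moment inequalities -/

/-- Minkowski's integral inequality against an integrable weight. -/
theorem lintegral_rpow_lintegral_mul_le {Z Ω : Type*} [MeasurableSpace Z] [MeasurableSpace Ω]
    {ν : Measure Z} [SFinite ν] {P : Measure Ω} [SFinite P] {F : Z → Ω → ℝ≥0∞}
    (hF : Measurable (Function.uncurry F)) {κ : Z → ℝ≥0∞} (hκ : Measurable κ) {p : ℝ} (hp : 1 < p)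
    {B m : ℝ≥0∞} (hB : ∀ᵐ z ∂ν, ∫⁻ ω, F z ω ^ p ∂P ≤ B ^ p) (hm : ∫⁻ z, κ z ∂ν ≤ m) :
    ∫⁻ ω, (∫⁻ z, F z ω * κ z ∂ν) ^ p ∂P ≤ (m * B) ^ p := by
  have hp0 : 0 < p := by linarith
  have hpq := Real.HolderConjugate.conjExponent hp
  set q := p.conjExponent with hq
  have hq0 : 0 ≤ 1 / q := one_div_nonneg.2 hpq.symm.nonneg
  have hFm : ∀ ω, Measurable (fun z => F z ω) := fun ω => hF.comp measurable_prodMk_right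
  -- Hölder against the constant `1` for the measure `κ ν`, of mass at most `m`; the exponent is
  -- `p/q = p-1`. After this pointwise bound only Tonelli is needed.
  have hpt : ∀ ω, (∫⁻ z, F z ω * κ z ∂ν) ^ p ≤
      (∫⁻ z, F z ω ^ p * κ z ∂ν) * m ^ (p - 1) := by
    intro ω
    have h1 : ∫⁻ z, F z ω * κ z ∂ν = ∫⁻ z, F z ω * 1 ∂(ν.withDensity κ) := by
      rw [lintegral_withDensity_eq_lintegral_mul _ hκ ((hFm ω).mul_const 1)]
      simp [mul_comm]
    have h2 : ∫⁻ z, F z ω ^ p * κ z ∂ν = ∫⁻ z, F z ω ^ p ∂(ν.withDensity κ) := by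
      rw [lintegral_withDensity_eq_lintegral_mul _ hκ ((hFm ω).pow_const p)]
      simp [mul_comm]
    have h3 := ENNReal.lintegral_mul_le_Lp_mul_Lq (ν.withDensity κ) hpq (hFm ω).aemeasurable
      (aemeasurable_const (b := (1 : ℝ≥0∞)))
    rw [h1, h2]
    simp only [Pi.mul_apply, ENNReal.one_rpow, lintegral_const, one_mul] at h3
    have h4 : (ν.withDensity κ) Set.univ ≤ m := by
      rw [withDensity_apply _ MeasurableSet.univ, Measure.restrict_univ]; exact hm
    calc _ ≤ ((∫⁻ z, F z ω ^ p ∂(ν.withDensity κ)) ^ (1 / p) * m ^ (1 / q)) ^ p := by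
          gcongr
          exact h3.trans (by gcongr)
      _ = _ := by
          rw [ENNReal.mul_rpow_of_nonneg _ _ hp0.le, ← ENNReal.rpow_mul, ← ENNReal.rpow_mul,
            one_div_mul_cancel hp0.ne', ENNReal.rpow_one]
          congr 2
          rw [hq, Real.conjExponent]
          have : p - 1 ≠ 0 := by linarith
          field_simp
  calc ∫⁻ ω, (∫⁻ z, F z ω * κ z ∂ν) ^ p ∂P
      ≤ ∫⁻ ω, (∫⁻ z, F z ω ^ p * κ z ∂ν) * m ^ (p - 1) ∂P := lintegral_mono hpt
    _ = (∫⁻ ω, ∫⁻ z, F z ω ^ p * κ z ∂ν ∂P) * m ^ (p - 1) := by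
        refine lintegral_mul_const _ ?_
        have hm' : Measurable (fun r : Z × Ω => F r.1 r.2 ^ p * κ r.1) :=
          (hF.pow_const p).mul (hκ.comp measurable_fst)
        exact hm'.lintegral_prod_left'
    _ = (∫⁻ z, ∫⁻ ω, F z ω ^ p * κ z ∂P ∂ν) * m ^ (p - 1) := by
        rw [lintegral_lintegral_swap]
        exact (((hF.comp measurable_swap).pow_const p).mul
          (hκ.comp measurable_snd)).aemeasurable
    _ ≤ (∫⁻ z, B ^ p * κ z ∂ν) * m ^ (p - 1) := by
        refine mul_le_mul_left (lintegral_mono_ae (hB.mono fun z hz => ?_)) _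
        have hz' : Measurable (fun ω => F z ω ^ p) :=
          (hF.comp measurable_prodMk_left).pow_const p
        rw [lintegral_mul_const _ hz']
        gcongr
    _ ≤ (B ^ p * m) * m ^ (p - 1) := by
        gcongr
        rw [lintegral_const_mul _ hκ]
        gcongr
    _ = _ := by
        rw [ENNReal.mul_rpow_of_nonneg _ _ hp0.le, mul_assoc, mul_comm]
        congr 1
        have := ENNReal.rpow_add_of_nonneg (x := m) 1 (p - 1) zero_le_one (by linarith)
        rw [ENNReal.rpow_one] at this
        rw [← this]
        congr 1
        ring

/-! ### A priori moment bounds by duality -/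

/-- If all pairings `∫ X Y` with bounded `Y` are dominated by `c ‖Y‖_{p'}`, then `‖X‖_p ≤ c`. -/
theorem lintegral_rpow_le_of_forall_bounded {Ω : Type*} [MeasurableSpace Ω] {P : Measure Ω}
    [IsFiniteMeasure P] {X : Ω → ℝ≥0∞} (hX : Measurable X) {p q : ℝ} (hpq : p.HolderConjugate q)
    {c : ℝ≥0∞}
    (h : ∀ (Y : Ω → ℝ≥0∞) (N : ℝ≥0), Measurable Y → (∀ ω, Y ω ≤ N) →
      ∫⁻ ω, X ω * Y ω ∂P ≤ c * (∫⁻ ω, Y ω ^ q ∂P) ^ (1 / q)) :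
    ∫⁻ ω, X ω ^ p ∂P ≤ c ^ p := by
  have hp0 := hpq.pos
  have hq0 := hpq.symm.pos
  have hp1 : 0 < p - 1 := by linarith [hpq.lt]
  -- The extremal test variable `X^(p-1)` is truncated at level `N`: this makes it admissible and
  -- makes `I` finite, so `I ≤ c I^(1/q)` can be divided by `I^(1/q)`. Monotone convergence then
  -- removes the truncation.
  have hmin : ∀ N : ℕ, ∫⁻ ω, (min (X ω) N) ^ p ∂P ≤ c ^ p := by
    intro N
    have hm : Measurable (fun ω => min (X ω) (N : ℝ≥0∞)) := hX.min measurable_const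
    set I := ∫⁻ ω, (min (X ω) N) ^ p ∂P with hI
    have hN : ((N : ℝ≥0∞)) ^ (p - 1) = (((N : ℝ≥0) ^ (p - 1) : ℝ≥0) : ℝ≥0∞) := by
      rw [ENNReal.coe_rpow_of_nonneg _ hp1.le]; simp
    have h1 := h (fun ω => (min (X ω) N) ^ (p - 1)) ((N : ℝ≥0) ^ (p - 1)) (hm.pow_const _)
      (fun ω => by
        rw [← hN]
        exact ENNReal.rpow_le_rpow (min_le_right _ _) hp1.le)
    have h2 : ∫⁻ ω, ((min (X ω) (N : ℝ≥0∞)) ^ (p - 1)) ^ q ∂P = I := by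
      refine lintegral_congr fun ω => ?_
      rw [← ENNReal.rpow_mul, hpq.sub_one_mul_conj]
    have h3 : I ≤ ∫⁻ ω, X ω * (min (X ω) (N : ℝ≥0∞)) ^ (p - 1) ∂P := by
      refine lintegral_mono fun ω => ?_
      have := ENNReal.rpow_add_of_nonneg (x := min (X ω) (N : ℝ≥0∞)) 1 (p - 1) zero_le_one hp1.le
      rw [ENNReal.rpow_one, add_sub_cancel] at this
      simp only [this]
      gcongr
      exact min_le_left _ _
    have hIfin : I ≠ ∞ := by
      refine ne_top_of_le_ne_top (b := ∫⁻ _, (N : ℝ≥0∞) ^ p ∂P) ?_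
        (lintegral_mono fun ω => ENNReal.rpow_le_rpow (min_le_right _ _) hp0.le)
      rw [lintegral_const]
      exact ENNReal.mul_ne_top (ENNReal.rpow_ne_top_of_nonneg hp0.le (by simp))
        (measure_ne_top _ _)
    rw [h2] at h1
    have h4 : I ≤ c * I ^ (1 / q) := h3.trans h1
    rcases eq_or_ne I 0 with h0 | h0
    · rw [h0]; exact zero_le
    have h5 : I ^ (1 / p) ≤ c := by
      have hq' : 0 < I ^ (1 / q) := ENNReal.rpow_pos (pos_iff_ne_zero.2 h0) hIfin
      have hqt : I ^ (1 / q) ≠ ∞ := ENNReal.rpow_ne_top_of_nonneg (by positivity) hIfin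
      have h6 : I = I ^ (1 / p) * I ^ (1 / q) := by
        rw [← ENNReal.rpow_add _ _ h0 hIfin]
        have : 1 / p + 1 / q = 1 := by simpa using hpq.inv_add_inv_eq_one
        rw [this, ENNReal.rpow_one]
      exact (ENNReal.mul_le_mul_iff_left hq'.ne' hqt).1 (h6.symm.trans_le h4)
    calc I = (I ^ (1 / p)) ^ p := by
          rw [← ENNReal.rpow_mul, one_div_mul_cancel hp0.ne', ENNReal.rpow_one]
      _ ≤ c ^ p := ENNReal.rpow_le_rpow h5 hp0.le
  have hsup : ∀ ω, X ω ^ p = ⨆ N : ℕ, (min (X ω) (N : ℝ≥0∞)) ^ p := by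
    intro ω
    have h1 : Tendsto (fun N : ℕ => min (X ω) (N : ℝ≥0∞)) atTop (𝓝 (min (X ω) ∞)) :=
      tendsto_const_nhds.min ENNReal.tendsto_nat_nhds_top
    rw [min_eq_left le_top] at h1
    have h2 : Tendsto (fun N : ℕ => (min (X ω) (N : ℝ≥0∞)) ^ p) atTop (𝓝 (X ω ^ p)) :=
      h1.ennrpow_const p
    refine tendsto_nhds_unique h2 (tendsto_atTop_iSup fun a b hab => ?_)
    exact ENNReal.rpow_le_rpow (min_le_min_left _ (by exact_mod_cast hab)) hp0.le
  simp_rw [hsup]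
  rw [lintegral_iSup (fun N => (hX.min measurable_const).pow_const p)]
  · exact iSup_le hmin
  · intro a b hab ω
    exact ENNReal.rpow_le_rpow (min_le_min_left _ (by exact_mod_cast hab)) hp0.le

theorem lintegral_Ioo_exp_le {L t T : ℝ} (hL : 0 < L) (ht : 0 ≤ t) :
    ∫⁻ s in Set.Ioo 0 T, (Set.Iio t).indicator (fun s => ENNReal.ofReal (Real.exp (L * s))) s ≤
      ENNReal.ofReal (Real.exp (L * t) / L) := by
  have hcont : Continuous (fun s => Real.exp (L * s)) := by fun_prop
  calc _ ≤ ∫⁻ s in Set.Ioc 0 t, ENNReal.ofReal (Real.exp (L * s)) := by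
        rw [← lintegral_indicator measurableSet_Ioo, ← lintegral_indicator measurableSet_Ioc]
        refine lintegral_mono fun s => ?_
        by_cases h1 : s ∈ Set.Ioo 0 T
        · by_cases h2 : s ∈ Set.Iio t
          · have h3 : s ∈ Set.Ioc 0 t := ⟨h1.1, le_of_lt h2⟩
            simp [h1, h2, h3]
          · rw [Set.indicator_of_mem h1, Set.indicator_of_notMem h2]; exact zero_le
        · rw [Set.indicator_of_notMem h1]; exact zero_le
    _ = ENNReal.ofReal (∫ s in (0 : ℝ)..t, Real.exp (L * s)) := by
        rw [intervalIntegral.integral_of_le ht, ofReal_integral_eq_lintegral_ofReal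
          (hcont.intervalIntegrable 0 t).1 (Eventually.of_forall fun s => (Real.exp_pos _).le)]
    _ ≤ _ := by
        refine ENNReal.ofReal_le_ofReal ?_
        rw [intervalIntegral.integral_comp_mul_left (fun s => Real.exp s) hL.ne', integral_exp,
          smul_eq_mul, mul_zero, Real.exp_zero, inv_mul_eq_div]
        gcongr
        linarith

section Apriori

variable {d : ℕ} {Ω : Type*} [MeasurableSpace Ω] {P : Measure Ω} [IsProbabilityMeasure P] {T : ℝ}

/-- Gronwall's argument for a field `N(t, x)` subject to a linear Volterra inequality with the heat
kernel. -/
theorem le_of_forall_le_add_lintegral_convolutionIntegrand {N : ℝ × SpaceE d → ℝ≥0∞}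
    (hN : Measurable N) {K : ℝ} (hK : 0 < K) {A B : ℝ≥0∞} (hB : B ≠ ∞)
    (hNB : ∀ t ∈ Set.Icc 0 T, ∀ x, N (t, x) ≤ B)
    (hle : ∀ t ∈ Set.Icc 0 T, ∀ x, N (t, x) ≤ A + ENNReal.ofReal K *
      ∫⁻ z, N z * ‖convolutionIntegrand t x z.1 z.2‖ₑ ∂stripMeasure d T) :
    ∀ t ∈ Set.Icc 0 T, ∀ x, N (t, x) ≤ ENNReal.ofReal (2 * Real.exp (2 * K * T)) * A := by
  -- In the sup norm weighted by `exp(-2Kt)` the Volterra operator has norm at most `1/2`, since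
  -- every time slice of the kernel has mass `1`. The rate `2K` is chosen for this.
  set S : ℝ≥0∞ := ⨆ z : Set.Icc 0 T × SpaceE d,
    ENNReal.ofReal (Real.exp (-(2 * K * z.1))) * N (z.1, z.2) with hS
  have hSle : ∀ t ∈ Set.Icc 0 T, ∀ x, ENNReal.ofReal (Real.exp (-(2 * K * t))) * N (t, x) ≤ S :=
    fun t ht x => le_iSup (fun z : Set.Icc 0 T × SpaceE d =>
      ENNReal.ofReal (Real.exp (-(2 * K * z.1))) * N (z.1, z.2)) (⟨t, ht⟩, x)
  have hexp : ∀ t, ENNReal.ofReal (Real.exp (2 * K * t)) *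
      ENNReal.ofReal (Real.exp (-(2 * K * t))) = 1 := by
    intro t
    rw [← ENNReal.ofReal_mul (Real.exp_pos _).le, ← Real.exp_add]
    simp
  have hNS : ∀ t ∈ Set.Icc 0 T, ∀ x, N (t, x) ≤ ENNReal.ofReal (Real.exp (2 * K * t)) * S := by
    intro t ht x
    calc N (t, x) = ENNReal.ofReal (Real.exp (2 * K * t)) *
          (ENNReal.ofReal (Real.exp (-(2 * K * t))) * N (t, x)) := by
          rw [← mul_assoc, hexp, one_mul]
      _ ≤ _ := by gcongr; exact hSle t ht x
  have hSfin : S ≠ ∞ := by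
    refine ne_top_of_le_ne_top hB (iSup_le fun z => ?_)
    refine (mul_le_mul_left (ENNReal.ofReal_le_one.2 (Real.exp_le_one_iff.2 ?_)) _).trans ?_
    · have := z.1.2.1
      have : 0 ≤ 2 * K * (z.1 : ℝ) := by positivity
      linarith
    · rw [one_mul]; exact hNB _ z.1.2 _
  have hint : ∀ t ∈ Set.Icc 0 T, ∀ x,
      ∫⁻ z, N z * ‖convolutionIntegrand t x z.1 z.2‖ₑ ∂stripMeasure d T ≤
        S * ENNReal.ofReal (Real.exp (2 * K * t) / (2 * K)) := by
    intro t ht x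
    have hm := (measurable_convolutionIntegrand t x).enorm
    have hm' : Measurable fun z => N z * ‖convolutionIntegrand t x z.1 z.2‖ₑ := hN.mul hm
    rw [lintegral_stripMeasure hm']
    calc _ ≤ ∫⁻ s in Set.Ioo 0 T, S *
          (Set.Iio t).indicator (fun s => ENNReal.ofReal (Real.exp (2 * K * s))) s := by
          refine setLIntegral_mono' measurableSet_Ioo fun s hs => ?_
          rcases lt_or_ge s t with h | h
          · have h' : s ∈ Set.Iio t := h
            rw [Set.indicator_of_mem h']
            calc ∫⁻ y, N (s, y) * ‖convolutionIntegrand t x s y‖ₑ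
                ≤ ∫⁻ y, (ENNReal.ofReal (Real.exp (2 * K * s)) * S) *
                    ‖convolutionIntegrand t x s y‖ₑ := by
                  refine lintegral_mono fun y => ?_
                  gcongr
                  exact hNS s ⟨hs.1.le, hs.2.le⟩ y
              _ = _ := by
                  rw [lintegral_const_mul' _ _ (ENNReal.mul_ne_top ENNReal.ofReal_ne_top hSfin),
                    lintegral_enorm_convolutionIntegrand_slice ⟨hs.1.le, h⟩, mul_one, mul_comm]
          · simp [convolutionIntegrand_of_le h]
      _ = S * ∫⁻ s in Set.Ioo 0 T,
          (Set.Iio t).indicator (fun s => ENNReal.ofReal (Real.exp (2 * K * s))) s :=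
          lintegral_const_mul' _ _ hSfin
      _ ≤ _ := by
          gcongr
          exact lintegral_Ioo_exp_le (by positivity) ht.1
  have hS2 : S ≤ A + S / 2 := by
    refine iSup_le fun z => ?_
    have ht := z.1.2
    calc _ ≤ ENNReal.ofReal (Real.exp (-(2 * K * z.1))) * (A + ENNReal.ofReal K *
          (S * ENNReal.ofReal (Real.exp (2 * K * z.1) / (2 * K)))) := by
          gcongr
          refine (hle _ ht _).trans ?_
          gcongr
          exact hint _ ht _
      _ ≤ A + S / 2 := by
          rw [mul_add]
          gcongr
          · refine mul_le_of_le_one_left zero_le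
              (ENNReal.ofReal_le_one.2 (Real.exp_le_one_iff.2 ?_))
            have := z.1.2.1
            have : 0 ≤ 2 * K * (z.1 : ℝ) := by positivity
            linarith
          · have e : ENNReal.ofReal (Real.exp (-(2 * K * z.1))) * (ENNReal.ofReal K *
                (S * ENNReal.ofReal (Real.exp (2 * K * z.1) / (2 * K)))) =
                S * (ENNReal.ofReal (Real.exp (-(2 * K * z.1))) * (ENNReal.ofReal K *
                  ENNReal.ofReal (Real.exp (2 * K * z.1) / (2 * K)))) := by ring
            have e2 : Real.exp (-(2 * K * z.1)) * (K * (Real.exp (2 * K * z.1) / (2 * K))) =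
                1 / 2 := by
              rw [Real.exp_neg]; field_simp
            rw [e, ← ENNReal.ofReal_mul hK.le, ← ENNReal.ofReal_mul (Real.exp_pos _).le, e2,
              one_div, ENNReal.ofReal_inv_of_pos (by norm_num)]
            simp [div_eq_mul_inv]
  have hS3 : S ≤ 2 * A := by
    -- Absorbing `S/2` on the left requires `S` finite, the only role of the bound `B`; its size
    -- does not enter the conclusion.
    have h1 : S / 2 + S / 2 ≤ A + S / 2 := by rwa [ENNReal.add_halves]
    have h2 : S / 2 ≤ A :=
      (ENNReal.add_le_add_iff_right (ENNReal.div_ne_top hSfin (by norm_num))).1 h1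
    calc S = 2 * (S / 2) := (ENNReal.mul_div_cancel (by norm_num) (by norm_num)).symm
      _ ≤ 2 * A := by gcongr
  intro t ht x
  calc N (t, x) ≤ ENNReal.ofReal (Real.exp (2 * K * t)) * S := hNS t ht x
    _ ≤ ENNReal.ofReal (Real.exp (2 * K * T)) * (2 * A) := by
        gcongr
        exact ht.2
    _ = _ := by
        rw [ENNReal.ofReal_mul (by norm_num)]
        simp only [ENNReal.ofReal_ofNat]
        ring

/-- The random inequality is linear, so pairing it with a fixed `Y ≥ 0` gives a deterministic
Volterra inequality for `E[U(z) Y]`, with forcing at most `A ‖Y‖_q`. Boundedness of `Y` makes the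
pairing finite from first moments alone, and the Gronwall constant does not depend on `Y`, so
duality returns the `L^p` norm. -/
theorem lintegral_rpow_le_of_volterra {U : ℝ × SpaceE d → Ω → ℝ≥0∞}
    (hU : Measurable (Function.uncurry U)) {K : ℝ} (hK : 0 < K) {A B : ℝ≥0∞} (hB : B ≠ ∞)
    (hUB : ∀ t ∈ Set.Icc 0 T, ∀ x, ∫⁻ ω, U (t, x) ω ∂P ≤ B) {p : ℝ} (hp : 1 < p)
    (hle : ∀ t ∈ Set.Icc 0 T, ∀ x, ∃ G : Ω → ℝ≥0∞, AEMeasurable G P ∧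
      (∫⁻ ω, G ω ^ p ∂P) ^ (1 / p) ≤ A ∧ ∀ᵐ ω ∂P, U (t, x) ω ≤ G ω + ENNReal.ofReal K *
        ∫⁻ z, U z ω * ‖convolutionIntegrand t x z.1 z.2‖ₑ ∂stripMeasure d T) :
    ∀ t ∈ Set.Icc 0 T, ∀ x,
      ∫⁻ ω, U (t, x) ω ^ p ∂P ≤ (ENNReal.ofReal (2 * Real.exp (2 * K * T)) * A) ^ p := by
  intro t ht x
  have hpq := Real.HolderConjugate.conjExponent hp
  set q := p.conjExponent
  have hUm : ∀ z, Measurable (U z) := fun z => hU.comp measurable_prodMk_left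
  refine lintegral_rpow_le_of_forall_bounded (hUm _) hpq fun Y M hY hYM => ?_
  set N : ℝ × SpaceE d → ℝ≥0∞ := fun z => ∫⁻ ω, U z ω * Y ω ∂P with hNdef
  have hUY : Measurable (fun r : (ℝ × SpaceE d) × Ω => U r.1 r.2 * Y r.2) :=
    hU.mul (hY.comp measurable_snd)
  have hN : Measurable N := hUY.lintegral_prod_right'
  rw [mul_assoc]
  refine le_of_forall_le_add_lintegral_convolutionIntegrand hN hK (B := B * M)
    (ENNReal.mul_ne_top hB (by simp)) (fun t ht x => ?_) (fun t ht x => ?_) t ht x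
  · calc N (t, x) ≤ ∫⁻ ω, U (t, x) ω * M ∂P := lintegral_mono fun ω => by gcongr; exact hYM ω
      _ = (∫⁻ ω, U (t, x) ω ∂P) * M := lintegral_mul_const _ (hUm _)
      _ ≤ _ := by gcongr; exact hUB t ht x
  · obtain ⟨G, hG, hGA, hG'⟩ := hle t ht x
    have hm := (measurable_convolutionIntegrand t x).enorm
    have hker : Measurable (fun r : Ω × (ℝ × SpaceE d) =>
        U r.2 r.1 * ‖convolutionIntegrand t x r.2.1 r.2.2‖ₑ) :=
      (hU.comp measurable_swap).mul (hm.comp measurable_snd)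
    calc N (t, x) ≤ ∫⁻ ω, (G ω * Y ω + ENNReal.ofReal K *
          ((∫⁻ z, U z ω * ‖convolutionIntegrand t x z.1 z.2‖ₑ ∂stripMeasure d T) * Y ω)) ∂P := by
          refine lintegral_mono_ae (hG'.mono fun ω hω => ?_)
          calc _ ≤ _ := mul_le_mul_left hω (Y ω)
            _ = _ := by ring
      _ = ∫⁻ ω, G ω * Y ω ∂P + ENNReal.ofReal K *
          ∫⁻ ω, (∫⁻ z, U z ω * ‖convolutionIntegrand t x z.1 z.2‖ₑ ∂stripMeasure d T) * Y ω ∂P := by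
          have hGY : AEMeasurable (fun ω => G ω * Y ω) P := hG.mul hY.aemeasurable
          rw [lintegral_add_left' hGY, lintegral_const_mul' _ _ ENNReal.ofReal_ne_top]
      _ ≤ A * (∫⁻ ω, Y ω ^ q ∂P) ^ (1 / q) + ENNReal.ofReal K *
          ∫⁻ z, N z * ‖convolutionIntegrand t x z.1 z.2‖ₑ ∂stripMeasure d T := by
          gcongr
          · refine (ENNReal.lintegral_mul_le_Lp_mul_Lq P hpq hG hY.aemeasurable).trans ?_
            gcongr
          · refine le_of_eq ?_
            have e1 : ∀ ω, (∫⁻ z, U z ω * ‖convolutionIntegrand t x z.1 z.2‖ₑ ∂stripMeasure d T) *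
                Y ω = ∫⁻ z, U z ω * ‖convolutionIntegrand t x z.1 z.2‖ₑ * Y ω
                  ∂stripMeasure d T := by
              intro ω
              exact (lintegral_mul_const _ (hker.comp measurable_prodMk_left)).symm
            simp_rw [e1]
            rw [lintegral_lintegral_swap]
            · refine lintegral_congr fun z => ?_
              have e2 : ∀ ω, U z ω * ‖convolutionIntegrand t x z.1 z.2‖ₑ * Y ω =
                  (U z ω * Y ω) * ‖convolutionIntegrand t x z.1 z.2‖ₑ := fun ω => by ring
              simp_rw [e2]
              exact lintegral_mul_const _ ((hUm z).mul hY)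
            · exact (hker.mul (hY.comp measurable_fst)).aemeasurable

end Apriori

/-! ### The drift term -/

section Drift

variable {d : ℕ} {T : ℝ}

/-- Drift integrals with different final times live on different domains; written over the common
strip they can be subtracted kernel by kernel. -/
theorem integral_drift_eq_stripMeasure {f : ℝ → SpaceE d → ℝ} {t : ℝ} (htT : t ≤ T)
    (x : SpaceE d)
    (hi : Integrable (fun z : ℝ × SpaceE d => f z.1 z.2 * gaussKernel (t - z.1) (x - z.2))
      ((volume.restrict (Set.Ioo 0 t)).prod volume)) :
    Integrable (fun z : ℝ × SpaceE d => f z.1 z.2 * convolutionIntegrand t x z.1 z.2)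
        (stripMeasure d T) ∧
      ∫ s in Set.Ioo 0 t, ∫ y, f s y * gaussKernel (t - s) (x - y) =
        ∫ z, f z.1 z.2 * convolutionIntegrand t x z.1 z.2 ∂stripMeasure d T := by
  have hprod : ∀ r : ℝ, (volume.restrict (Set.Ioo 0 r)).prod (volume : Measure (SpaceE d)) =
      ((volume : Measure ℝ).prod (volume : Measure (SpaceE d))).restrict
        (Set.Ioo 0 r ×ˢ Set.univ) := by
    intro r
    rw [← Measure.prod_restrict, Measure.restrict_univ]
  have hms : ∀ r : ℝ, MeasurableSet (Set.Ioo 0 r ×ˢ (Set.univ : Set (SpaceE d))) :=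
    fun r => measurableSet_Ioo.prod MeasurableSet.univ
  have hind : ∀ z : ℝ × SpaceE d, (Set.Ioo 0 T ×ˢ (Set.univ : Set (SpaceE d))).indicator
      (fun z => f z.1 z.2 * convolutionIntegrand t x z.1 z.2) z =
      (Set.Ioo 0 t ×ˢ (Set.univ : Set (SpaceE d))).indicator
        (fun z => f z.1 z.2 * gaussKernel (t - z.1) (x - z.2)) z := by
    rintro ⟨s, y⟩
    by_cases h1 : s ∈ Set.Ioo 0 t
    · have h2 : s ∈ Set.Ioo 0 T := ⟨h1.1, h1.2.trans_le htT⟩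
      rw [Set.indicator_of_mem (by simpa using h2), Set.indicator_of_mem (by simpa using h1),
        convolutionIntegrand_of_mem ⟨h1.1.le, h1.2⟩]
    · rw [Set.indicator_of_notMem (a := (s, y)) (s := Set.Ioo 0 t ×ˢ Set.univ) (by simpa using h1)]
      by_cases h2 : s ∈ Set.Ioo 0 T
      · rw [Set.indicator_of_mem (by simpa using h2)]
        have : t ≤ s := by
          by_contra h
          exact h1 ⟨h2.1, not_le.1 h⟩
        simp [convolutionIntegrand_of_le this]
      · rw [Set.indicator_of_notMem (by simpa using h2)]
  have hfun := funext hind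
  constructor
  · rw [stripMeasure, hprod, ← IntegrableOn, ← integrable_indicator_iff (hms T), hfun,
      integrable_indicator_iff (hms t), IntegrableOn, ← hprod]
    exact hi
  · rw [← integral_prod _ hi, stripMeasure, hprod, hprod, ← integral_indicator (hms T), hfun,
      integral_indicator (hms t)]

theorem ae_stripMeasure_mem_Icc : ∀ᵐ z ∂stripMeasure d T, z.1 ∈ Set.Icc 0 T := by
  have h : ∀ᵐ s ∂(volume.restrict (Set.Ioo 0 T)), s ∈ Set.Icc 0 T :=
    (ae_restrict_mem measurableSet_Ioo).mono fun s hs => ⟨hs.1.le, hs.2.le⟩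
  exact (Measure.quasiMeasurePreserving_fst (μ := volume.restrict (Set.Ioo 0 T))
    (ν := (volume : Measure (SpaceE d)))).ae h

/-- The solution as a function on all of space-time, with time clamped to `[0, T]`. -/
noncomputable def clampTime {d : ℕ} {Ω : Type*} {T : ℝ} (hT : 0 ≤ T) (u : ℝ → SpaceE d → Ω → ℝ)
    (z : ℝ × SpaceE d) (ω : Ω) : ℝ := u (Set.projIcc 0 T hT z.1) z.2 ω

theorem clampTime_of_mem {Ω : Type*} (hT : 0 ≤ T) {u : ℝ → SpaceE d → Ω → ℝ} {s : ℝ}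
    (hs : s ∈ Set.Icc 0 T) (y : SpaceE d) (ω : Ω) : clampTime hT u (s, y) ω = u s y ω := by
  simp [clampTime, Set.projIcc_of_mem hT hs]

variable {Ω : Type*} [MeasurableSpace Ω] {P : Measure Ω}
  {μ : Measure (SpaceE d)} {W : TestFn d → Ω → ℝ} {b : ℝ → ℝ} {u₀ : SpaceE d → ℝ}
  {u : ℝ → SpaceE d → Ω → ℝ}

theorem IsMildHeatSolution.measurable_clampTime (hu : IsMildHeatSolution P μ W b u₀ T u)
    (hT : 0 ≤ T) : Measurable (Function.uncurry (clampTime hT u)) := by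
  have h : Measurable (fun r : (ℝ × SpaceE d) × Ω =>
      ((Set.projIcc 0 T hT r.1.1, r.1.2, r.2) : Set.Icc (0 : ℝ) T × SpaceE d × Ω)) := by
    have : Measurable (Set.projIcc 0 T hT) := continuous_projIcc.measurable
    fun_prop
  exact hu.jointly_measurable.comp h

theorem IsMildHeatSolution.measurable_apply (hu : IsMildHeatSolution P μ W b u₀ T u)
    {t : ℝ} (ht : t ∈ Set.Icc 0 T) (x : SpaceE d) : Measurable (u t x) := by
  have hT : 0 ≤ T := ht.1.trans ht.2
  have := (hu.measurable_clampTime hT).comp (measurable_prodMk_left (x := (t, x)))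
  convert this using 1
  ext ω
  simp [clampTime_of_mem hT ht]

theorem IsMildHeatSolution.exists_decomposition (hu : IsMildHeatSolution P μ W b u₀ T u)
    (hT : 0 ≤ T) {t : ℝ} (ht : t ∈ Set.Icc 0 T) (x : SpaceE d) :
    ∃ v : Ω → ℝ, IsWienerIntegral P μ W (convolutionIntegrand t x) v ∧
      ∀ᵐ ω ∂P, Integrable (fun z : ℝ × SpaceE d =>
        b (clampTime hT u z ω) * convolutionIntegrand t x z.1 z.2) (stripMeasure d T) ∧
        u t x ω = heatFlow u₀ t x + v ω +
          ∫ z, b (clampTime hT u z ω) * convolutionIntegrand t x z.1 z.2 ∂stripMeasure d T := by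
  obtain ⟨v, hv, hve⟩ := hu.mild t ht x
  refine ⟨v, hv, ?_⟩
  filter_upwards [hve, hu.integrable t ht x] with ω hω hi
  obtain ⟨h1, h2⟩ := integral_drift_eq_stripMeasure (T := T) ht.2 x
    (f := fun s y => b (u s y ω)) hi
  have hae : ∀ᵐ z ∂stripMeasure d T, clampTime hT u z ω = u z.1 z.2 ω :=
    ae_stripMeasure_mem_Icc.mono fun z hz => clampTime_of_mem hT hz z.2 ω
  refine ⟨h1.congr (hae.mono fun z hz => by simp only [hz]), ?_⟩
  rw [hω, h2]
  congr 1
  exact integral_congr_ae (hae.mono fun z hz => by simp only [hz])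

end Drift

/-! ### Moments of the solution and of its increments -/

/-- Linear growth, with `K + 1` in place of `K` so that the Gronwall rate is strictly positive. -/
theorem LipschitzWith.enorm_apply_le {b : ℝ → ℝ} {K : ℝ≥0} (hb : LipschitzWith K b) (r : ℝ) :
    ‖b r‖ₑ ≤ ‖b 0‖ₑ + ENNReal.ofReal (K + 1) * ‖r‖ₑ := by
  have h1 : |b r| ≤ |b 0| + (K + 1) * |r| := by
    have := hb.dist_le_mul r 0
    rw [Real.dist_eq, Real.dist_eq, sub_zero] at this
    have h2 : |b r| ≤ |b 0| + |b r - b 0| := by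
      have := abs_add_le (b 0) (b r - b 0)
      simpa using this
    nlinarith [abs_nonneg r]
  simp_rw [← ofReal_norm, Real.norm_eq_abs]
  rw [← ENNReal.ofReal_mul (by positivity), ← ENNReal.ofReal_add (by positivity) (by positivity)]
  exact ENNReal.ofReal_le_ofReal h1

theorem eLpNorm_ofReal_eq {Ω : Type*} [MeasurableSpace Ω] {P : Measure Ω} (X : Ω → ℝ) {p : ℝ}
    (hp : 0 < p) : eLpNorm X (ENNReal.ofReal p) P = (∫⁻ ω, ‖X ω‖ₑ ^ p ∂P) ^ (1 / p) := by
  rw [eLpNorm_eq_lintegral_rpow_enorm_toReal (by simpa using hp) ENNReal.ofReal_ne_top,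
    ENNReal.toReal_ofReal hp.le]

theorem lintegral_rpow_enorm_eq {Ω : Type*} [MeasurableSpace Ω] {P : Measure Ω} (X : Ω → ℝ) {p : ℝ}
    (hp : 0 < p) : ∫⁻ ω, ‖X ω‖ₑ ^ p ∂P = eLpNorm X (ENNReal.ofReal p) P ^ p := by
  rw [eLpNorm_ofReal_eq X hp, ← ENNReal.rpow_mul, one_div_mul_cancel hp.ne', ENNReal.rpow_one]

section Moments

variable {d : ℕ} {T : ℝ} {Ω : Type*} [MeasurableSpace Ω] {P : Measure Ω} [IsProbabilityMeasure P]
  {μ : Measure (SpaceE d)} {W : TestFn d → Ω → ℝ} {b : ℝ → ℝ} {u₀ : SpaceE d → ℝ}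
  {u : ℝ → SpaceE d → Ω → ℝ} {K : ℝ≥0} {M β : ℝ}

/-- The mild equation and linear growth of `b` give a Volterra inequality for `|u|`. Its forcing is
a constant plus the modulus of the stochastic convolution, which has moments of every order
uniformly in `(t,x)`. -/
theorem IsMildHeatSolution.exists_moment_bound (hW : IsHomogeneousNoise P μ W)
    (hu : IsMildHeatSolution P μ W b u₀ T u) (hT : 0 ≤ T) (hb : LipschitzWith K b)
    (hM : ∀ x, |u₀ x| ≤ M) (hβ0 : 0 < β)
    (hμ : ∫⁻ ξ, ENNReal.ofReal (1 / (1 + ‖ξ‖ ^ 2) ^ (1 - β)) ∂μ < ∞)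
    {B : ℝ≥0} (hB : ∀ t ∈ Set.Icc (0 : ℝ) T, ∀ x, ∫⁻ ω, ‖u t x ω‖ₑ ^ 2 ∂P ≤ B)
    {p : ℝ} (hp : 1 < p) :
    ∃ A : ℝ≥0∞, A ≠ ∞ ∧ ∀ t ∈ Set.Icc (0 : ℝ) T, ∀ x, ∫⁻ ω, ‖u t x ω‖ₑ ^ p ∂P ≤ A ^ p := by
  have := hW.tempered.sigmaFinite
  have hp0 : 0 < p := by linarith
  set I := ∫⁻ ξ, ENNReal.ofReal (1 / (1 + ‖ξ‖ ^ 2) ^ (1 - β)) ∂μ with hI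
  set c := eLpNorm id (ENNReal.ofReal p) (gaussianReal 0 1) with hc
  have hcfin : c ≠ ∞ := (memLp_id_gaussianReal' _ ENNReal.ofReal_ne_top).2.ne
  set A₀ : ℝ≥0∞ := ENNReal.ofReal M + ‖b 0‖ₑ * ENNReal.ofReal (T + 1) with hA₀
  set A₁ : ℝ≥0∞ := c * (3 * (ENNReal.ofReal (T + 1) * I)) ^ (1 / 2 : ℝ) with hA₁
  have hA₀fin : A₀ ≠ ∞ := by
    simp only [hA₀]
    exact ENNReal.add_ne_top.2 ⟨ENNReal.ofReal_ne_top,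
      ENNReal.mul_ne_top enorm_ne_top ENNReal.ofReal_ne_top⟩
  have hA₁fin : A₁ ≠ ∞ := by
    refine ENNReal.mul_ne_top hcfin (ENNReal.rpow_ne_top_of_nonneg (by norm_num) ?_)
    exact ENNReal.mul_ne_top (by simp) (ENNReal.mul_ne_top ENNReal.ofReal_ne_top hμ.ne)
  have hK : (0 : ℝ) < K + 1 := by positivity
  have hum := hu.measurable_clampTime hT
  refine ⟨ENNReal.ofReal (2 * Real.exp (2 * (K + 1) * T)) * (A₀ + A₁),
    ENNReal.mul_ne_top ENNReal.ofReal_ne_top (ENNReal.add_ne_top.2 ⟨hA₀fin, hA₁fin⟩), ?_⟩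
  have main := lintegral_rpow_le_of_volterra (P := P) (T := T)
    (U := fun z ω => ‖clampTime hT u z ω‖ₑ) hum.enorm hK (A := A₀ + A₁) (B := 1 + B) (by simp)
    (fun t ht x => ?_) hp (fun t ht x => ?_)
  · intro t ht x
    have := main t ht x
    simpa only [clampTime_of_mem hT ht] using this
  · simp only [clampTime_of_mem hT ht]
    -- The hypothesis on second moments is used only through `r ≤ 1 + r²`, to provide finite first
    -- moments.
    calc ∫⁻ ω, ‖u t x ω‖ₑ ∂P ≤ ∫⁻ ω, (1 + ‖u t x ω‖ₑ ^ 2) ∂P := by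
          refine lintegral_mono fun ω => ?_
          rcases le_total ‖u t x ω‖ₑ 1 with h | h
          · exact h.trans le_self_add
          · refine le_trans ?_ le_add_self
            rw [sq]
            exact le_mul_of_one_le_left zero_le h
      _ = 1 + ∫⁻ ω, ‖u t x ω‖ₑ ^ 2 ∂P := by
          rw [lintegral_add_left measurable_const]; simp
      _ ≤ 1 + B := by gcongr; exact hB t ht x
  · obtain ⟨v, hv, hve⟩ := hu.exists_decomposition hT ht x
    have hvm : AEMeasurable (fun ω => ‖v ω‖ₑ) P := hv.1.1.aemeasurable.enorm
    refine ⟨fun ω => A₀ + ‖v ω‖ₑ, aemeasurable_const.add hvm, ?_, ?_⟩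
    · have h1 := ENNReal.lintegral_Lp_add_le (μ := P) (p := p) (f := fun _ => A₀)
        (g := fun ω => ‖v ω‖ₑ) aemeasurable_const hvm hp.le
      refine h1.trans ?_
      gcongr
      · rw [lintegral_const, measure_univ, mul_one, ← ENNReal.rpow_mul, mul_one_div_cancel hp0.ne',
          ENNReal.rpow_one]
      · have h2 := hv.eLpNorm_sub_le hW hW.isWienerIntegral_zero
          (measurable_spaceFourier_convolutionIntegrand t x)
          (by simp_rw [spaceFourier_zero]; exact measurable_const)
          (p := ENNReal.ofReal p) ENNReal.ofReal_ne_top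
        rw [sub_zero, eLpNorm_ofReal_eq v hp0] at h2
        refine h2.trans ?_
        simp only [hA₁]
        gcongr
        exact noiseDistSq_convolutionIntegrand_zero_le hβ0 ht.1 ht.2 x
    · filter_upwards [hve] with ω hω
      obtain ⟨hi, he⟩ := hω
      simp only [clampTime_of_mem hT ht]
      have hk := (measurable_convolutionIntegrand t x).enorm
      have hkint := lintegral_enorm_convolutionIntegrand_le ht.1 ht.2 x
      have hD : ‖∫ z, b (clampTime hT u z ω) * convolutionIntegrand t x z.1 z.2
          ∂stripMeasure d T‖ₑ ≤ ‖b 0‖ₑ * ENNReal.ofReal (T + 1) + ENNReal.ofReal (K + 1) *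
          ∫⁻ z, ‖clampTime hT u z ω‖ₑ * ‖convolutionIntegrand t x z.1 z.2‖ₑ
            ∂stripMeasure d T := by
        calc _ ≤ ∫⁻ z, ‖b (clampTime hT u z ω) * convolutionIntegrand t x z.1 z.2‖ₑ
              ∂stripMeasure d T := enorm_integral_le_lintegral_enorm _
          _ ≤ ∫⁻ z, (‖b 0‖ₑ * ‖convolutionIntegrand t x z.1 z.2‖ₑ + ENNReal.ofReal (K + 1) *
              (‖clampTime hT u z ω‖ₑ * ‖convolutionIntegrand t x z.1 z.2‖ₑ))
              ∂stripMeasure d T := by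
              refine lintegral_mono fun z => ?_
              rw [enorm_mul, ← mul_assoc, ← add_mul]
              gcongr
              exact hb.enorm_apply_le _
          _ = ‖b 0‖ₑ * ∫⁻ z, ‖convolutionIntegrand t x z.1 z.2‖ₑ ∂stripMeasure d T +
              ENNReal.ofReal (K + 1) * ∫⁻ z, ‖clampTime hT u z ω‖ₑ *
                ‖convolutionIntegrand t x z.1 z.2‖ₑ ∂stripMeasure d T := by
              rw [lintegral_add_left (hk.const_mul _), lintegral_const_mul' _ _ enorm_ne_top,
                lintegral_const_mul' _ _ ENNReal.ofReal_ne_top]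
          _ ≤ _ := by gcongr
      have hH : ‖heatFlow u₀ t x‖ₑ ≤ ENNReal.ofReal M := by
        rw [← ofReal_norm]
        exact ENNReal.ofReal_le_ofReal (abs_heatFlow_le hM ht.1 x)
      rw [he]
      calc _ ≤ ‖heatFlow u₀ t x‖ₑ + ‖v ω‖ₑ + _ :=
            (enorm_add_le _ _).trans (add_le_add_left (enorm_add_le _ _) _)
        _ ≤ ENNReal.ofReal M + ‖v ω‖ₑ + (‖b 0‖ₑ * ENNReal.ofReal (T + 1) +
            ENNReal.ofReal (K + 1) * ∫⁻ z, ‖clampTime hT u z ω‖ₑ *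
              ‖convolutionIntegrand t x z.1 z.2‖ₑ ∂stripMeasure d T) := by gcongr
        _ = _ := by simp only [hA₀]; ring

theorem IsMildHeatSolution.exists_drift_moment_bound (hW : IsHomogeneousNoise P μ W)
    (hu : IsMildHeatSolution P μ W b u₀ T u) (hT : 0 ≤ T) (hb : LipschitzWith K b)
    (hM : ∀ x, |u₀ x| ≤ M) (hβ0 : 0 < β)
    (hμ : ∫⁻ ξ, ENNReal.ofReal (1 / (1 + ‖ξ‖ ^ 2) ^ (1 - β)) ∂μ < ∞)
    {B : ℝ≥0} (hB : ∀ t ∈ Set.Icc (0 : ℝ) T, ∀ x, ∫⁻ ω, ‖u t x ω‖ₑ ^ 2 ∂P ≤ B)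
    {p : ℝ} (hp : 1 < p) :
    ∃ A : ℝ≥0∞, A ≠ ∞ ∧ ∀ t ∈ Set.Icc (0 : ℝ) T, ∀ x, ∫⁻ ω, ‖b (u t x ω)‖ₑ ^ p ∂P ≤ A ^ p := by
  have hp0 : 0 < p := by linarith
  obtain ⟨A, hA, hAle⟩ := hu.exists_moment_bound hW hT hb hM hβ0 hμ hB hp
  refine ⟨‖b 0‖ₑ + ENNReal.ofReal (K + 1) * A, ENNReal.add_ne_top.2
    ⟨enorm_ne_top, ENNReal.mul_ne_top ENNReal.ofReal_ne_top hA⟩, fun t ht x => ?_⟩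
  have hum : AEMeasurable (fun ω => ENNReal.ofReal (K + 1) * ‖u t x ω‖ₑ) P :=
    ((hu.measurable_apply ht x).enorm.const_mul _).aemeasurable
  have h1 := ENNReal.lintegral_Lp_add_le (μ := P) (p := p) (f := fun _ => ‖b 0‖ₑ)
    aemeasurable_const hum hp.le
  have h2 : (∫⁻ ω, (ENNReal.ofReal (K + 1) * ‖u t x ω‖ₑ) ^ p ∂P) ^ (1 / p) ≤
      ENNReal.ofReal (K + 1) * A := by
    simp_rw [ENNReal.mul_rpow_of_nonneg _ _ hp0.le]
    rw [lintegral_const_mul' _ _ (ENNReal.rpow_ne_top_of_nonneg hp0.le ENNReal.ofReal_ne_top),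
      ENNReal.mul_rpow_of_nonneg _ _ (by positivity), ← ENNReal.rpow_mul,
      mul_one_div_cancel hp0.ne', ENNReal.rpow_one]
    gcongr
    calc _ ≤ (A ^ p) ^ (1 / p) := by gcongr; exact hAle t ht x
      _ = A := by rw [← ENNReal.rpow_mul, mul_one_div_cancel hp0.ne', ENNReal.rpow_one]
  have h3 : (∫⁻ _ω : Ω, ‖b 0‖ₑ ^ p ∂P) ^ (1 / p) = ‖b 0‖ₑ := by
    rw [lintegral_const, measure_univ, mul_one, ← ENNReal.rpow_mul, mul_one_div_cancel hp0.ne',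
      ENNReal.rpow_one]
  calc ∫⁻ ω, ‖b (u t x ω)‖ₑ ^ p ∂P
      ≤ ∫⁻ ω, (‖b 0‖ₑ + ENNReal.ofReal (K + 1) * ‖u t x ω‖ₑ) ^ p ∂P := by
        refine lintegral_mono fun ω => ?_
        gcongr
        exact hb.enorm_apply_le _
    _ = ((∫⁻ ω, (‖b 0‖ₑ + ENNReal.ofReal (K + 1) * ‖u t x ω‖ₑ) ^ p ∂P) ^ (1 / p)) ^ p := by
        rw [← ENNReal.rpow_mul, one_div_mul_cancel hp0.ne', ENNReal.rpow_one]
    _ ≤ _ := by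
        gcongr
        refine h1.trans ?_
        rw [h3]
        gcongr

/-- The three-term splitting of an increment. The drift part pairs the same `b(u)` with the
difference of two kernels, so it is governed by the `L¹` distance of the kernels. -/
theorem IsMildHeatSolution.eLpNorm_sub_le (hW : IsHomogeneousNoise P μ W)
    (hu : IsMildHeatSolution P μ W b u₀ T u) (hT : 0 ≤ T) (hb : Continuous b) {p : ℝ} (hp : 1 < p)
    {A : ℝ≥0∞} (hA : ∀ t ∈ Set.Icc (0 : ℝ) T, ∀ x, ∫⁻ ω, ‖b (u t x ω)‖ₑ ^ p ∂P ≤ A ^ p)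
    {t t' : ℝ} (ht : t ∈ Set.Icc (0 : ℝ) T) (ht' : t' ∈ Set.Icc (0 : ℝ) T) (x x' : SpaceE d) :
    eLpNorm (fun ω => u t x ω - u t' x' ω) (ENNReal.ofReal p) P ≤
      ‖heatFlow u₀ t x - heatFlow u₀ t' x'‖ₑ +
      eLpNorm id (ENNReal.ofReal p) (gaussianReal 0 1) *
        (3 * noiseDistSq μ (convolutionIntegrand t x) (convolutionIntegrand t' x')) ^ (1 / 2 : ℝ) +
      (∫⁻ z, ‖convolutionIntegrand t x z.1 z.2 - convolutionIntegrand t' x' z.1 z.2‖ₑ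
        ∂stripMeasure d T) * A := by
  have hp0 : 0 < p := by linarith
  obtain ⟨v, hv, hve⟩ := hu.exists_decomposition hT ht x
  obtain ⟨v', hv', hve'⟩ := hu.exists_decomposition hT ht' x'
  have hum := hu.measurable_clampTime hT
  -- Defining the drift as a remainder makes its measurability immediate; it equals the integral
  -- almost surely.
  set D : Ω → ℝ := fun ω => u t x ω - heatFlow u₀ t x - v ω with hDdef
  set D' : Ω → ℝ := fun ω => u t' x' ω - heatFlow u₀ t' x' - v' ω with hDdef'
  have hDm : AEStronglyMeasurable D P :=
    ((hu.measurable_apply ht x).sub_const _).aestronglyMeasurable.sub hv.1.1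
  have hDm' : AEStronglyMeasurable D' P :=
    ((hu.measurable_apply ht' x').sub_const _).aestronglyMeasurable.sub hv'.1.1
  have hp1 : 1 ≤ ENNReal.ofReal p := by simpa using hp.le
  have hsplit : (fun ω => u t x ω - u t' x' ω) =
      (fun _ => heatFlow u₀ t x - heatFlow u₀ t' x') + (v - v') + (D - D') := by
    ext ω
    simp only [hDdef, hDdef', Pi.add_apply, Pi.sub_apply]
    ring
  have hdrift : eLpNorm (D - D') (ENNReal.ofReal p) P ≤
      (∫⁻ z, ‖convolutionIntegrand t x z.1 z.2 - convolutionIntegrand t' x' z.1 z.2‖ₑ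
        ∂stripMeasure d T) * A := by
    have hκ : Measurable (fun z : ℝ × SpaceE d =>
        ‖convolutionIntegrand t x z.1 z.2 - convolutionIntegrand t' x' z.1 z.2‖ₑ) :=
      ((measurable_convolutionIntegrand t x).sub (measurable_convolutionIntegrand t' x')).enorm
    have hF : Measurable (Function.uncurry fun (z : ℝ × SpaceE d) (ω : Ω) =>
        ‖b (clampTime hT u z ω)‖ₑ) := (hb.measurable.comp hum).enorm
    have hmain := lintegral_rpow_lintegral_mul_le (ν := stripMeasure d T) (P := P) hF hκ hp
      (B := A) (ae_stripMeasure_mem_Icc.mono fun z hz => by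
        simpa only [clampTime_of_mem hT hz] using hA z.1 hz z.2) le_rfl
    rw [eLpNorm_ofReal_eq _ hp0]
    calc _ ≤ (((∫⁻ z, ‖convolutionIntegrand t x z.1 z.2 -
          convolutionIntegrand t' x' z.1 z.2‖ₑ ∂stripMeasure d T) * A) ^ p) ^ (1 / p) := by
          gcongr
          refine le_trans (lintegral_mono_ae ?_) hmain
          filter_upwards [hve, hve'] with ω h h'
          gcongr
          have e : (D - D') ω = ∫ z, b (clampTime hT u z ω) * (convolutionIntegrand t x z.1 z.2 -
              convolutionIntegrand t' x' z.1 z.2) ∂stripMeasure d T := by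
            simp_rw [mul_sub]
            rw [integral_sub h.1 h'.1]
            simp only [Pi.sub_apply, hDdef, hDdef', h.2, h'.2]
            ring
          rw [e]
          refine (enorm_integral_le_lintegral_enorm _).trans_eq ?_
          simp_rw [enorm_mul]
      _ = _ := by rw [← ENNReal.rpow_mul, mul_one_div_cancel hp0.ne', ENNReal.rpow_one]
  rw [hsplit]
  refine (eLpNorm_add_le (aestronglyMeasurable_const.add (hv.1.1.sub hv'.1.1)) (hDm.sub hDm')
    hp1).trans ?_
  gcongr
  refine (eLpNorm_add_le aestronglyMeasurable_const (hv.1.1.sub hv'.1.1) hp1).trans ?_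
  gcongr
  · rw [eLpNorm_const _ (by simpa using hp0) (IsProbabilityMeasure.ne_zero P)]
    simp
  · exact hv.eLpNorm_sub_le hW hv' (measurable_spaceFourier_convolutionIntegrand t x)
      (measurable_spaceFourier_convolutionIntegrand t' x') ENNReal.ofReal_ne_top

/-- Space and time increments differ only in the scale `ρ`, so the assembly is done once: the heat
flow and kernel terms are linear in `ρ`, the squared noise distance is quadratic. -/
theorem IsMildHeatSolution.exists_increment_bound (hW : IsHomogeneousNoise P μ W)
    (hu : IsMildHeatSolution P μ W b u₀ T u) (hT : 0 ≤ T) (hb : LipschitzWith K b)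
    (hM : ∀ x, |u₀ x| ≤ M) (hβ0 : 0 < β)
    (hμ : ∫⁻ ξ, ENNReal.ofReal (1 / (1 + ‖ξ‖ ^ 2) ^ (1 - β)) ∂μ < ∞)
    {B : ℝ≥0} (hB : ∀ t ∈ Set.Icc (0 : ℝ) T, ∀ x, ∫⁻ ω, ‖u t x ω‖ₑ ^ 2 ∂P ≤ B)
    {p : ℝ} (hp : 1 ≤ p) {a V m : ℝ} (hV : 0 ≤ V) :
    ∃ C : ℝ, 0 < C ∧ ∀ t ∈ Set.Icc (0 : ℝ) T, ∀ t' ∈ Set.Icc (0 : ℝ) T, ∀ x x' : SpaceE d,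
      ∀ ρ : ℝ, 0 ≤ ρ → |heatFlow u₀ t x - heatFlow u₀ t' x'| ≤ a * ρ →
      noiseDistSq μ (convolutionIntegrand t x) (convolutionIntegrand t' x') ≤
        ENNReal.ofReal (V * ρ ^ 2) *
          ∫⁻ ξ, ENNReal.ofReal (1 / (1 + ‖ξ‖ ^ 2) ^ (1 - β)) ∂μ →
      ∫⁻ z, ‖convolutionIntegrand t x z.1 z.2 - convolutionIntegrand t' x' z.1 z.2‖ₑ
        ∂stripMeasure d T ≤ ENNReal.ofReal (m * ρ) →
      ∫⁻ ω, ‖u t x ω - u t' x' ω‖ₑ ^ p ∂P ≤ ENNReal.ofReal (C * ρ ^ p) := by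
  have hp0 : 0 < p := by linarith
  -- The duality and Hölder arguments need an exponent strictly above `1`. The bound is proved for
  -- `p + 1` and lowered to `p` on the probability space, so that `p = 1` is included.
  have hp' : 1 < p + 1 := by linarith
  obtain ⟨A, hA, hAle⟩ := hu.exists_drift_moment_bound hW hT hb hM hβ0 hμ hB hp'
  set I := ∫⁻ ξ, ENNReal.ofReal (1 / (1 + ‖ξ‖ ^ 2) ^ (1 - β)) ∂μ with hI
  set c := eLpNorm id (ENNReal.ofReal (p + 1)) (gaussianReal 0 1) with hc
  have hcfin : c ≠ ∞ := (memLp_id_gaussianReal' _ ENNReal.ofReal_ne_top).2.ne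
  set J : ℝ≥0∞ := ENNReal.ofReal a + c * (3 * (ENNReal.ofReal V * I)) ^ (1 / 2 : ℝ) +
    ENNReal.ofReal m * A with hJ
  have hJfin : J ≠ ∞ := by
    refine ENNReal.add_ne_top.2 ⟨ENNReal.add_ne_top.2 ⟨ENNReal.ofReal_ne_top,
      ENNReal.mul_ne_top hcfin (ENNReal.rpow_ne_top_of_nonneg (by norm_num) ?_)⟩,
      ENNReal.mul_ne_top ENNReal.ofReal_ne_top hA⟩
    exact ENNReal.mul_ne_top (by simp) (ENNReal.mul_ne_top ENNReal.ofReal_ne_top hμ.ne)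
  refine ⟨(J.toReal + 1) ^ p, by positivity, fun t ht t' ht' x x' ρ hρ h1 h2 h3 => ?_⟩
  have key : eLpNorm (fun ω => u t x ω - u t' x' ω) (ENNReal.ofReal (p + 1)) P ≤
      ENNReal.ofReal ρ * J := by
    refine (hu.eLpNorm_sub_le hW hT hb.continuous hp' hAle ht ht' x x').trans ?_
    have e1 : ‖heatFlow u₀ t x - heatFlow u₀ t' x'‖ₑ ≤ ENNReal.ofReal ρ * ENNReal.ofReal a := by
      rw [← ENNReal.ofReal_mul hρ, ← ofReal_norm, Real.norm_eq_abs, mul_comm ρ]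
      exact ENNReal.ofReal_le_ofReal h1
    have e2 : (3 * noiseDistSq μ (convolutionIntegrand t x) (convolutionIntegrand t' x')) ^
        (1 / 2 : ℝ) ≤ ENNReal.ofReal ρ * (3 * (ENNReal.ofReal V * I)) ^ (1 / 2 : ℝ) := by
      have e3 : ENNReal.ofReal ρ = (ENNReal.ofReal (ρ ^ 2)) ^ (1 / 2 : ℝ) := by
        rw [ENNReal.ofReal_rpow_of_nonneg (by positivity) (by norm_num), ← Real.sqrt_eq_rpow,
          Real.sqrt_sq hρ]
      rw [e3, ← ENNReal.mul_rpow_of_nonneg _ _ (by norm_num)]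
      refine ENNReal.rpow_le_rpow ?_ (by norm_num)
      calc _ ≤ 3 * (ENNReal.ofReal (V * ρ ^ 2) * I) := by gcongr
        _ = _ := by rw [ENNReal.ofReal_mul hV]; ring
    have e4 : (∫⁻ z, ‖convolutionIntegrand t x z.1 z.2 - convolutionIntegrand t' x' z.1 z.2‖ₑ
        ∂stripMeasure d T) ≤ ENNReal.ofReal ρ * ENNReal.ofReal m := by
      rw [← ENNReal.ofReal_mul hρ, mul_comm ρ]
      exact h3
    calc _ ≤ ENNReal.ofReal ρ * ENNReal.ofReal a +
          c * (ENNReal.ofReal ρ * (3 * (ENNReal.ofReal V * I)) ^ (1 / 2 : ℝ)) +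
          ENNReal.ofReal ρ * ENNReal.ofReal m * A := by gcongr
      _ = _ := by simp only [hJ]; ring
  have hmeas : AEStronglyMeasurable (fun ω => u t x ω - u t' x' ω) P :=
    ((hu.measurable_apply ht x).sub (hu.measurable_apply ht' x')).aestronglyMeasurable
  have key2 : eLpNorm (fun ω => u t x ω - u t' x' ω) (ENNReal.ofReal p) P ≤
      ENNReal.ofReal ((J.toReal + 1) * ρ) := by
    calc _ ≤ eLpNorm (fun ω => u t x ω - u t' x' ω) (ENNReal.ofReal (p + 1)) P :=
          eLpNorm_le_eLpNorm_of_exponent_le (ENNReal.ofReal_le_ofReal (by linarith)) hmeas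
      _ ≤ ENNReal.ofReal ρ * J := key
      _ = ENNReal.ofReal (ρ * J.toReal) := by
          rw [ENNReal.ofReal_mul hρ, ENNReal.ofReal_toReal hJfin]
      _ ≤ _ := ENNReal.ofReal_le_ofReal (by nlinarith)
  have hJ0 : 0 ≤ J.toReal + 1 := by positivity
  rw [lintegral_rpow_enorm_eq _ hp0, ← Real.mul_rpow hJ0 hρ,
    ← ENNReal.ofReal_rpow_of_nonneg (by positivity) hp0.le]
  gcongr

end Moments

/-! ### A Kolmogorov continuity theorem -/

section Kolmogorov

variable {S : Type*}

/-- At every dyadic scale `2⁻ⁿ`, the increments of `f` between approximating points of `B` which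
are `κ 2⁻ⁿ`-close are bounded by a multiple of `2^{-nθ}`. -/
def DyadicHolder (ρ : S → S → ℝ) (π : ℕ → S → S) (B : Set S) (κ θ : ℝ) (f : S → ℝ) : Prop :=
  ∃ c : ℝ, ∀ n, ∀ a ∈ π n '' B ∪ π (n + 1) '' B, ∀ b ∈ π n '' B ∪ π (n + 1) '' B,
    ρ a b ≤ κ * (1 / 2) ^ n → |f a - f b| ≤ c * ((1 / 2 : ℝ) ^ θ) ^ n

theorem DyadicHolder.mono {ρ : S → S → ℝ} {π : ℕ → S → S} {B : Set S} {κ θ θ' : ℝ} {f : S → ℝ}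
    (h : DyadicHolder ρ π B κ θ' f) (hθ : θ ≤ θ') : DyadicHolder ρ π B κ θ f := by
  obtain ⟨c, hc⟩ := h
  refine ⟨|c|, fun n a ha b hb hab => (hc n a ha b hb hab).trans ?_⟩
  have h1 : (1 / 2 : ℝ) ^ θ' ≤ (1 / 2 : ℝ) ^ θ :=
    Real.rpow_le_rpow_of_exponent_ge (by norm_num) (by norm_num) hθ
  calc c * ((1 / 2 : ℝ) ^ θ') ^ n ≤ |c| * ((1 / 2 : ℝ) ^ θ') ^ n := by
        gcongr; exact le_abs_self c
    _ ≤ _ := by gcongr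

variable {ρ : S → S → ℝ} {π : ℕ → S → S} {κ : ℝ}

/-- The radius `2κ + 1` is what rounding requires: points at distance `2⁻ⁿ` round to points at
distance at most `(κ+1+κ) 2⁻ⁿ`, and two successive roundings of one point are closer still. -/
theorem DyadicHolder.exists_dist_le (hsymm : ∀ a b, ρ a b = ρ b a)
    (htri : ∀ a b c, ρ a c ≤ ρ a b + ρ b c) (hκ : 0 ≤ κ) (hπ : ∀ n a, ρ (π n a) a ≤ κ * (1 / 2) ^ n)
    {B : Set S} {θ : ℝ} {f : S → ℝ} (h : DyadicHolder ρ π B (2 * κ + 1) θ f) :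
    ∃ c : ℝ, 0 ≤ c ∧
      (∀ n, ∀ a ∈ B, dist (f (π n a)) (f (π (n + 1) a)) ≤ c * ((1 / 2 : ℝ) ^ θ) ^ n) ∧
      ∀ n, ∀ a ∈ B, ∀ b ∈ B, ρ a b ≤ (1 / 2) ^ n →
        dist (f (π n a)) (f (π n b)) ≤ c * ((1 / 2 : ℝ) ^ θ) ^ n := by
  obtain ⟨c, hc⟩ := h
  have hle : ∀ n, c * ((1 / 2 : ℝ) ^ θ) ^ n ≤ |c| * ((1 / 2 : ℝ) ^ θ) ^ n := fun n => by
    gcongr; exact le_abs_self c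
  refine ⟨|c|, abs_nonneg c, fun n a ha => ?_, fun n a ha b hb hab => ?_⟩
  · refine (hc n _ (Or.inl ⟨a, ha, rfl⟩) _ (Or.inr ⟨a, ha, rfl⟩) ?_).trans (hle n)
    have h1 := htri (π n a) a (π (n + 1) a)
    have h2 := hπ n a
    have h3 := hπ (n + 1) a
    rw [hsymm] at h3
    have h4 : (0 : ℝ) < (1 / 2) ^ n := by positivity
    rw [pow_succ] at h3
    nlinarith
  · refine (hc n _ (Or.inl ⟨a, ha, rfl⟩) _ (Or.inl ⟨b, hb, rfl⟩) ?_).trans (hle n)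
    have h1 := htri (π n a) a (π n b)
    have h2 := hπ n a
    have h3 := hπ n b
    have h4 := htri a b (π n b)
    rw [hsymm] at h3
    linarith

theorem DyadicHolder.exists_tendsto (hsymm : ∀ a b, ρ a b = ρ b a)
    (htri : ∀ a b c, ρ a c ≤ ρ a b + ρ b c) (hκ : 0 ≤ κ) (hπ : ∀ n a, ρ (π n a) a ≤ κ * (1 / 2) ^ n)
    {B : Set S} {θ : ℝ} (hθ : 0 < θ) {f : S → ℝ} (h : DyadicHolder ρ π B (2 * κ + 1) θ f) {a : S}
    (ha : a ∈ B) : ∃ l, Tendsto (fun n => f (π n a)) atTop (𝓝 l) := by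
  obtain ⟨c, _, h1, _⟩ := h.exists_dist_le hsymm htri hκ hπ
  have hq : (1 / 2 : ℝ) ^ θ < 1 := Real.rpow_lt_one (by norm_num) (by norm_num) hθ
  exact cauchySeq_tendsto_of_complete (cauchySeq_of_le_geometric _ c hq fun n => h1 n a ha)

/-- Chaining: `w` differs from its rounding at level `n` by a geometric tail of order `q^n`, where
`q = 2^(-θ)`. Choosing `n` with `2⁻ⁿ` comparable to `ρ a b` turns `q^n` into `ρ(a,b)^θ`. -/
theorem DyadicHolder.exists_holder_bound (hρ : ∀ a b, 0 ≤ ρ a b) (hsymm : ∀ a b, ρ a b = ρ b a)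
    (htri : ∀ a b c, ρ a c ≤ ρ a b + ρ b c) (hκ : 0 ≤ κ) (hπ : ∀ n a, ρ (π n a) a ≤ κ * (1 / 2) ^ n)
    {B : Set S} (hfin : (π 0 '' B).Finite) {θ : ℝ} (hθ : 0 < θ) {f w : S → ℝ}
    (h : DyadicHolder ρ π B (2 * κ + 1) θ f)
    (hw : ∀ a ∈ B, Tendsto (fun n => f (π n a)) atTop (𝓝 (w a))) :
    ∃ C : ℝ, ∀ a ∈ B, ∀ b ∈ B, |w a - w b| ≤ C * ρ a b ^ θ := by
  obtain ⟨c, hc, h1, h2⟩ := h.exists_dist_le hsymm htri hκ hπ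
  set q : ℝ := (1 / 2 : ℝ) ^ θ with hq
  have hq0 : 0 < q := by positivity
  have hq1 : q < 1 := Real.rpow_lt_one (by norm_num) (by norm_num) hθ
  have hq1' : 0 < 1 - q := by linarith
  have hlim : ∀ n, ∀ a ∈ B, |f (π n a) - w a| ≤ c * q ^ n / (1 - q) := fun n a ha =>
    dist_le_of_le_geometric_of_tendsto q c hq1 (fun n => h1 n a ha) (hw a ha) n
  obtain ⟨L, hL⟩ := (hfin.image fun a => |f a|).bddAbove
  have hLB : ∀ a ∈ B, |f (π 0 a)| ≤ L := fun a ha => hL ⟨π 0 a, ⟨a, ha, rfl⟩, rfl⟩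
  set D : ℝ := 2 * c / (1 - q) + c with hD
  have hD0 : 0 ≤ D := by positivity
  have hsmall : ∀ n, ∀ a ∈ B, ∀ b ∈ B, ρ a b ≤ (1 / 2) ^ n → |w a - w b| ≤ D * q ^ n := by
    intro n a ha b hb hab
    have e1 := hlim n a ha
    have e2 := hlim n b hb
    have e3 : |f (π n a) - f (π n b)| ≤ c * q ^ n := h2 n a ha b hb hab
    have e4 : w a - w b = -(f (π n a) - w a) + (f (π n b) - w b) + (f (π n a) - f (π n b)) := by
      ring
    rw [e4]
    refine (abs_add_three _ _ _).trans ?_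
    rw [abs_neg]
    calc _ ≤ c * q ^ n / (1 - q) + c * q ^ n / (1 - q) + c * q ^ n := by gcongr
      _ = _ := by rw [hD]; ring
  refine ⟨D * 2 ^ θ + 2 * c / (1 - q) + 2 * |L|, fun a ha b hb => ?_⟩
  have hr := hρ a b
  -- At distance zero no single scale can be chosen, so all scales are used; `ρ` is not assumed to
  -- separate points.
  rcases hr.eq_or_lt with h0 | h0
  · have hz : |w a - w b| ≤ 0 := by
      have ht : Tendsto (fun n => D * q ^ n) atTop (𝓝 (D * 0)) :=
        (tendsto_pow_atTop_nhds_zero_of_lt_one hq0.le hq1).const_mul D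
      rw [mul_zero] at ht
      exact ge_of_tendsto' ht fun n => hsmall n a ha b hb (by rw [← h0]; positivity)
    rw [← h0, Real.zero_rpow hθ.ne', mul_zero]
    exact hz
  rcases le_or_gt (ρ a b) 1 with h3 | h3
  · obtain ⟨n, hn1, hn2⟩ := exists_nat_pow_near_of_lt_one h0 h3 (by norm_num : (0 : ℝ) < 1 / 2)
      (by norm_num)
    have e1 := hsmall n a ha b hb hn2
    have e2 : q ^ n ≤ 2 ^ θ * ρ a b ^ θ := by
      rw [hq, ← Real.rpow_natCast, ← Real.rpow_mul (by norm_num), mul_comm θ, Real.rpow_mul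
        (by norm_num), Real.rpow_natCast, ← Real.mul_rpow (by norm_num) hr]
      gcongr
      rw [pow_succ] at hn1
      linarith
    have e3 : 0 ≤ ρ a b ^ θ := by positivity
    calc |w a - w b| ≤ D * (2 ^ θ * ρ a b ^ θ) := e1.trans (by gcongr)
      _ ≤ D * (2 ^ θ * ρ a b ^ θ) + (2 * c / (1 - q) + 2 * |L|) * ρ a b ^ θ :=
          le_add_of_nonneg_right (by positivity)
      _ = _ := by ring
  -- Beyond distance `1` the bound follows from boundedness of `w` on `B`, which uses the finiteness
  -- of the coarsest grid.
  · have e1 := hlim 0 a ha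
    have e2 := hlim 0 b hb
    have e3 := hLB a ha
    have e4 := hLB b hb
    have e5 : w a - w b = -(f (π 0 a) - w a) + (f (π 0 b) - w b) + (f (π 0 a) - f (π 0 b)) := by
      ring
    have e6 : |w a - w b| ≤ 2 * c / (1 - q) + 2 * |L| := by
      rw [e5]
      refine (abs_add_three _ _ _).trans ?_
      rw [abs_neg]
      have e7 : |f (π 0 a) - f (π 0 b)| ≤ |L| + |L| :=
        (abs_sub _ _).trans (add_le_add (e3.trans (le_abs_self L)) (e4.trans (le_abs_self L)))
      calc _ ≤ c * q ^ 0 / (1 - q) + c * q ^ 0 / (1 - q) + (|L| + |L|) := by gcongr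
        _ = _ := by ring
    have e8 : 1 ≤ ρ a b ^ θ := Real.one_le_rpow h3.le hθ.le
    have e9 : 0 ≤ D * 2 ^ θ + 2 * c / (1 - q) + 2 * |L| := by positivity
    calc |w a - w b| ≤ 2 * c / (1 - q) + 2 * |L| := e6
      _ ≤ D * 2 ^ θ + 2 * c / (1 - q) + 2 * |L| := by
          have : 0 ≤ D * 2 ^ θ := by positivity
          linarith
      _ ≤ _ := le_mul_of_one_le_right e9 e8

variable {Ω : Type*} [MeasurableSpace Ω] {P : Measure Ω} {X : S → Ω → ℝ}

theorem exists_rpow_mul_le_half {Λ γ : ℝ} (hγ : 0 < γ) :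
    ∃ p : ℝ, 1 ≤ p ∧ Λ * (1 / 2 : ℝ) ^ (p * γ) ≤ 1 / 2 := by
  have h1 : Tendsto (fun p : ℝ => (1 / 2 : ℝ) ^ (p * γ)) atTop (𝓝 0) :=
    (tendsto_rpow_atTop_of_base_lt_one (1 / 2 : ℝ) (by norm_num) (by norm_num)).comp
      (tendsto_id.atTop_mul_const hγ)
  have h2 := (h1.const_mul Λ).eventually (ge_mem_nhds (by norm_num : Λ * 0 < 1 / 2))
  obtain ⟨p, hp1, hp2⟩ := ((eventually_ge_atTop (1 : ℝ)).and h2).exists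
  exact ⟨p, hp1, hp2⟩

/-- Level `n` has at most a constant times `Λ^(2n)` pairs, and each normalised increment has `p`-th
moment of order `2^(-np(β-θ))`. For `p` large the products are summable. -/
theorem ae_dyadicHolder (hX : ∀ a, Measurable (X a)) (hρ : ∀ a b, 0 ≤ ρ a b) (hκ : 0 ≤ κ) {B : Set S}
    {A Λ : ℝ} (hΛ : 1 ≤ Λ)
    (hcard : ∀ n, (π n '' B).Finite ∧ ((π n '' B).ncard : ℝ) ≤ A * Λ ^ n) {β θ : ℝ}
    (hθβ : θ < β) (hβ : 0 < β)
    (hmom : ∀ p : ℝ, 1 ≤ p → ∃ C : ℝ, ∀ a b,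
      ∫⁻ ω, ‖X a ω - X b ω‖ₑ ^ p ∂P ≤ ENNReal.ofReal (C * ρ a b ^ (p * β))) :
    ∀ᵐ ω ∂P, DyadicHolder ρ π B κ θ (fun a => X a ω) := by
  classical
  obtain ⟨p, hp1, hp⟩ := exists_rpow_mul_le_half (Λ := Λ ^ 2) (γ := β - θ) (by linarith)
  have hp0 : 0 < p := by linarith
  obtain ⟨C, hC⟩ := hmom p hp1
  have hA : 0 ≤ A := by
    have := (hcard 0).2
    simp only [pow_zero, mul_one] at this
    exact le_trans (Nat.cast_nonneg _) this
  have hfin : ∀ n, (π n '' B ∪ π (n + 1) '' B).Finite := fun n => (hcard n).1.union (hcard (n + 1)).1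
  set Q : ℕ → Finset S := fun n => (hfin n).toFinset with hQ
  have hQcard : ∀ n, ((Q n).card : ℝ) ≤ 2 * A * Λ * Λ ^ n := by
    intro n
    have h1 : (Q n).card ≤ (π n '' B).ncard + (π (n + 1) '' B).ncard := by
      rw [hQ, ← Set.ncard_eq_toFinset_card _ (hfin n)]
      exact Set.ncard_union_le _ _
    have h2 : (A * Λ ^ n : ℝ) ≤ A * Λ ^ n * Λ := le_mul_of_one_le_right (by positivity) hΛ
    have h3 : (((π n '' B).ncard + (π (n + 1) '' B).ncard : ℕ) : ℝ) ≤ 2 * A * Λ * Λ ^ n := by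
      have := (hcard n).2
      have := (hcard (n + 1)).2
      push_cast
      rw [pow_succ] at this
      linarith
    exact le_trans (by exact_mod_cast h1) h3
  set F : ℕ → Finset (S × S) := fun n =>
    (Q n ×ˢ Q n).filter fun r => ρ r.1 r.2 ≤ κ * (1 / 2) ^ n with hF
  set q : ℝ := (1 / 2 : ℝ) ^ θ with hq
  have hq0 : 0 < q := by positivity
  -- Maxima over close pairs are replaced by sums of `p`-th powers. If the total over all levels is
  -- finite, its `p`-th root bounds every normalised increment at once.
  set Z : ℕ → Ω → ℝ≥0∞ := fun n ω => ∑ r ∈ F n,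
    ENNReal.ofReal ((q ^ n)⁻¹ ^ p) * ‖X r.1 ω - X r.2 ω‖ₑ ^ p with hZ
  have hterm : ∀ r : S × S, Measurable fun ω => ‖X r.1 ω - X r.2 ω‖ₑ ^ p :=
    fun r => ((hX r.1).sub (hX r.2)).enorm.pow_const p
  have hZm : ∀ n, Measurable (Z n) := fun n =>
    Finset.measurable_fun_sum _ fun r _ => (hterm r).const_mul _
  set c₀ : ℝ := (2 * A * Λ) ^ 2 * (|C| * κ ^ (p * β)) with hc₀
  have hc₀0 : 0 ≤ c₀ := by positivity
  have hZint : ∀ n, ∫⁻ ω, Z n ω ∂P ≤ ENNReal.ofReal (c₀ * (1 / 2) ^ n) := by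
    intro n
    rw [lintegral_finsetSum _ fun r _ => (hterm r).const_mul _]
    have hr : ∀ r ∈ F n, ∫⁻ ω, ENNReal.ofReal ((q ^ n)⁻¹ ^ p) * ‖X r.1 ω - X r.2 ω‖ₑ ^ p ∂P ≤
        ENNReal.ofReal ((q ^ n)⁻¹ ^ p * (|C| * (κ * (1 / 2) ^ n) ^ (p * β))) := by
      intro r hr
      rw [lintegral_const_mul _ (hterm r), ENNReal.ofReal_mul (by positivity)]
      refine mul_le_mul_right ((hC r.1 r.2).trans (ENNReal.ofReal_le_ofReal ?_)) _
      have hr' : ρ r.1 r.2 ≤ κ * (1 / 2) ^ n := (Finset.mem_filter.1 hr).2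
      have := hρ r.1 r.2
      calc C * ρ r.1 r.2 ^ (p * β) ≤ |C| * ρ r.1 r.2 ^ (p * β) := by
            gcongr; exact le_abs_self C
        _ ≤ _ := by gcongr
    refine (Finset.sum_le_sum hr).trans ?_
    rw [Finset.sum_const, nsmul_eq_mul, ← ENNReal.ofReal_natCast,
      ← ENNReal.ofReal_mul (Nat.cast_nonneg _)]
    refine ENNReal.ofReal_le_ofReal ?_
    have hFcard : ((F n).card : ℝ) ≤ (2 * A * Λ) ^ 2 * (Λ ^ 2) ^ n := by
      have h1 : (F n).card ≤ (Q n).card * (Q n).card :=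
        (Finset.card_filter_le _ _).trans_eq (Finset.card_product _ _)
      calc ((F n).card : ℝ) ≤ (Q n).card * (Q n).card := by exact_mod_cast h1
        _ ≤ (2 * A * Λ * Λ ^ n) * (2 * A * Λ * Λ ^ n) := by
            gcongr <;> exact hQcard n
        _ = _ := by ring
    have hscale : (q ^ n)⁻¹ ^ p * (κ * (1 / 2) ^ n) ^ (p * β) =
        κ ^ (p * β) * ((1 / 2 : ℝ) ^ (p * (β - θ))) ^ n := by
      have h0 : (0 : ℝ) ≤ 1 / 2 := by norm_num
      have e1 : (q ^ n)⁻¹ ^ p = (1 / 2 : ℝ) ^ (-(θ * n) * p) := by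
        rw [hq, ← Real.rpow_mul_natCast h0, ← Real.rpow_neg h0, ← Real.rpow_mul h0]
      have e2 : ((1 / 2 : ℝ) ^ n) ^ (p * β) = (1 / 2 : ℝ) ^ (n * (p * β)) := by
        rw [← Real.rpow_natCast_mul h0]
      rw [Real.mul_rpow hκ (by positivity), e1, e2, ← Real.rpow_mul_natCast h0, mul_left_comm,
        ← Real.rpow_add (by norm_num)]
      congr 2
      ring
    calc ((F n).card : ℝ) * ((q ^ n)⁻¹ ^ p * (|C| * (κ * (1 / 2) ^ n) ^ (p * β)))
        = (F n).card * (|C| * ((q ^ n)⁻¹ ^ p * (κ * (1 / 2) ^ n) ^ (p * β))) := by ring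
      _ ≤ ((2 * A * Λ) ^ 2 * (Λ ^ 2) ^ n) *
          (|C| * (κ ^ (p * β) * ((1 / 2 : ℝ) ^ (p * (β - θ))) ^ n)) := by
          rw [hscale]; gcongr
      _ = c₀ * (Λ ^ 2 * (1 / 2 : ℝ) ^ (p * (β - θ))) ^ n := by rw [hc₀, mul_pow]; ring
      _ ≤ _ := by gcongr
  have hsum : ∫⁻ ω, ∑' n, Z n ω ∂P ≠ ∞ := by
    rw [lintegral_tsum fun n => (hZm n).aemeasurable]
    refine ne_top_of_le_ne_top ?_ (ENNReal.tsum_le_tsum hZint)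
    have hs : Summable fun n : ℕ => c₀ * (1 / 2 : ℝ) ^ n :=
      (summable_geometric_of_lt_one (by norm_num) (by norm_num)).mul_left c₀
    rw [← ENNReal.ofReal_tsum_of_nonneg (fun n => by positivity) hs]
    exact ENNReal.ofReal_ne_top
  filter_upwards [ae_lt_top (Measurable.tsum hZm) hsum] with ω hω
  refine ⟨((∑' n, Z n ω) ^ (1 / p)).toReal, fun n a ha b hb hab => ?_⟩
  have hmem : (a, b) ∈ F n := by
    simp only [hF, hQ, Finset.mem_filter, Finset.mem_product, Set.Finite.mem_toFinset]
    exact ⟨⟨ha, hb⟩, hab⟩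
  have h1 : ENNReal.ofReal ((q ^ n)⁻¹ ^ p) * ‖X a ω - X b ω‖ₑ ^ p ≤ ∑' n, Z n ω :=
    (Finset.single_le_sum (f := fun r : S × S =>
      ENNReal.ofReal ((q ^ n)⁻¹ ^ p) * ‖X r.1 ω - X r.2 ω‖ₑ ^ p) (fun _ _ => zero_le)
      hmem).trans (ENNReal.le_tsum (f := fun n => Z n ω) n)
  have h2 : ENNReal.ofReal ((q ^ n)⁻¹ * |X a ω - X b ω|) ≤ (∑' n, Z n ω) ^ (1 / p) := by
    have e : (ENNReal.ofReal ((q ^ n)⁻¹ ^ p) * ‖X a ω - X b ω‖ₑ ^ p) ^ (1 / p) =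
        ENNReal.ofReal ((q ^ n)⁻¹ * |X a ω - X b ω|) := by
      rw [← ENNReal.ofReal_rpow_of_nonneg (by positivity) hp0.le,
        ← ENNReal.mul_rpow_of_nonneg _ _ hp0.le, ← ENNReal.rpow_mul, mul_one_div_cancel hp0.ne',
        ENNReal.rpow_one, ← ofReal_norm, Real.norm_eq_abs, ENNReal.ofReal_mul (by positivity)]
    rw [← e]
    exact ENNReal.rpow_le_rpow h1 (by positivity)
  have h3 : (q ^ n)⁻¹ * |X a ω - X b ω| ≤ ((∑' n, Z n ω) ^ (1 / p)).toReal :=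
    (ENNReal.ofReal_le_iff_le_toReal (ENNReal.rpow_ne_top_of_nonneg (by positivity) hω.ne)).1 h2
  rwa [inv_mul_le_iff₀ (by positivity), mul_comm] at h3

/-- A Kolmogorov continuity theorem for processes with moment bounds of all orders, indexed by a
set with polynomially growing finite approximations. -/
theorem exists_holder_modification (hX : ∀ a, Measurable (X a)) (hρ : ∀ a b, 0 ≤ ρ a b)
    (hsymm : ∀ a b, ρ a b = ρ b a) (htri : ∀ a b c, ρ a c ≤ ρ a b + ρ b c) (hκ : 0 ≤ κ)
    (hπ : ∀ n a, ρ (π n a) a ≤ κ * (1 / 2) ^ n) {B : ℕ → Set S} (hB : ∀ a, ∃ N, a ∈ B N)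
    (hcard : ∀ N, ∃ A Λ : ℝ, 1 ≤ Λ ∧
      ∀ n, (π n '' B N).Finite ∧ ((π n '' B N).ncard : ℝ) ≤ A * Λ ^ n) {β : ℝ} (hβ : 0 < β)
    (hmom : ∀ p : ℝ, 1 ≤ p → ∃ C : ℝ, ∀ a b,
      ∫⁻ ω, ‖X a ω - X b ω‖ₑ ^ p ∂P ≤ ENNReal.ofReal (C * ρ a b ^ (p * β))) :
    ∃ w : S → Ω → ℝ, (∀ a, Measurable (w a) ∧ w a =ᵐ[P] X a) ∧
      ∀ ω, ∀ θ ∈ Set.Ioo 0 β, ∀ N, ∃ C : ℝ, ∀ a ∈ B N, ∀ b ∈ B N,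
        |w a ω - w b ω| ≤ C * ρ a b ^ θ := by
  -- A countable sequence of exponents increasing to `β`, so that one null set serves every `θ < β`.
  set τ : ℕ → ℝ := fun k => β * (1 - 1 / (k + 2)) with hτ
  have hτβ : ∀ k, τ k < β := fun k => by
    have : (0 : ℝ) < 1 / (k + 2) := by positivity
    simp only [hτ]; nlinarith
  have hτlim : Tendsto τ atTop (𝓝 β) := by
    have h1 : Tendsto (fun k : ℕ => (1 : ℝ) / (k + 2)) atTop (𝓝 0) :=
      tendsto_const_nhds.div_atTop (tendsto_atTop_add_const_right _ _ tendsto_natCast_atTop_atTop)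
    have h2 := (h1.const_sub 1).const_mul β
    rw [sub_zero, mul_one] at h2
    exact h2
  have hgood : ∀ᵐ ω ∂P, ∀ N k, DyadicHolder ρ π (B N) (2 * κ + 1) (τ k) (fun a => X a ω) := by
    rw [ae_all_iff]; intro N
    rw [ae_all_iff]; intro k
    obtain ⟨A, Λ, hΛ, hc⟩ := hcard N
    exact ae_dyadicHolder hX hρ (by linarith) hΛ hc (hτβ k) hβ hmom
  obtain ⟨G, hGsub, hGm, hG⟩ := exists_measurable_superset_of_null (mem_ae_iff.1 hgood)
  have hin : ∀ ω, ω ∉ G → ∀ N, ∀ θ < β,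
      DyadicHolder ρ π (B N) (2 * κ + 1) θ (fun a => X a ω) := by
    intro ω hω N θ hθ
    have h1 : ∀ N k, DyadicHolder ρ π (B N) (2 * κ + 1) (τ k) (fun a => X a ω) := by
      by_contra h
      exact hω (hGsub h)
    obtain ⟨k, hk⟩ := (hτlim.eventually (lt_mem_nhds hθ)).exists
    exact (h1 N k).mono hk.le
  -- The version is the limit along grid roundings, with the process set to zero on the measurable
  -- null set `G`; hence the Hölder bound holds for every `ω`.
  have hconv : ∀ a ω, ∃ l, Tendsto (fun n => Gᶜ.indicator (X (π n a)) ω) atTop (𝓝 l) := by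
    intro a ω
    by_cases hω : ω ∈ G
    · refine ⟨0, ?_⟩
      have : ∀ n, Gᶜ.indicator (X (π n a)) ω = 0 := fun n =>
        Set.indicator_of_notMem (by simpa using hω) _
      simp [this]
    · obtain ⟨N, hN⟩ := hB a
      have : ∀ n, Gᶜ.indicator (X (π n a)) ω = X (π n a) ω := fun n =>
        Set.indicator_of_mem (by simpa using hω) _
      simp_rw [this]
      exact (hin ω hω N (β / 2) (by linarith)).exists_tendsto hsymm htri hκ hπ (by linarith) hN
  choose w hw using hconv
  refine ⟨w, fun a => ⟨?_, ?_⟩, fun ω θ hθ N => ?_⟩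
  · exact measurable_of_tendsto_metrizable (fun n => (hX (π n a)).indicator hGm.compl)
      (tendsto_pi_nhds.2 fun ω => hw a ω)
  · obtain ⟨C, hC⟩ := hmom 1 le_rfl
    -- First moments suffice to see that the roundings converge to `X a` in `L¹`, which identifies
    -- the limit with `X a` almost surely.
    have hL1 : Tendsto (fun n => eLpNorm (X (π n a) - X a) 1 P) atTop (𝓝 0) := by
      have h1 : Tendsto (fun n : ℕ => ENNReal.ofReal (|C| * (κ * (1 / 2 : ℝ) ^ n) ^ (1 * β))) atTop
          (𝓝 0) := by
        have h2 : Tendsto (fun n : ℕ => (1 / 2 : ℝ) ^ n) atTop (𝓝 0) :=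
          tendsto_pow_atTop_nhds_zero_of_lt_one (by norm_num) (by norm_num)
        have h3 := ((h2.const_mul κ).rpow_const (p := 1 * β) (Or.inr (by linarith))).const_mul |C|
        rw [mul_zero, Real.zero_rpow (by linarith), mul_zero] at h3
        simpa using ENNReal.tendsto_ofReal h3
      refine tendsto_of_tendsto_of_tendsto_of_le_of_le tendsto_const_nhds h1 (fun _ => zero_le)
        fun n => ?_
      have h4 := hC (π n a) a
      simp only [ENNReal.rpow_one] at h4
      rw [eLpNorm_one_eq_lintegral_enorm]
      refine h4.trans (ENNReal.ofReal_le_ofReal ?_)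
      have := hρ (π n a) a
      calc C * ρ (π n a) a ^ (1 * β) ≤ |C| * ρ (π n a) a ^ (1 * β) := by
            gcongr; exact le_abs_self C
        _ ≤ _ := by
            gcongr
            exact hπ n a
    obtain ⟨ns, hns, hae⟩ := (tendstoInMeasure_of_tendsto_eLpNorm one_ne_zero
      (fun n => (hX (π n a)).aestronglyMeasurable) (hX a).aestronglyMeasurable
      hL1).exists_seq_tendsto_ae
    have hGae : ∀ᵐ ω ∂P, ω ∉ G := measure_eq_zero_iff_ae_notMem.1 hG
    filter_upwards [hae, hGae] with ω h1 h2
    have h3 := (hw a ω).comp hns.tendsto_atTop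
    have h4 : ∀ n, Gᶜ.indicator (X (π n a)) ω = X (π n a) ω := fun n =>
      Set.indicator_of_mem (by simpa using h2) _
    simp only [Function.comp_def, h4] at h3
    exact tendsto_nhds_unique h3 h1
  · by_cases hω : ω ∈ G
    · refine ⟨0, fun a _ b _ => ?_⟩
      have h0 : ∀ a, w a ω = 0 := fun a => by
        refine tendsto_nhds_unique (hw a ω) ?_
        have : ∀ n, Gᶜ.indicator (X (π n a)) ω = 0 := fun n =>
          Set.indicator_of_notMem (by simpa using hω) _
        simp [this]
      simp [h0]
    · obtain ⟨A, Λ, _, hc⟩ := hcard N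
      refine (hin ω hω N θ hθ.2).exists_holder_bound hρ hsymm htri hκ hπ (hc 0).1 hθ.1
        fun a _ => ?_
      have h4 : ∀ n, Gᶜ.indicator (X (π n a)) ω = X (π n a) ω := fun n =>
        Set.indicator_of_mem (by simpa using hω) _
      have := hw a ω
      simpa only [h4] using this

end Kolmogorov

/-! ### Random fields on `ℝ × ℝ^d` with the parabolic distance -/

section Parabolic

variable {d : ℕ}

/-- The parabolic distance on `ℝ × ℝ^d`. -/
noncomputable def parabolicDist (a b : ℝ × SpaceE d) : ℝ := √|a.1 - b.1| + ‖a.2 - b.2‖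

/-- Rounding to the grid of mesh `4⁻ⁿ` in time and `2⁻ⁿ` in every space coordinate. -/
noncomputable def parabolicGrid (n : ℕ) (a : ℝ × SpaceE d) : ℝ × SpaceE d :=
  ((⌊4 ^ n * a.1⌋ : ℝ) / 4 ^ n, WithLp.toLp 2 fun i => (⌊2 ^ n * a.2 i⌋ : ℝ) / 2 ^ n)

theorem parabolicDist_nonneg (a b : ℝ × SpaceE d) : 0 ≤ parabolicDist a b := by
  unfold parabolicDist; positivity

theorem parabolicDist_comm (a b : ℝ × SpaceE d) : parabolicDist a b = parabolicDist b a := by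
  rw [parabolicDist, parabolicDist, abs_sub_comm, norm_sub_rev]

theorem parabolicDist_triangle (a b c : ℝ × SpaceE d) :
    parabolicDist a c ≤ parabolicDist a b + parabolicDist b c := by
  have h1 : √|a.1 - c.1| ≤ √|a.1 - b.1| + √|b.1 - c.1| := by
    refine Real.sqrt_le_iff.2 ⟨by positivity, ?_⟩
    have h2 := abs_sub_le a.1 b.1 c.1
    have h3 := Real.sq_sqrt (abs_nonneg (a.1 - b.1))
    have h4 := Real.sq_sqrt (abs_nonneg (b.1 - c.1))
    nlinarith [mul_nonneg (Real.sqrt_nonneg |a.1 - b.1|) (Real.sqrt_nonneg |b.1 - c.1|)]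
  have h2 := norm_sub_le_norm_sub_add_norm_sub a.2 b.2 c.2
  simp only [parabolicDist]
  linarith

theorem parabolicDist_rpow_le (a b : ℝ × SpaceE d) {θ : ℝ} (hθ0 : 0 ≤ θ) (hθ1 : θ ≤ 1) :
    parabolicDist a b ^ θ ≤ |a.1 - b.1| ^ (θ / 2) + ‖a.2 - b.2‖ ^ θ := by
  refine (Real.rpow_add_le_add_rpow (Real.sqrt_nonneg _) (norm_nonneg _) hθ0 hθ1).trans_eq ?_
  rw [Real.sqrt_eq_rpow, ← Real.rpow_mul (abs_nonneg _), one_div_mul_eq_div]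

theorem abs_floor_mul_div_sub_le {c : ℝ} (hc : 0 < c) (r : ℝ) : |(⌊c * r⌋ : ℝ) / c - r| ≤ 1 / c := by
  have h1 := Int.floor_le (c * r)
  have h2 := Int.lt_floor_add_one (c * r)
  have e : (⌊c * r⌋ : ℝ) / c - r = -((c * r - ⌊c * r⌋) / c) := by field_simp; ring
  rw [e, abs_neg, abs_div, abs_of_pos hc, abs_of_nonneg (by linarith)]
  gcongr
  linarith

theorem EuclideanSpace.norm_le_card_mul {x : SpaceE d} {δ : ℝ} (hδ : 0 ≤ δ) (h : ∀ i, |x i| ≤ δ) :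
    ‖x‖ ≤ d * δ := by
  rw [EuclideanSpace.norm_eq]
  refine Real.sqrt_le_iff.2 ⟨by positivity, ?_⟩
  have h1 : ∑ i, ‖x i‖ ^ 2 ≤ (∑ i, ‖x i‖) ^ 2 :=
    Finset.sum_sq_le_sq_sum_of_nonneg fun i _ => norm_nonneg _
  have h2 : ∑ i, ‖x i‖ ≤ d * δ := by
    refine (Finset.sum_le_sum fun i _ => h i).trans_eq ?_
    simp
  exact h1.trans (pow_le_pow_left₀ (by positivity) h2 2)

theorem parabolicDist_grid_le (n : ℕ) (a : ℝ × SpaceE d) :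
    parabolicDist (parabolicGrid n a) a ≤ (1 + d) * (1 / 2) ^ n := by
  have h1 : √|(parabolicGrid n a).1 - a.1| ≤ (1 / 2) ^ n := by
    refine Real.sqrt_le_iff.2 ⟨by positivity, (abs_floor_mul_div_sub_le (by positivity) _).trans_eq ?_⟩
    rw [← pow_mul, mul_comm, pow_mul, one_div, ← inv_pow]
    norm_num
  have h2 : ‖(parabolicGrid n a).2 - a.2‖ ≤ d * (1 / 2) ^ n := by
    refine EuclideanSpace.norm_le_card_mul (by positivity) fun i => ?_
    refine (abs_floor_mul_div_sub_le (c := 2 ^ n) (by positivity) (a.2 i)).trans_eq ?_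
    rw [one_div, one_div, inv_pow]
  simp only [parabolicDist]
  linarith

theorem parabolicGrid_image_finite (N n : ℕ) :
    (parabolicGrid n '' {a : ℝ × SpaceE d | |a.1| ≤ N ∧ ‖a.2‖ ≤ N}).Finite ∧
      ((parabolicGrid n '' {a : ℝ × SpaceE d | |a.1| ≤ N ∧ ‖a.2‖ ≤ N}).ncard : ℝ) ≤
        (2 * N + 3) ^ (d + 1) * ((4 : ℝ) ^ (d + 1)) ^ n := by
  classical
  -- One index range serves time and space because `2^n ≤ 4^n`; the `+ 1` allows for rounding down.
  -- It has `2·4^n·N + 3 ≤ (2N+3) 4^n` elements.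
  set M : ℤ := 4 ^ n * N + 1 with hM
  set g : ℤ × (Fin d → ℤ) → ℝ × SpaceE d := fun k =>
    ((k.1 : ℝ) / 4 ^ n, WithLp.toLp 2 fun i => (k.2 i : ℝ) / 2 ^ n) with hg
  set F : Finset (ℤ × (Fin d → ℤ)) :=
    Finset.Icc (-M) M ×ˢ Fintype.piFinset fun _ => Finset.Icc (-M) M with hF
  have hfloor : ∀ c r : ℝ, 0 ≤ c → c ≤ 4 ^ n → |r| ≤ N → ⌊c * r⌋ ∈ Finset.Icc (-M) M := by
    intro c r hc0 hc hr
    have h1 : |c * r| ≤ 4 ^ n * N := by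
      rw [abs_mul, abs_of_nonneg hc0]; gcongr
    have h2 := abs_le.1 h1
    have h3 := Int.floor_le (c * r)
    have h4 := Int.lt_floor_add_one (c * r)
    refine Finset.mem_Icc.2 ⟨?_, ?_⟩
    · have : ((-M : ℤ) : ℝ) ≤ (⌊c * r⌋ : ℝ) := by
        rw [hM]; push_cast; linarith
      exact_mod_cast this
    · have : (⌊c * r⌋ : ℝ) ≤ (M : ℤ) := by
        rw [hM]; push_cast; linarith
      exact_mod_cast this
  have hsub : parabolicGrid n '' {a : ℝ × SpaceE d | |a.1| ≤ N ∧ ‖a.2‖ ≤ N} ⊆ F.image g := by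
    rintro _ ⟨a, ⟨ha1, ha2⟩, rfl⟩
    refine Finset.mem_coe.2 (Finset.mem_image.2 ⟨(⌊4 ^ n * a.1⌋, fun i => ⌊2 ^ n * a.2 i⌋), ?_, rfl⟩)
    refine Finset.mem_product.2 ⟨hfloor _ _ (by positivity) le_rfl ha1,
      Fintype.mem_piFinset.2 fun i => hfloor _ _ (by positivity) ?_
        ((PiLp.norm_apply_le a.2 i).trans ha2)⟩
    gcongr
    norm_num
  have hfin := (F.image g).finite_toSet.subset hsub
  refine ⟨hfin, ?_⟩
  have h1 : (parabolicGrid n '' {a : ℝ × SpaceE d | |a.1| ≤ N ∧ ‖a.2‖ ≤ N}).ncard ≤ F.card := by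
    refine (Set.ncard_le_ncard hsub (Finset.finite_toSet _)).trans ?_
    rw [Set.ncard_coe_finset]
    exact Finset.card_image_le
  have hcard : ((Finset.Icc (-M) M).card : ℝ) ≤ (2 * N + 3) * 4 ^ n := by
    have h4 : (1 : ℝ) ≤ 4 ^ n := one_le_pow₀ (by norm_num)
    have h5 : ((Finset.Icc (-M) M).card : ℤ) = 2 * M + 1 := by
      rw [Int.card_Icc_of_le _ _ (by have : 0 ≤ M := by positivity
                                     linarith)]
      ring
    have h6 : ((Finset.Icc (-M) M).card : ℝ) = 2 * (4 ^ n * N + 1) + 1 := by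
      have : (((Finset.Icc (-M) M).card : ℤ) : ℝ) = ((2 * M + 1 : ℤ) : ℝ) := by rw [h5]
      rw [hM] at this ⊢
      push_cast at this ⊢
      exact this
    rw [h6]
    linarith
  have h2 : (F.card : ℝ) ≤ ((2 * N + 3) * 4 ^ n) ^ (d + 1) := by
    rw [hF, Finset.card_product, Fintype.card_piFinset_const, pow_succ']
    push_cast
    gcongr
  calc _ ≤ (F.card : ℝ) := by exact_mod_cast h1
    _ ≤ ((2 * N + 3) * 4 ^ n) ^ (d + 1) := h2
    _ = _ := by rw [mul_pow, ← pow_mul, ← pow_mul, mul_comm n]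

variable {Ω : Type*} [MeasurableSpace Ω] {P : Measure Ω}

/-- A general increment is a space increment at fixed time plus a time increment at a fixed point,
and each is bounded through the parabolic distance. Subadditivity of `r ↦ r^θ` returns separate
moduli in time and space. -/
theorem exists_jointly_holder_modification {X : ℝ → SpaceE d → Ω → ℝ}
    (hX : ∀ t x, Measurable (X t x)) {β : ℝ} (hβ0 : 0 < β) (hβ1 : β ≤ 1)
    (hmom : ∀ p : ℝ, 1 ≤ p → ∃ C : ℝ, 0 < C ∧
      (∀ (x z : SpaceE d) (t : ℝ),
        ∫⁻ ω, ‖X t x ω - X t z ω‖ₑ ^ p ∂P ≤ ENNReal.ofReal (C * ‖x - z‖ ^ (p * β))) ∧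
      ∀ (s t : ℝ) (x : SpaceE d),
        ∫⁻ ω, ‖X t x ω - X s x ω‖ₑ ^ p ∂P ≤ ENNReal.ofReal (C * |t - s| ^ (p * (β / 2)))) :
    ∃ w : ℝ → SpaceE d → Ω → ℝ, (∀ t x, Measurable (w t x) ∧ w t x =ᵐ[P] X t x) ∧
      ∀ ω, ∀ θ ∈ Set.Ioo (0 : ℝ) β, ∀ N : ℕ, ∃ C : ℝ, ∀ s t : ℝ, |s| ≤ N → |t| ≤ N →
        ∀ x z : SpaceE d, ‖x‖ ≤ N → ‖z‖ ≤ N →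
          |w t x ω - w s z ω| ≤ C * (|t - s| ^ (θ / 2) + ‖x - z‖ ^ θ) := by
  have hB : ∀ a : ℝ × SpaceE d, ∃ N : ℕ, |a.1| ≤ N ∧ ‖a.2‖ ≤ N := by
    intro a
    obtain ⟨N, hN⟩ := exists_nat_ge (max |a.1| ‖a.2‖)
    exact ⟨N, (le_max_left _ _).trans hN, (le_max_right _ _).trans hN⟩
  have hmom' : ∀ p : ℝ, 1 ≤ p → ∃ C : ℝ, ∀ a b : ℝ × SpaceE d,
      ∫⁻ ω, ‖X a.1 a.2 ω - X b.1 b.2 ω‖ₑ ^ p ∂P ≤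
        ENNReal.ofReal (C * parabolicDist a b ^ (p * β)) := by
    intro p hp
    obtain ⟨C, hC0, hC1, hC2⟩ := hmom p hp
    have hp0 : 0 ≤ p := by linarith
    have hpβ : 0 ≤ p * β := by positivity
    refine ⟨2 ^ (p - 1) * (C + C), fun a b => ?_⟩
    have hd0 := parabolicDist_nonneg a b
    have h1 : ∫⁻ ω, ‖X a.1 a.2 ω - X a.1 b.2 ω‖ₑ ^ p ∂P ≤
        ENNReal.ofReal (C * parabolicDist a b ^ (p * β)) := by
      refine (hC1 a.2 b.2 a.1).trans (ENNReal.ofReal_le_ofReal ?_)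
      gcongr
      exact le_add_of_nonneg_left (Real.sqrt_nonneg _)
    have h2 : ∫⁻ ω, ‖X a.1 b.2 ω - X b.1 b.2 ω‖ₑ ^ p ∂P ≤
        ENNReal.ofReal (C * parabolicDist a b ^ (p * β)) := by
      refine (hC2 b.1 a.1 b.2).trans (ENNReal.ofReal_le_ofReal ?_)
      have e : |a.1 - b.1| ^ (p * (β / 2)) = √|a.1 - b.1| ^ (p * β) := by
        rw [Real.sqrt_eq_rpow, ← Real.rpow_mul (abs_nonneg _)]
        congr 1
        ring
      rw [e]
      gcongr
      exact le_add_of_nonneg_right (norm_nonneg _)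
    calc ∫⁻ ω, ‖X a.1 a.2 ω - X b.1 b.2 ω‖ₑ ^ p ∂P
        ≤ ∫⁻ ω, 2 ^ (p - 1) * (‖X a.1 a.2 ω - X a.1 b.2 ω‖ₑ ^ p +
            ‖X a.1 b.2 ω - X b.1 b.2 ω‖ₑ ^ p) ∂P := by
          refine lintegral_mono fun ω => ?_
          refine le_trans ?_ (ENNReal.rpow_add_le_mul_rpow_add_rpow _ _ hp)
          refine ENNReal.rpow_le_rpow ?_ hp0
          rw [← sub_add_sub_cancel (X a.1 a.2 ω) (X a.1 b.2 ω) (X b.1 b.2 ω)]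
          exact enorm_add_le _ _
      _ = 2 ^ (p - 1) * (∫⁻ ω, ‖X a.1 a.2 ω - X a.1 b.2 ω‖ₑ ^ p ∂P +
            ∫⁻ ω, ‖X a.1 b.2 ω - X b.1 b.2 ω‖ₑ ^ p ∂P) := by
          have hm := (((hX a.1 a.2).sub (hX a.1 b.2)).enorm.pow_const p)
          have hm' := (((hX a.1 b.2).sub (hX b.1 b.2)).enorm.pow_const p)
          rw [lintegral_const_mul _ (by exact hm.add hm'), lintegral_add_left (by exact hm)]
      _ ≤ ENNReal.ofReal (2 ^ (p - 1)) * (ENNReal.ofReal (C * parabolicDist a b ^ (p * β)) +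
            ENNReal.ofReal (C * parabolicDist a b ^ (p * β))) := by
          rw [← ENNReal.ofReal_rpow_of_pos (by norm_num : (0 : ℝ) < 2), ENNReal.ofReal_ofNat]
          gcongr
      _ = _ := by
          rw [← ENNReal.ofReal_add (by positivity) (by positivity),
            ← ENNReal.ofReal_mul (by positivity)]
          congr 1
          ring
  obtain ⟨w, hw1, hw2⟩ := exists_holder_modification (P := P) (X := fun a : ℝ × SpaceE d => X a.1 a.2)
    (π := parabolicGrid) (B := fun N => {a : ℝ × SpaceE d | |a.1| ≤ N ∧ ‖a.2‖ ≤ N})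
    (κ := 1 + d) (β := β) (fun a => hX a.1 a.2)
    parabolicDist_nonneg parabolicDist_comm parabolicDist_triangle (by positivity)
    parabolicDist_grid_le hB
    (fun N => ⟨(2 * N + 3) ^ (d + 1), 4 ^ (d + 1), one_le_pow₀ (by norm_num),
      fun n => parabolicGrid_image_finite N n⟩) hβ0 hmom'
  refine ⟨fun t x => w (t, x), fun t x => hw1 (t, x), fun ω θ hθ N => ?_⟩
  obtain ⟨C, hC⟩ := hw2 ω θ hθ N
  refine ⟨|C|, fun s t hs ht x z hx hz => (hC (t, x) ⟨ht, hx⟩ (s, z) ⟨hs, hz⟩).trans ?_⟩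
  have h1 := parabolicDist_rpow_le (t, x) (s, z) hθ.1.le (hθ.2.le.trans hβ1)
  have h2 := parabolicDist_nonneg (t, x) (s, z)
  calc C * parabolicDist (t, x) (s, z) ^ θ ≤ |C| * parabolicDist (t, x) (s, z) ^ θ := by
        gcongr; exact le_abs_self C
    _ ≤ _ := by gcongr

end Parabolic

/-! ### Moments of space and time increments -/

section Increments

variable {d : ℕ} {T : ℝ} {Ω : Type*} [MeasurableSpace Ω] {P : Measure Ω} [IsProbabilityMeasure P]
  {μ : Measure (SpaceE d)} {W : TestFn d → Ω → ℝ} {b : ℝ → ℝ} {K : ℝ≥0} {u₀ : SpaceE d → ℝ}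
  {u : ℝ → SpaceE d → Ω → ℝ} {β M H : ℝ}

/-- The common increment bound at scale `ρ = |x-z|^β`. -/
theorem IsMildHeatSolution.exists_space_increment_bound (hW : IsHomogeneousNoise P μ W)
    (hu : IsMildHeatSolution P μ W b u₀ T u) (hT : 0 ≤ T) (hb : LipschitzWith K b)
    (hm : Measurable u₀) (hM : ∀ x, |u₀ x| ≤ M) (hH : ∀ x y, |u₀ x - u₀ y| ≤ H * ‖x - y‖ ^ β)
    (hβ0 : 0 < β) (hβ1 : β ≤ 1)
    (hμ : ∫⁻ ξ, ENNReal.ofReal (1 / (1 + ‖ξ‖ ^ 2) ^ (1 - β)) ∂μ < ∞)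
    {B : ℝ≥0} (hB : ∀ t ∈ Set.Icc (0 : ℝ) T, ∀ x, ∫⁻ ω, ‖u t x ω‖ₑ ^ 2 ∂P ≤ B)
    {p : ℝ} (hp : 1 ≤ p) :
    ∃ C : ℝ, 0 < C ∧ ∀ x z : SpaceE d, ∀ t ∈ Set.Icc (0 : ℝ) T,
      ∫⁻ ω, ‖u t x ω - u t z ω‖ₑ ^ p ∂P ≤ ENNReal.ofReal (C * ‖x - z‖ ^ (p * β)) := by
  have := hW.tempered.sigmaFinite
  obtain ⟨C, hC0, hC⟩ := hu.exists_increment_bound hW hT hb hM hβ0 hμ hB hp (a := H)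
    (V := 4 * (T + 1)) (m := (T + 1) / (1 - β / 2) * 3) (by positivity)
  refine ⟨C, hC0, fun x z t ht => ?_⟩
  have hn := norm_nonneg (x - z)
  rw [mul_comm p β, Real.rpow_mul hn]
  refine hC t ht t ht x z _ (by positivity) (abs_heatFlow_sub_le hm hM hH ht.1 x z) ?_ ?_
  · have e : (‖x - z‖ ^ β) ^ 2 = (‖x - z‖ ^ 2) ^ β := by
      rw [← Real.rpow_mul_natCast hn, ← Real.rpow_natCast_mul hn, mul_comm]
    rw [e]
    exact noiseDistSq_convolutionIntegrand_space_le hβ0 hβ1 ht.1 ht.2 x z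
  · rw [mul_assoc]
    exact lintegral_convolutionIntegrand_space_sub_le hβ0 hβ1 ht.1 ht.2 x z

/-- The common increment bound at scale `ρ = |t-s|^(β/2)`. The kernel estimates assume ordered
times, and symmetry covers the other order. -/
theorem IsMildHeatSolution.exists_time_increment_bound (hd : 1 ≤ d) (hW : IsHomogeneousNoise P μ W)
    (hu : IsMildHeatSolution P μ W b u₀ T u) (hT : 0 ≤ T) (hb : LipschitzWith K b)
    (hm : Measurable u₀) (hM : ∀ x, |u₀ x| ≤ M) (hH0 : 0 ≤ H)
    (hH : ∀ x y, |u₀ x - u₀ y| ≤ H * ‖x - y‖ ^ β) (hβ0 : 0 < β) (hβ1 : β ≤ 1)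
    (hμ : ∫⁻ ξ, ENNReal.ofReal (1 / (1 + ‖ξ‖ ^ 2) ^ (1 - β)) ∂μ < ∞)
    {B : ℝ≥0} (hB : ∀ t ∈ Set.Icc (0 : ℝ) T, ∀ x, ∫⁻ ω, ‖u t x ω‖ₑ ^ 2 ∂P ≤ B)
    {p : ℝ} (hp : 1 ≤ p) :
    ∃ C : ℝ, 0 < C ∧ ∀ s ∈ Set.Icc (0 : ℝ) T, ∀ t ∈ Set.Icc (0 : ℝ) T, ∀ x : SpaceE d,
      ∫⁻ ω, ‖u t x ω - u s x ω‖ₑ ^ p ∂P ≤ ENNReal.ofReal (C * |t - s| ^ (p * (β / 2))) := by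
  have := hW.tempered.sigmaFinite
  obtain ⟨C, hC0, hC⟩ := hu.exists_increment_bound hW hT hb hM hβ0 hμ hB hp
    (a := H * ∫ n : SpaceE d, gaussKernel 1 n * ‖n‖ ^ β)
    (V := 2 * (T + 1)) (m := (T + 1) / (1 - β / 2) * (3 * d)) (by positivity)
  have hmain : ∀ s ∈ Set.Icc (0 : ℝ) T, ∀ t ∈ Set.Icc (0 : ℝ) T, s ≤ t → ∀ x : SpaceE d,
      ∫⁻ ω, ‖u t x ω - u s x ω‖ₑ ^ p ∂P ≤ ENNReal.ofReal (C * |t - s| ^ (p * (β / 2))) := by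
    intro s hs t ht hst x
    have hn : 0 ≤ t - s := by linarith
    rw [mul_comm p, Real.rpow_mul (abs_nonneg _)]
    refine hC t ht s hs x x _ (by positivity)
      (abs_heatFlow_time_sub_le hm hM hH0 hH hβ0 hβ1 hs.1 ht.1 x) ?_ ?_
    · have e : (|t - s| ^ (β / 2)) ^ 2 = (t - s) ^ β := by
        rw [abs_of_nonneg hn, ← Real.rpow_mul_natCast hn]
        congr 1
        push_cast
        ring
      rw [e]
      exact noiseDistSq_convolutionIntegrand_time_le hβ0 hβ1 hs.1 hst ht.2 x
    · rw [abs_of_nonneg hn, mul_assoc]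
      exact lintegral_convolutionIntegrand_time_sub_le hd hβ0 hβ1 hs.1 hst ht.2 x
  refine ⟨C, hC0, fun s hs t ht x => ?_⟩
  rcases le_total s t with h | h
  · exact hmain s hs t ht h x
  · rw [abs_sub_comm]
    simp_rw [enorm_sub_rev (u t x _)]
    exact hmain t ht s hs h x

end Increments

theorem proposition4p8 {d : ℕ} (hd : 1 ≤ d) {Ω : Type*} [MeasurableSpace Ω] (P : Measure Ω)
    [IsProbabilityMeasure P] [P.IsComplete]
    -- the noise and its spectral measure
    (μ : Measure (SpaceE d)) (W : TestFn d → Ω → ℝ) (hW : IsHomogeneousNoise P μ W)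
    (q : ℝ) (hq : q ∈ Set.Ioo (0 : ℝ) 2)
    (hμ : ∫⁻ ξ, ENNReal.ofReal (1 / (1 + ‖ξ‖ ^ q)) ∂μ < ∞)
    -- the drift and the initial condition
    (b : ℝ → ℝ) (hb : ∃ K : ℝ≥0, LipschitzWith K b)
    (u₀ : SpaceE d → ℝ) (hu₀_meas : Measurable u₀) (hu₀_bdd : ∃ M : ℝ, ∀ x, |u₀ x| ≤ M)
    (α : ℝ≥0) (hα_pos : 0 < α) (hα_lt : α < 1) (hu₀_holder : MemHolder α u₀)
    -- the solution
    (T : ℝ) (hT : 0 < T) (u : ℝ → SpaceE d → Ω → ℝ)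
    (hu : IsMildHeatSolution P μ W b u₀ T u)
    (hu_bdd : ∃ K : ℝ≥0, ∀ t ∈ Set.Icc (0 : ℝ) T, ∀ x, ∫⁻ ω, ‖u t x ω‖ₑ ^ 2 ∂P ≤ K)
    (β : ℝ) (hβ : β = min (α : ℝ) (1 - q / 2)) :
    (∀ p : ℝ, 1 ≤ p → ∃ C : ℝ, 0 < C ∧
      (∀ x z : SpaceE d, ∀ t ∈ Set.Icc (0 : ℝ) T,
        ∫⁻ ω, ‖u t x ω - u t z ω‖ₑ ^ p ∂P ≤ ENNReal.ofReal (C * ‖x - z‖ ^ (p * β))) ∧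
      (∀ s ∈ Set.Icc (0 : ℝ) T, ∀ t ∈ Set.Icc (0 : ℝ) T, ∀ x : SpaceE d,
        ∫⁻ ω, ‖u t x ω - u s x ω‖ₑ ^ p ∂P ≤ ENNReal.ofReal (C * |t - s| ^ (p * (β / 2))))) ∧
    -- a version whose paths are jointly Hölder continuous on bounded sets, with every exponent
    -- below `β` in space and below `β / 2` in time
    (∃ w : ℝ → SpaceE d → Ω → ℝ,
      (∀ t ∈ Set.Icc (0 : ℝ) T, ∀ x, Measurable (w t x) ∧ w t x =ᵐ[P] u t x) ∧
      ∀ ω, ∀ θ ∈ Set.Ioo (0 : ℝ) β, ∀ R : ℝ, ∃ C : ℝ,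
        ∀ s ∈ Set.Icc (0 : ℝ) T, ∀ t ∈ Set.Icc (0 : ℝ) T, ∀ x z : SpaceE d, ‖x‖ ≤ R → ‖z‖ ≤ R →
          |w t x ω - w s z ω| ≤ C * (|t - s| ^ (θ / 2) + ‖x - z‖ ^ θ)) := by
  have hα1 : (α : ℝ) < 1 := by exact_mod_cast hα_lt
  have hβ0 : 0 < β := by
    rw [hβ]
    exact lt_min (by exact_mod_cast hα_pos) (by linarith [hq.2])
  have hβα : β ≤ α := hβ.trans_le (min_le_left _ _)
  have hβ1 : β ≤ 1 := hβα.trans hα1.le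
  have hμβ := lintegral_rpow_spectral_lt_top hμ hq.1 (hβ.trans_le (min_le_right _ _))
  obtain ⟨K, hK⟩ := hb
  obtain ⟨M, hM⟩ := hu₀_bdd
  obtain ⟨B, hB⟩ := hu_bdd
  obtain ⟨H, hH0, hH⟩ := hu₀_holder.exists_abs_sub_le_of_bounded hM hβ0 hβα
  have hmom : ∀ p : ℝ, 1 ≤ p → ∃ C : ℝ, 0 < C ∧
      (∀ x z : SpaceE d, ∀ t ∈ Set.Icc (0 : ℝ) T,
        ∫⁻ ω, ‖u t x ω - u t z ω‖ₑ ^ p ∂P ≤ ENNReal.ofReal (C * ‖x - z‖ ^ (p * β))) ∧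
      (∀ s ∈ Set.Icc (0 : ℝ) T, ∀ t ∈ Set.Icc (0 : ℝ) T, ∀ x : SpaceE d,
        ∫⁻ ω, ‖u t x ω - u s x ω‖ₑ ^ p ∂P ≤
          ENNReal.ofReal (C * |t - s| ^ (p * (β / 2)))) := by
    intro p hp
    obtain ⟨C₁, h₁, hC₁⟩ := hu.exists_space_increment_bound hW hT.le hK hu₀_meas hM hH hβ0 hβ1
      hμβ hB hp
    obtain ⟨C₂, h₂, hC₂⟩ := hu.exists_time_increment_bound hd hW hT.le hK hu₀_meas hM hH0 hH hβ0
      hβ1 hμβ hB hp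
    refine ⟨max C₁ C₂, lt_max_of_lt_left h₁, fun x z t ht => (hC₁ x z t ht).trans ?_,
      fun s hs t ht x => (hC₂ s hs t ht x).trans ?_⟩
    · gcongr
      exact le_max_left _ _
    · gcongr
      exact le_max_right _ _
  refine ⟨hmom, ?_⟩
  -- Clamping time extends the field to all of `ℝ × ℝ^d`. The projection is `1`-Lipschitz, so the
  -- moment bounds persist with the same constants.
  have hcl : ∀ t : ℝ, (Set.projIcc 0 T hT.le t : ℝ) ∈ Set.Icc 0 T := fun t => Subtype.coe_prop _
  obtain ⟨w, hw1, hw2⟩ := exists_jointly_holder_modification (P := P)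
    (X := fun t x => u (Set.projIcc 0 T hT.le t) x)
    (fun t x => hu.measurable_apply (hcl t) x) hβ0 hβ1 fun p hp => by
      obtain ⟨C, hC0, hC1, hC2⟩ := hmom p hp
      refine ⟨C, hC0, fun x z t => hC1 x z _ (hcl t), fun s t x =>
        (hC2 _ (hcl s) _ (hcl t) x).trans (ENNReal.ofReal_le_ofReal ?_)⟩
      have hpβ : 0 ≤ p * (β / 2) := mul_nonneg (by linarith) (by linarith)
      exact mul_le_mul_of_nonneg_left
        (Real.rpow_le_rpow (abs_nonneg _) (Set.abs_projIcc_sub_projIcc hT.le) hpβ) hC0.le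
  refine ⟨w, fun t ht x => ⟨(hw1 t x).1, ?_⟩, fun ω θ hθ R => ?_⟩
  · have h := (hw1 t x).2
    rwa [Set.projIcc_of_mem hT.le ht] at h
  · obtain ⟨N, hN⟩ := exists_nat_ge (max T R)
    obtain ⟨C, hC⟩ := hw2 ω θ hθ N
    have htime : ∀ t ∈ Set.Icc (0 : ℝ) T, |t| ≤ N := fun t ht => by
      rw [abs_of_nonneg ht.1]
      exact ht.2.trans ((le_max_left _ _).trans hN)
    have hR : R ≤ N := (le_max_right _ _).trans hN
    exact ⟨C, fun s hs t ht x z hx hz =>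
      hC s t (htime s hs) (htime t ht) x z (hx.trans hR) (hz.trans hR)⟩
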